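/- Let $G$ be an infinite tree rooted at a vertex $\phi$, of uniformly bounded degree and such that each vertex has at least two offspring. For $T\in(0,\infty)$, let $\mathcal{B}\subseteq E(G)\times[0,T)$ be a random collection of bars having the Poisson law of intensity one with respect to the product of counting measure on $E(G)$ and Lebesgue measure on $[0,T)$. Let the meander $X=(X(t))_{t\ge 0}$ be the right-continuous process with left limits in $V(G)\times[0,T)$ that starts at $X(0)=(\phi,0)$, moves at unit speed cyclically upwards, $t\mapsto (v,(h+t) \bmod T)$, from its present location $(v,h)$ until it reaches an endpoint $(v,h')$ of a bar $(\{v,w\},h')\in\mathcal{B}$, at which moment it jumps to the other endpoint $(w,h')$ of this bar, and then continues by the same rule; almost surely, exactly one process $X$ on $[0,\infty)$ follows these rules. The cyclic-time random walk $Y$ with parameter $T$ is the projection of $X$ to $V(G)$. Then there exists $T_0\in(0,\infty)$, depending only on the rooted tree $G$, such that for every $T\ge T_0$ the walk $Y$ is transient: with positive probability, there is $s_0>0$ such that $\phi\notin Y(s_0,\infty)$. -/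

import Mathlib

open MeasureTheory ProbabilityTheory Filter Topology
open scoped NNReal ENNReal

/-- The offspring of `v` in the graph `G` rooted at `φ`: the vertices `w ≠ φ` whose parent is `v`,
that is, those for which `v` is the first vertex after `w` on a simple path from `w` to `φ`
(in a tree there is exactly one such path). -/
def offspring {V : Type*} (G : SimpleGraph V) (φ v : V) : Set V :=
  {w | w ≠ φ ∧ ∃ p : G.Walk w φ, p.IsPath ∧ p.snd = v}

/-- A bar `(e, h)`: the edge `e` that supports it, and its height `h` (which lies in `[0, T)` for
the bar collections considered below). -/
abbrev Bar {V : Type*} (G : SimpleGraph V) : Type _ := G.edgeSet × ℝ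

/-- The edge set is a discrete measurable space. -/
instance instMeasurableSpaceEdgeSet {V : Type*} (G : SimpleGraph V) : MeasurableSpace G.edgeSet :=
  ⊤

/-- Counting measure on the edges times Lebesgue measure on `[0, T)`. -/
noncomputable def barMeasure {V : Type*} (G : SimpleGraph V) (T : ℝ) : Measure (Bar G) :=
  Measure.prod Measure.count (volume.restrict (Set.Ico 0 T))

/-- The number of bars of the collection `B` that lie in `A`. -/
noncomputable def barCount {V : Type*} {G : SimpleGraph V} (A B : Set (Bar G)) : ℕ∞ :=
  (B ∩ A).encard

/-- `B` is a random bar collection in `E(G) × [0, T)` having, under `P`, the Poisson law of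
intensity one with respect to the product of counting and Lebesgue measure. -/
structure IsPoissonBars {V : Type*} (G : SimpleGraph V) (T : ℝ) {Ω : Type*} [MeasurableSpace Ω]
    (P : Measure Ω) (B : Ω → Set (Bar G)) : Prop where
  /-- All heights are in `[0, T)`. -/
  height_mem : ∀ ω, ∀ b ∈ B ω, b.2 ∈ Set.Ico 0 T
  /-- The number of bars in a measurable set is a random variable. -/
  measurable_count : ∀ A : Set (Bar G), MeasurableSet A → Measurable fun ω => barCount A (B ω)
  /-- The number of bars in a set of finite measure is Poisson, with that measure as its mean. -/
  law_count : ∀ A : Set (Bar G), MeasurableSet A → barMeasure G T A < ∞ → ∀ k : ℕ,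
    P {ω | barCount A (B ω) = k} = poissonMeasure (barMeasure G T A).toNNReal {k}
  /-- The numbers of bars in disjoint sets are independent. -/
  indep_count : ∀ (n : ℕ) (A : Fin n → Set (Bar G)), (∀ i, MeasurableSet (A i)) →
    Pairwise (Function.onFun Disjoint A) → iIndepFun (fun i ω => barCount (A i) (B ω)) P

/-- The height in `[0, T)` reached by unit-speed cyclic upward motion from height `h` after
time `t`, namely `(h + t) mod T`. -/
noncomputable def cyclicHeight {T : ℝ} (hT : 0 < T) (h : ℝ) (t : ℝ≥0) : ℝ :=
  toIcoMod hT 0 (h + t)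

/-- `(v, h)` is a joint of a bar in `B`. -/
def IsJoint {V : Type*} {G : SimpleGraph V} (B : Set (Bar G)) (v : V) (h : ℝ) : Prop :=
  ∃ b ∈ B, v ∈ (b.1 : Sym2 V) ∧ b.2 = h

/-- `X` is the cyclic-time meander among the bars `B`, with initial condition `x₀`. -/
structure IsMeander {V : Type*} {G : SimpleGraph V} {T : ℝ} (hT : 0 < T) (B : Set (Bar G))
    (x₀ : V × ℝ) (X : ℝ≥0 → V × ℝ) : Prop where
  /-- The initial condition. -/
  init : X 0 = x₀
  /-- From any time `s` on, the process pursues unit-speed cyclic upward motion as long as this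
  reaches no joint. -/
  flow : ∀ s t : ℝ≥0, 0 < t →
    (∀ r : ℝ≥0, 0 < r → r ≤ t → ¬ IsJoint B (X s).1 (cyclicHeight hT (X s).2 r)) →
    X (s + t) = ((X s).1, cyclicHeight hT (X s).2 t)
  /-- When, after time `s`, this motion first reaches a joint of a bar, the process jumps to the
  other joint of the bar. -/
  jump : ∀ s t : ℝ≥0, 0 < t →
    (∀ r : ℝ≥0, 0 < r → r < t → ¬ IsJoint B (X s).1 (cyclicHeight hT (X s).2 r)) →
    ∀ b ∈ B, ∀ w : V, (b.1 : Sym2 V) = s((X s).1, w) → b.2 = cyclicHeight hT (X s).2 t →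
    X (s + t) = (w, cyclicHeight hT (X s).2 t)
  /-- Right-continuity, the vertex set being discrete. (The height at time `t` is always
  `(h + t) mod T`, so only the vertex matters.) -/
  right_cont : ∀ s : ℝ≥0, ∀ᶠ t in 𝓝[>] s, (X t).1 = (X s).1
  /-- Existence of left limits. -/
  left_lim : ∀ s : ℝ≥0, ∃ v : V, ∀ᶠ t in 𝓝[<] s, (X t).1 = v

open Classical in
/-- Cyclic-time walk among the bars `B`, begun at `v`: the projection to the vertices of the
meander from `(v, 0)`. (The constant walk if the rules fail to define a meander on `[0, ∞)`.) -/
noncomputable def cyclicWalk {V : Type*} {G : SimpleGraph V} {T : ℝ} (hT : 0 < T)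
    (B : Set (Bar G)) (v : V) : ℝ≥0 → V :=
  if h : ∃ X, IsMeander hT B (v, 0) X then fun t => (h.choose t).1 else fun _ => v

/-- The vertex-valued process `Y` is transient with respect to `φ`: with positive probability there
is `s₀ > 0` such that `Y` is never at `φ` during `(s₀, ∞)`. The event is asked to contain a
measurable set of positive probability, so that no use is made of outer measure. -/
def IsTransient {V Ω : Type*} [MeasurableSpace Ω] (P : Measure Ω) (Y : Ω → ℝ≥0 → V) (φ : V) :
    Prop :=
  ∃ A : Set Ω, MeasurableSet A ∧ 0 < P A ∧
    ∀ ω ∈ A, ∃ s₀ : ℝ≥0, 0 < s₀ ∧ ∀ s : ℝ≥0, s₀ < s → Y ω s ≠ φ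

/-!
# Transience of the cyclic-time random walk for large `T`

The time circle is cut into `N` cells of equal length, and an edge, labelled by its lower endpoint
`y`, is said to carry the bit `(y, c)` if it has a bar in cell `c`. The bits are independent, each
of them having probability `r = 1 - exp (-T / N)` (`Presents.isBernoulliSet_barBits`). For given
`n`, with a probability that tends to one as `N → ∞`, no cell contains two bars on edges down to
depth `n + 1` (`Presents.tendsto_measure_crowded`), and then the meander, until it reaches depth
`n`, follows a walk that is a function of the bits (`IsFaithful.step`). So it suffices to bound
from below, uniformly in `n` and `N`, the probability that this walk starts with an escape: it
leaves the root through the only bar at the root, and does not return through this bar before it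
reaches depth `n`. The meander then satisfies this for infinitely many `n` with positive
probability, and as it visits finitely many vertices in finite time, it never comes back.

The heart of the matter is `escapeBound`: whatever has been revealed outside the subtree of `w`, the
walk that enters this subtree for the first time leaves it again, through the edge above `w` and
before reaching depth `n`, with conditional probability at most `1 - p`. This is an induction on
`n - depth w`. It rests on the exploration of the bits along the walk, all probabilities being
compared on the events `bitCylinder b D O` on which the bits in the finite set `D` are known.

* During the first half turn of the clock, the walk inside the subtree of `w` meets unexplored cells
  only. As each vertex has at least two children, its next bar leads down at least twice as often as
  up. A walk with this drift has a good chance to reach height `2 * K` above `w`, within half a turn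
  when `T` is large, and to leave behind it of the order of `K` ancestors that it has visited only
  once, at even heights. `runPotential` is a submartingale which measures the expected number of
  such ancestors, and `exitEvent_le_of_run` follows it.
* To exit, the walk has to come back through all these ancestors. When it comes back to one of them,
  `u`, from the child `y`, it is with probability at least `1 / 2` at a time of the clock when the
  edges from `u` to its other children are still unexplored. Then with probability at least `ρ` the
  next bar leads to an unvisited child, from whose subtree the walk escapes with probability `p` by
  the induction hypothesis (`exitEvent_le_of_return`). So each such ancestor reduces the
  probability of the exit by the factor `1 - ρ * p / 2` (`exitEvent_le_pow`).
* The gain is of the order of `ρ * p * K`, which is at least `p` if `K` is a large multiple of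
  `1 / ρ`. Here `ρ` depends on the degree bound alone, and `p = 1 / K` will do.

That the meander is almost surely well defined follows from a percolation argument. The bars in a
short time interval form a subcritical percolation on the edges, so that all its open clusters are
finite; hence the jumps of the meander do not accumulate, and it is determined by its successive
steps (`Presents.ae_isGoodBars`, `IsGoodBars.existsUnique_isMeander`).
-/

/-! ### Rooted trees -/

/-- A rooted tree presented by its parent map, the distance to the root, and the finite sets of
children. The parent of the root is a junk value. -/
structure ParentTree (V : Type*) where
  /-- The parent of a vertex. -/
  parent : V → V
  /-- The distance from the root. -/
  depth : V → ℕ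
  /-- The children of a vertex. -/
  children : V → Finset V
  mem_children : ∀ {x y}, y ∈ children x ↔ parent y = x ∧ 0 < depth y
  depth_parent : ∀ {y}, 0 < depth y → depth (parent y) + 1 = depth y

namespace ParentTree

variable {V : Type*} (R : ParentTree V)

/-- `R.Below y x`: the vertex `x` lies in the subtree hanging from `y` (which includes `y`). -/
def Below (y x : V) : Prop := R.depth y ≤ R.depth x ∧ R.parent^[R.depth x - R.depth y] x = y

variable {R}

theorem depth_child {x y : V} (h : y ∈ R.children x) : R.depth y = R.depth x + 1 := by
  obtain ⟨rfl, h'⟩ := R.mem_children.1 h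
  exact (R.depth_parent h').symm

theorem parent_child {x y : V} (h : y ∈ R.children x) : R.parent y = x :=
  (R.mem_children.1 h).1

theorem mem_children_parent {y : V} (h : 0 < R.depth y) : y ∈ R.children (R.parent y) :=
  R.mem_children.2 ⟨rfl, h⟩

theorem not_mem_children_self (x : V) : x ∉ R.children x := fun h => by
  have := depth_child h
  omega

theorem ne_of_mem_children {x y : V} (h : y ∈ R.children x) : y ≠ x := by
  rintro rfl
  exact not_mem_children_self _ h

theorem Below.refl (x : V) : R.Below x x := ⟨le_rfl, by simp⟩

theorem Below.depth_le {x y : V} (h : R.Below y x) : R.depth y ≤ R.depth x := h.1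

theorem Below.eq_of_depth_eq {x y z : V} (h : R.Below y x) (h' : R.Below z x)
    (hd : R.depth y = R.depth z) : y = z := by
  rw [← h.2, ← h'.2, hd]

theorem Below.eq_of_depth_le {x y : V} (h : R.Below y x) (hd : R.depth x ≤ R.depth y) : y = x :=
  h.eq_of_depth_eq (Below.refl x) (le_antisymm h.1 hd)

theorem Below.depth_lt {x y : V} (h : R.Below y x) (hne : x ≠ y) : R.depth y < R.depth x := by
  by_contra hc
  exact hne (h.eq_of_depth_le (not_lt.1 hc)).symm

theorem Below.child {x y z : V} (h : R.Below y x) (hz : z ∈ R.children x) : R.Below y z := by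
  have h1 := depth_child hz
  refine ⟨by have := h.1; omega, ?_⟩
  have : R.depth z - R.depth y = (R.depth x - R.depth y) + 1 := by have := h.1; omega
  rw [this, Function.iterate_succ_apply, parent_child hz, h.2]

theorem Below.parent {x y : V} (h : R.Below y x) (hne : x ≠ y) : R.Below y (R.parent x) := by
  have hlt := h.depth_lt hne
  have hp := R.depth_parent (y := x) (by omega)
  refine ⟨by omega, ?_⟩
  have : R.depth x - R.depth y = (R.depth (R.parent x) - R.depth y) + 1 := by omega
  have h2 := h.2
  rwa [this, Function.iterate_succ_apply] at h2

theorem Below.trans {x y z : V} (h : R.Below z y) (h' : R.Below y x) : R.Below z x := by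
  refine ⟨h.1.trans h'.1, ?_⟩
  have h1 := h.1
  have h2 := h'.1
  have : R.depth x - R.depth z = (R.depth y - R.depth z) + (R.depth x - R.depth y) := by omega
  rw [this, Function.iterate_add_apply, h'.2, h.2]

theorem Below.of_depth_le {x y z : V} (h : R.Below y x) (h' : R.Below z x)
    (hd : R.depth z ≤ R.depth y) : R.Below z y := by
  refine ⟨hd, ?_⟩
  have h1 := h.1
  have : R.depth x - R.depth z = (R.depth y - R.depth z) + (R.depth x - R.depth y) := by omega
  have h2 := h'.2
  rwa [this, Function.iterate_add_apply, h.2] at h2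

theorem not_below_child {u y : V} (h : y ∈ R.children u) : ¬ R.Below y u := fun hb => by
  have := depth_child h
  have := hb.1
  omega

theorem Below.ne_child {w u y : V} (h : R.Below w u) (hy : y ∈ R.children u) : y ≠ w := by
  rintro rfl
  exact not_below_child hy h

theorem children_eq_of_below {u y z x : V} (hy : y ∈ R.children u) (hz : z ∈ R.children u)
    (h : R.Below y x) (h' : R.Below z x) : y = z :=
  h.eq_of_depth_eq h' (by rw [depth_child hy, depth_child hz])

variable [DecidableEq V]

variable (R) in
/-- The edges at `x`, each of them labelled by its endpoint that is farther from the root. -/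
def star (x : V) : Finset V := insert x (R.children x)

theorem mem_star {x y : V} : y ∈ R.star x ↔ y = x ∨ y ∈ R.children x := Finset.mem_insert

theorem self_mem_star (x : V) : x ∈ R.star x := Finset.mem_insert_self _ _

theorem child_mem_star {x y : V} (h : y ∈ R.children x) : y ∈ R.star x :=
  Finset.mem_insert_of_mem h

theorem Below.star {x y z : V} (h : R.Below y x) (hz : z ∈ R.star x) : R.Below y z := by
  rcases mem_star.1 hz with rfl | hz
  · exact h
  · exact h.child hz

theorem card_star (x : V) : (R.star x).card = (R.children x).card + 1 :=
  Finset.card_insert_of_notMem (not_mem_children_self x)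

/-! ### The discretised walk -/

/-- The walk among the discretised bars `b`: a pair `(y, c)` in `b` is a bar in the `c`-th of `N`
cells of the time circle, on the edge from `y` to its parent. `R.Exits n N b w k x t` says that
the walk, at vertex `x` at the beginning of cell `t % N`, leaves the subtree of `w` through the
edge above `w` within `k` cells, before it reaches depth `n`, and that it never sees two bars at
its current vertex in the same cell. -/
def Exits (n N : ℕ) (b : Set (V × ℕ)) (w : V) : ℕ → V → ℕ → Prop
  | 0, _, _ => False
  | k + 1, x, t => R.depth x < n ∧
      (((∀ z ∈ R.star x, (z, t % N) ∉ b) ∧ Exits n N b w k x (t + 1)) ∨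
       (∃ y ∈ R.children x, (∀ z ∈ R.star x, (z, t % N) ∈ b ↔ z = y) ∧
          Exits n N b w k y (t + 1)) ∨
       ((∀ z ∈ R.star x, (z, t % N) ∈ b ↔ z = x) ∧
          (x = w ∨ Exits n N b w k (R.parent x) (t + 1))))

variable {n N : ℕ} {b : Set (V × ℕ)} {w x y : V} {k t : ℕ}

theorem exits_succ_none (hx : R.depth x < n) (h : ∀ z ∈ R.star x, (z, t % N) ∉ b) :
    R.Exits n N b w (k + 1) x t ↔ R.Exits n N b w k x (t + 1) := by
  rw [Exits]
  constructor
  · rintro ⟨-, ⟨-, h'⟩ | ⟨y, hy, h', -⟩ | ⟨h', -⟩⟩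
    · exact h'
    · exact absurd ((h' y (child_mem_star hy)).2 rfl) (h y (child_mem_star hy))
    · exact absurd ((h' x (self_mem_star x)).2 rfl) (h x (self_mem_star x))
  · exact fun h' => ⟨hx, Or.inl ⟨h, h'⟩⟩

theorem exits_succ_child (hx : R.depth x < n) (hy : y ∈ R.children x)
    (h : ∀ z ∈ R.star x, (z, t % N) ∈ b ↔ z = y) :
    R.Exits n N b w (k + 1) x t ↔ R.Exits n N b w k y (t + 1) := by
  rw [Exits]
  constructor
  · rintro ⟨-, ⟨h', -⟩ | ⟨y', hy', h', h2⟩ | ⟨h', -⟩⟩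
    · exact absurd ((h y (child_mem_star hy)).2 rfl) (h' y (child_mem_star hy))
    · have := (h y' (child_mem_star hy')).1 ((h' y' (child_mem_star hy')).2 rfl)
      rwa [this] at h2
    · have := (h x (self_mem_star x)).1 ((h' x (self_mem_star x)).2 rfl)
      exact absurd this.symm (ne_of_mem_children hy)
  · exact fun h' => ⟨hx, Or.inr (Or.inl ⟨y, hy, h, h'⟩)⟩

theorem exits_succ_up (hx : R.depth x < n) (h : ∀ z ∈ R.star x, (z, t % N) ∈ b ↔ z = x) :
    R.Exits n N b w (k + 1) x t ↔ (x = w ∨ R.Exits n N b w k (R.parent x) (t + 1)) := by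
  rw [Exits]
  constructor
  · rintro ⟨-, ⟨h', -⟩ | ⟨y, hy, h', -⟩ | ⟨-, h'⟩⟩
    · exact absurd ((h x (self_mem_star x)).2 rfl) (h' x (self_mem_star x))
    · have := (h y (child_mem_star hy)).1 ((h' y (child_mem_star hy)).2 rfl)
      exact absurd this (ne_of_mem_children hy)
    · exact h'
  · exact fun h' => ⟨hx, Or.inr (Or.inr ⟨h, h'⟩)⟩

theorem not_exits_of_two {z z' : V} (hz : z ∈ R.star x) (hz' : z' ∈ R.star x) (hne : z ≠ z')
    (hb : (z, t % N) ∈ b) (hb' : (z', t % N) ∈ b) : ¬ R.Exits n N b w k x t := by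
  cases k with
  | zero => simp [Exits]
  | succ k =>
    rw [Exits]
    rintro ⟨-, ⟨h', -⟩ | ⟨y, hy, h', -⟩ | ⟨h', -⟩⟩
    · exact h' z hz hb
    · exact hne (((h' z hz).1 hb).trans ((h' z' hz').1 hb').symm)
    · exact hne (((h' z hz).1 hb).trans ((h' z' hz').1 hb').symm)

theorem not_exits_of_depth (hx : n ≤ R.depth x) : ¬ R.Exits n N b w k x t := by
  cases k with
  | zero => simp [Exits]
  | succ k =>
    rw [Exits]
    rintro ⟨h, -⟩
    omega

theorem exits_mono (h : R.Exits n N b w k x t) : R.Exits n N b w (k + 1) x t := by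
  induction k generalizing x t with
  | zero => simp [Exits] at h
  | succ k ih =>
    rw [Exits] at h ⊢
    obtain ⟨hx, ⟨h', h2⟩ | ⟨y, hy, h', h2⟩ | ⟨h', h2⟩⟩ := h
    · exact ⟨hx, Or.inl ⟨h', ih h2⟩⟩
    · exact ⟨hx, Or.inr (Or.inl ⟨y, hy, h', ih h2⟩)⟩
    · exact ⟨hx, Or.inr (Or.inr ⟨h', h2.imp_right ih⟩)⟩

/-- While no bar is met, time passes. -/
theorem exits_wait (hx : R.depth x < n) (j : ℕ)
    (h : ∀ i < j, ∀ z ∈ R.star x, (z, (t + i) % N) ∉ b)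
    (hE : R.Exits n N b w k x t) : R.Exits n N b w (k - j) x (t + j) := by
  induction j with
  | zero => exact hE
  | succ j ih =>
    have h1 := ih (fun i hi => h i (by omega))
    rcases Nat.eq_zero_or_pos (k - j) with h0 | h0
    · rw [h0] at h1
      simp [Exits] at h1
    · obtain ⟨m, hm⟩ := Nat.exists_eq_add_of_le' h0
      rw [hm] at h1
      have h2 : k - (j + 1) = m := by omega
      rw [h2]
      exact (exits_succ_none hx (h j (by omega))).1 h1

/-- If the walk at `x` meets no bar in `j` cells, and then exactly one bar, which leads to the
child `y`, it goes to `y`. -/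
theorem exits_wait_child (j : ℕ) (h : ∀ i < j, ∀ z ∈ R.star x, (z, (t + i) % N) ∉ b)
    (hy : y ∈ R.children x) (h' : ∀ z ∈ R.star x, (z, (t + j) % N) ∈ b ↔ z = y)
    (hE : R.Exits n N b w k x t) : R.Exits n N b w (k - (j + 1)) y (t + j + 1) := by
  have hx : R.depth x < n := by
    by_contra hc
    exact not_exits_of_depth (not_lt.1 hc) hE
  have h1 := exits_wait hx j h hE
  rcases Nat.eq_zero_or_pos (k - j) with h0 | h0
  · rw [h0] at h1
    simp [Exits] at h1
  · obtain ⟨m, hm⟩ := Nat.exists_eq_add_of_le' h0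
    rw [hm] at h1
    have h2 : k - (j + 1) = m := by omega
    rw [h2]
    exact (exits_succ_child hx hy h').1 h1

end ParentTree

/-! ### Cylinder events -/

section Cylinder

variable {Ω ι : Type*} {b : Ω → Set ι}

/-- The event that the random set `b` agrees with `O` on `D`. -/
def bitCylinder (b : Ω → Set ι) (D O : Finset ι) : Set Ω := {ω | ∀ q ∈ D, q ∈ b ω ↔ q ∈ O}

theorem bitCylinder_insert_true [DecidableEq ι] {D O : Finset ι} {q : ι} (hq : q ∉ D) :
    bitCylinder b (insert q D) (insert q O) = bitCylinder b D O ∩ {ω | q ∈ b ω} := by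
  ext ω
  simp only [bitCylinder, Set.mem_ofPred_eq, Set.mem_inter_iff, Finset.mem_insert, forall_eq_or_imp,
    true_or, iff_true]
  constructor
  · rintro ⟨h1, h2⟩
    refine ⟨fun a ha => ?_, h1⟩
    have : a ≠ q := fun h => hq (h ▸ ha)
    simpa [this] using h2 a ha
  · rintro ⟨h1, h2⟩
    refine ⟨h2, fun a ha => ?_⟩
    have : a ≠ q := fun h => hq (h ▸ ha)
    simpa [this] using h1 a ha

theorem bitCylinder_insert_false [DecidableEq ι] {D O : Finset ι} {q : ι} (hq : q ∉ O) :
    bitCylinder b (insert q D) O = bitCylinder b D O \ {ω | q ∈ b ω} := by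
  ext ω
  simp only [bitCylinder, Set.mem_ofPred_eq, Set.mem_sdiff, Finset.mem_insert, forall_eq_or_imp]
  tauto

/-- Each valid index belongs to the random set `b` with probability `r`, independently of what is
known about finitely many other indices. -/
structure IsBernoulliSet [MeasurableSpace Ω] (P : Measure Ω) (b : Ω → Set ι) (valid : Set ι)
    (r : ℝ) : Prop where
  measurableSet_mem : ∀ q, MeasurableSet {ω | q ∈ b ω}
  prob : ∀ (D O : Finset ι) (q : ι), q ∉ D → q ∈ valid →
    P.real (bitCylinder b D O ∩ {ω | q ∈ b ω}) = r * P.real (bitCylinder b D O)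

variable [MeasurableSpace Ω] {P : Measure Ω} {valid : Set ι} {r : ℝ}

theorem sum_powerset_mass (r : ℝ) (Q : Finset ι) :
    ∑ A ∈ Q.powerset, r ^ A.card * (1 - r) ^ (Q.card - A.card) = 1 := by
  rw [Finset.sum_pow_mul_eq_add_pow]
  simp

namespace IsBernoulliSet

variable [DecidableEq ι]

theorem real_insert_true (hb : IsBernoulliSet P b valid r) {D O : Finset ι} {q : ι} (hq : q ∉ D)
    (hv : q ∈ valid) :
    P.real (bitCylinder b (insert q D) (insert q O)) = r * P.real (bitCylinder b D O) := by
  rw [bitCylinder_insert_true hq, hb.prob D O q hq hv]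

theorem real_insert_false [IsProbabilityMeasure P] (hb : IsBernoulliSet P b valid r)
    {D O : Finset ι} {q : ι} (hq : q ∉ D) (hO : O ⊆ D) (hv : q ∈ valid) :
    P.real (bitCylinder b (insert q D) O) = (1 - r) * P.real (bitCylinder b D O) := by
  have h := measureReal_inter_add_sdiff (μ := P) (s := bitCylinder b D O) (hb.measurableSet_mem q)
  rw [hb.prob D O q hq hv] at h
  rw [bitCylinder_insert_false (fun h => hq (hO h))]
  linarith

/-- Exploration of the indices in `Q`: the total probability formula, and the probabilities of
the outcomes. -/
theorem split [IsProbabilityMeasure P] (hb : IsBernoulliSet P b valid r)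
    (F : Set Ω) {D O : Finset ι} (hO : O ⊆ D) (Q : Finset ι) (hQ : Disjoint Q D)
    (hv : ∀ q ∈ Q, q ∈ valid) :
    P.real (bitCylinder b D O ∩ F)
        = ∑ A ∈ Q.powerset, P.real (bitCylinder b (D ∪ Q) (O ∪ A) ∩ F) ∧
    ∀ A ∈ Q.powerset, P.real (bitCylinder b (D ∪ Q) (O ∪ A))
        = r ^ A.card * (1 - r) ^ (Q.card - A.card) * P.real (bitCylinder b D O) := by
  induction Q using Finset.induction_on with
  | empty => simp
  | insert q Q hq ih =>
    have hqD : q ∉ D := fun h => (Finset.disjoint_left.1 hQ (Finset.mem_insert_self q Q)) h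
    have hQD : Disjoint Q D := Finset.disjoint_of_subset_left (Finset.subset_insert q Q) hQ
    obtain ⟨ih1, ih2⟩ := ih hQD (fun a ha => hv a (Finset.mem_insert_of_mem ha))
    have hqv := hv q (Finset.mem_insert_self q Q)
    have hqDQ : q ∉ D ∪ Q := by simp [hqD, hq]
    have hsub : ∀ A ∈ Q.powerset, O ∪ A ⊆ D ∪ Q := fun A hA =>
      Finset.union_subset_union hO (Finset.mem_powerset.1 hA)
    have hDQ : D ∪ insert q Q = insert q (D ∪ Q) := Finset.union_insert q D Q
    have hOA : ∀ A, O ∪ insert q A = insert q (O ∪ A) := fun A => Finset.union_insert q O A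
    constructor
    · rw [Finset.sum_powerset_insert hq, ih1, ← Finset.sum_add_distrib]
      refine Finset.sum_congr rfl fun A hA => ?_
      rw [hDQ, hOA, bitCylinder_insert_true hqDQ,
        bitCylinder_insert_false (fun h => hqDQ (hsub A hA h))]
      rw [← measureReal_inter_add_sdiff (μ := P) (s := bitCylinder b (D ∪ Q) (O ∪ A) ∩ F)
        (hb.measurableSet_mem q), add_comm]
      congr 2
      · ext; simp; tauto
      · ext; simp; tauto
    · intro A hA
      rw [hDQ]
      by_cases hqA : q ∈ A
      · obtain ⟨A', hqA', rfl⟩ : ∃ A', q ∉ A' ∧ A = insert q A' :=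
          ⟨A.erase q, Finset.notMem_erase q A, (Finset.insert_erase hqA).symm⟩
        have hA' : A' ∈ Q.powerset := by
          rw [Finset.mem_powerset] at hA ⊢
          intro a ha
          have := hA (Finset.mem_insert_of_mem ha)
          rcases Finset.mem_insert.1 this with rfl | h
          · exact absurd ha hqA'
          · exact h
        rw [hOA, hb.real_insert_true hqDQ hqv, ih2 A' hA', Finset.card_insert_of_notMem hqA',
          Finset.card_insert_of_notMem hq, Nat.add_sub_add_right]
        ring
      · have hA' : A ∈ Q.powerset := by
          rw [Finset.mem_powerset] at hA ⊢
          exact (Finset.subset_insert_iff_of_notMem hqA).1 hA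
        have hc := Finset.card_le_card (Finset.mem_powerset.1 hA')
        rw [hb.real_insert_false hqDQ (hsub A hA') hqv, ih2 A hA',
          Finset.card_insert_of_notMem hq, Nat.sub_add_comm hc]
        ring

/-- If each outcome `A` of the exploration of `Q` allows the bound `c - g A` for the conditional
probability of `F`, then the bound before the exploration is lower than `c` by the mean of the
gains `g A`. -/
theorem le_of_split [IsProbabilityMeasure P] (hb : IsBernoulliSet P b valid r)
    (F : Set Ω) {D O : Finset ι} (hO : O ⊆ D) (Q : Finset ι) (hQ : Disjoint Q D)
    (hv : ∀ q ∈ Q, q ∈ valid) (c : ℝ) (g : Finset ι → ℝ)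
    (h : ∀ A ⊆ Q, P.real (bitCylinder b (D ∪ Q) (O ∪ A) ∩ F)
      ≤ (c - g A) * P.real (bitCylinder b (D ∪ Q) (O ∪ A))) :
    P.real (bitCylinder b D O ∩ F)
      ≤ (c - ∑ A ∈ Q.powerset, r ^ A.card * (1 - r) ^ (Q.card - A.card) * g A)
        * P.real (bitCylinder b D O) := by
  obtain ⟨h1, h2⟩ := hb.split F hO Q hQ hv
  rw [h1]
  calc _ ≤ ∑ A ∈ Q.powerset, (c - g A) *
        (r ^ A.card * (1 - r) ^ (Q.card - A.card) * P.real (bitCylinder b D O)) := by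
        refine Finset.sum_le_sum fun A hA => ?_
        rw [← h2 A hA]
        exact h A (Finset.mem_powerset.1 hA)
    _ = _ := by
        have h3 := sum_powerset_mass r Q
        rw [sub_mul, Finset.sum_mul]
        have h4 : c * P.real (bitCylinder b D O) = ∑ A ∈ Q.powerset,
            r ^ A.card * (1 - r) ^ (Q.card - A.card) * (c * P.real (bitCylinder b D O)) := by
          rw [← Finset.sum_mul, h3, one_mul]
        rw [h4, ← Finset.sum_sub_distrib]
        exact Finset.sum_congr rfl fun A _ => by ring

/-- A variant of `le_of_split` in which only the outcomes with at most one element bring gains. -/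
theorem le_of_split_card_le_one [IsProbabilityMeasure P] (hb : IsBernoulliSet P b valid r)
    (F : Set Ω) {D O : Finset ι} (hO : O ⊆ D) (Q : Finset ι) (hQ : Disjoint Q D)
    (hv : ∀ q ∈ Q, q ∈ valid) (c g₀ : ℝ) (g : ι → ℝ)
    (h₀ : P.real (bitCylinder b (D ∪ Q) O ∩ F) ≤ (c - g₀) * P.real (bitCylinder b (D ∪ Q) O))
    (h₁ : ∀ q ∈ Q, P.real (bitCylinder b (D ∪ Q) (O ∪ {q}) ∩ F)
      ≤ (c - g q) * P.real (bitCylinder b (D ∪ Q) (O ∪ {q})))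
    (h₂ : ∀ A ⊆ Q, 1 < A.card → P.real (bitCylinder b (D ∪ Q) (O ∪ A) ∩ F)
      ≤ c * P.real (bitCylinder b (D ∪ Q) (O ∪ A))) :
    P.real (bitCylinder b D O ∩ F)
      ≤ (c - ((1 - r) ^ Q.card * g₀ + r * (1 - r) ^ (Q.card - 1) * ∑ q ∈ Q, g q))
        * P.real (bitCylinder b D O) := by
  set G : Finset ι → ℝ := fun A =>
    (if A = ∅ then g₀ else 0) + ∑ q ∈ Q, if A = {q} then g q else 0 with hG
  have h := hb.le_of_split F hO Q hQ hv c G fun A hA => by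
    rcases Nat.lt_or_ge 1 A.card with h1 | h1
    · have hA0 : A ≠ ∅ := by rintro rfl; simp at h1
      have hA1 : ∀ q, A ≠ {q} := by rintro q rfl; simp at h1
      have : G A = 0 := by simp [hG, hA0, hA1]
      rw [this, sub_zero]
      exact h₂ A hA h1
    · rcases Nat.le_one_iff_eq_zero_or_eq_one.1 h1 with h1 | h1
      · rw [Finset.card_eq_zero] at h1
        subst h1
        have : G ∅ = g₀ := by
          simp only [hG, if_true, add_eq_left]
          exact Finset.sum_eq_zero fun q _ => if_neg (Finset.singleton_ne_empty q).symm
        rw [this, Finset.union_empty]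
        exact h₀
      · obtain ⟨q, rfl⟩ := Finset.card_eq_one.1 h1
        have hq : q ∈ Q := Finset.singleton_subset_iff.1 hA
        have : G {q} = g q := by
          simp only [hG, Finset.singleton_ne_empty, if_false, zero_add, Finset.singleton_inj]
          rw [Finset.sum_ite_eq, if_pos hq]
        rw [this]
        exact h₁ q hq
  convert h using 3
  simp only [hG, mul_add, Finset.sum_add_distrib, Finset.mul_sum]
  congr 1
  · rw [Finset.sum_eq_single ∅]
    · simp
    · intro A _ hA; simp [hA]
    · simp
  · rw [Finset.sum_comm]
    refine Finset.sum_congr rfl fun q hq => ?_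
    rw [Finset.sum_eq_single {q}]
    · simp
    · intro A _ hA; simp [hA]
    · simp [hq]

end IsBernoulliSet

end Cylinder

/-! ### Excursions of the discretised walk -/

namespace ParentTree

variable {V Ω : Type*} [DecidableEq V]

/-- The indices of the bits: an edge, labelled by its lower endpoint, and one of `N` cells. -/
def slots (R : ParentTree V) (N : ℕ) : Set (V × ℕ) := {q | 0 < R.depth q.1 ∧ q.2 < N}

/-- The event that the discretised walk exits, see `ParentTree.Exits`. -/
def exitEvent (R : ParentTree V) (n N : ℕ) (b : Ω → Set (V × ℕ)) (w : V) (k : ℕ) (x : V)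
    (t : ℕ) : Set Ω := {ω | R.Exits n N (b ω) w k x t}

variable {R : ParentTree V} {n N : ℕ} {b : Ω → Set (V × ℕ)} {w x y u : V} {k t : ℕ}
  {D O : Finset (V × ℕ)}

theorem inter_exitEvent_of_depth (hx : n ≤ R.depth x) (S : Set Ω) :
    S ∩ R.exitEvent n N b w k x t = ∅ :=
  Set.eq_empty_of_forall_notMem fun _ h => not_exits_of_depth hx h.2

theorem inter_exitEvent_none (hx : R.depth x < n) (hD : ∀ z ∈ R.star x, (z, t % N) ∈ D)
    (hO : ∀ z ∈ R.star x, (z, t % N) ∉ O) :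
    bitCylinder b D O ∩ R.exitEvent n N b w (k + 1) x t
      = bitCylinder b D O ∩ R.exitEvent n N b w k x (t + 1) := by
  ext ω
  refine and_congr_right fun h => exits_succ_none hx fun z hz => ?_
  rw [h _ (hD z hz)]
  exact hO z hz

theorem inter_exitEvent_child (hx : R.depth x < n) (hy : y ∈ R.children x)
    (hD : ∀ z ∈ R.star x, (z, t % N) ∈ D) (hO : ∀ z ∈ R.star x, (z, t % N) ∈ O ↔ z = y) :
    bitCylinder b D O ∩ R.exitEvent n N b w (k + 1) x t
      = bitCylinder b D O ∩ R.exitEvent n N b w k y (t + 1) := by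
  ext ω
  refine and_congr_right fun h => exits_succ_child hx hy fun z hz => ?_
  rw [h _ (hD z hz)]
  exact hO z hz

theorem inter_exitEvent_up (hx : R.depth x < n) (hxw : x ≠ w)
    (hD : ∀ z ∈ R.star x, (z, t % N) ∈ D) (hO : ∀ z ∈ R.star x, (z, t % N) ∈ O ↔ z = x) :
    bitCylinder b D O ∩ R.exitEvent n N b w (k + 1) x t
      = bitCylinder b D O ∩ R.exitEvent n N b w k (R.parent x) (t + 1) := by
  ext ω
  refine and_congr_right fun h => (exits_succ_up hx fun z hz => ?_).trans (or_iff_right hxw)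
  rw [h _ (hD z hz)]
  exact hO z hz

theorem inter_exitEvent_up_self (hx : R.depth x < n)
    (hD : ∀ z ∈ R.star x, (z, t % N) ∈ D) (hO : ∀ z ∈ R.star x, (z, t % N) ∈ O ↔ z = x) :
    bitCylinder b D O ∩ R.exitEvent n N b x (k + 1) x t = bitCylinder b D O := by
  refine Set.inter_eq_left.2 fun ω h => (exits_succ_up hx fun z hz => ?_).2 (Or.inl rfl)
  rw [h _ (hD z hz)]
  exact hO z hz

theorem inter_exitEvent_two {z z' : V} (hz : z ∈ R.star x) (hz' : z' ∈ R.star x) (hne : z ≠ z')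
    (hOD : O ⊆ D) (h : (z, t % N) ∈ O) (h' : (z', t % N) ∈ O) :
    bitCylinder b D O ∩ R.exitEvent n N b w k x t = ∅ :=
  Set.eq_empty_of_forall_notMem fun _ hω => not_exits_of_two hz hz' hne
    ((hω.1 _ (hOD h)).2 h) ((hω.1 _ (hOD h')).2 h') hω.2

/-- The possible patterns of bars at a vertex within one cell. -/
theorem star_pattern (R : ParentTree V) (S : Set V) (x : V) :
    (∀ z ∈ R.star x, z ∉ S) ∨ (∃ y ∈ R.children x, ∀ z ∈ R.star x, z ∈ S ↔ z = y) ∨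
      (∀ z ∈ R.star x, z ∈ S ↔ z = x) ∨
      ∃ z ∈ R.star x, ∃ z' ∈ R.star x, z ≠ z' ∧ z ∈ S ∧ z' ∈ S := by
  by_cases h0 : ∀ z ∈ R.star x, z ∉ S
  · exact Or.inl h0
  by_cases h2 : ∃ z ∈ R.star x, ∃ z' ∈ R.star x, z ≠ z' ∧ z ∈ S ∧ z' ∈ S
  · exact Or.inr (Or.inr (Or.inr h2))
  push Not at h0 h2
  obtain ⟨y, hy, hyS⟩ := h0
  have key : ∀ z ∈ R.star x, z ∈ S ↔ z = y := fun z hz =>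
    ⟨fun hzS => by_contra fun hne => h2 z hz y hy hne hzS hyS, fun h => h ▸ hyS⟩
  rcases mem_star.1 hy with rfl | hy
  · exact Or.inr (Or.inr (Or.inl key))
  · exact Or.inr (Or.inl ⟨y, hy, key⟩)

/-- The bits at `x` in cell `c`. -/
def cellSlots (R : ParentTree V) (x : V) (c : ℕ) : Finset (V × ℕ) := (R.star x).image (·, c)

theorem mem_cellSlots {c : ℕ} {q : V × ℕ} : q ∈ R.cellSlots x c ↔ q.1 ∈ R.star x ∧ q.2 = c := by
  obtain ⟨z, d⟩ := q
  simp only [cellSlots, Finset.mem_image, Prod.mk.injEq]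
  constructor
  · rintro ⟨a, h, rfl, rfl⟩
    exact ⟨h, rfl⟩
  · rintro ⟨h, rfl⟩
    exact ⟨z, h, rfl, rfl⟩

theorem depth_pos_of_mem_star {z : V} (hx : 0 < R.depth x) (hz : z ∈ R.star x) :
    0 < R.depth z := by
  rcases mem_star.1 hz with rfl | hz
  · exact hx
  · rw [depth_child hz]; omega

theorem cellSlots_subset_slots (hx : 0 < R.depth x) (hN : 0 < N) :
    ∀ q ∈ R.cellSlots x (t % N) \ D, q ∈ R.slots N := fun q hq => by
  obtain ⟨h1, h2⟩ := mem_cellSlots.1 (Finset.mem_sdiff.1 hq).1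
  exact ⟨depth_pos_of_mem_star hx h1, h2 ▸ Nat.mod_lt _ hN⟩

variable [MeasurableSpace Ω] {P : Measure Ω} [IsProbabilityMeasure P] {r : ℝ}

/-- Between two visits to the vertex `u`, an excursion of the walk into the subtree of a child `y`
of `u` reveals bits of this subtree only, and ends with a bar on the edge from `y` to `u`. If then
the conditional probability of exiting at `w` is always at most `c`, the probability of exiting
at `w` is at most `c` times the probability that the excursion ends. -/
theorem exitEvent_le_of_excursion (hb : IsBernoulliSet P b (R.slots N) r) (hN : 0 < N)
    (hw : 0 < R.depth w) (hy : y ∈ R.children u) (hwu : R.Below w u) (hOD : O ⊆ D) {c : ℝ}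
    (hexit : ∀ (D' O' : Finset (V × ℕ)) (k t : ℕ), O' ⊆ D' → D ⊆ D' → O ⊆ O' →
      (∀ q ∈ D', q ∉ D → R.Below y q.1) →
      (∀ q ∈ O', q ∉ O → q ∉ D ∧ R.Below y q.1 ∧ (q.1 = y → q.2 = t % N)) →
      (y, t % N) ∈ O' →
      P.real (bitCylinder b D' O' ∩ R.exitEvent n N b w k u (t + 1))
        ≤ c * P.real (bitCylinder b D' O'))
    (hyx : R.Below y x) :
    P.real (bitCylinder b D O ∩ R.exitEvent n N b w k x t)
      ≤ c * P.real (bitCylinder b D O ∩ R.exitEvent n N b y k x t) := by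
  suffices H : ∀ (k : ℕ) (x : V) (t : ℕ) (D₁ O₁ : Finset (V × ℕ)), R.Below y x → O₁ ⊆ D₁ →
      D ⊆ D₁ → O ⊆ O₁ → (∀ q ∈ D₁, q ∉ D → R.Below y q.1) →
      (∀ q ∈ O₁, q ∉ O → q ∉ D ∧ R.Below y q.1 ∧ q.1 ≠ y) →
      P.real (bitCylinder b D₁ O₁ ∩ R.exitEvent n N b w k x t)
        ≤ c * P.real (bitCylinder b D₁ O₁ ∩ R.exitEvent n N b y k x t) from
    H k x t D O hyx hOD subset_rfl subset_rfl (fun q h h' => absurd h h')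
      (fun q h h' => absurd h h')
  intro k
  induction k with
  | zero => intro x t D₁ O₁ _ _ _ _ _ _; simp [exitEvent, Exits]
  | succ k ih =>
    intro x t D₁ O₁ hyx hOD₁ hDD hOO hD₁ hO₁
    rcases le_or_gt n (R.depth x) with hx | hx
    · simp [inter_exitEvent_of_depth hx]
    have hwy : R.Below w y := hwu.child hy
    have hyw : y ≠ w := hwu.ne_child hy
    have hx0 : 0 < R.depth x := hw.trans_le (hwy.trans hyx).1
    have hxw : x ≠ w := by
      rintro rfl
      exact hyw (hyx.eq_of_depth_le hwy.1)
    set Q := R.cellSlots x (t % N) \ D₁ with hQ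
    have hQd : Disjoint Q D₁ := Finset.sdiff_disjoint
    obtain ⟨h1, -⟩ := hb.split (R.exitEvent n N b w (k + 1) x t) hOD₁ Q hQd
      (cellSlots_subset_slots hx0 hN)
    obtain ⟨h2, -⟩ := hb.split (R.exitEvent n N b y (k + 1) x t) hOD₁ Q hQd
      (cellSlots_subset_slots hx0 hN)
    rw [h1, h2, Finset.mul_sum]
    refine Finset.sum_le_sum fun A hA => ?_
    rw [Finset.mem_powerset] at hA
    have hAQ : ∀ q ∈ A, q.1 ∈ R.star x ∧ q.2 = t % N ∧ q ∉ D₁ := fun q hq => by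
      obtain ⟨h3, h4⟩ := Finset.mem_sdiff.1 (hA hq)
      exact ⟨(mem_cellSlots.1 h3).1, (mem_cellSlots.1 h3).2, h4⟩
    set D₂ := D₁ ∪ Q with hD₂
    set O₂ := O₁ ∪ A with hO₂
    have hOD₂ : O₂ ⊆ D₂ := Finset.union_subset_union hOD₁ hA
    have hDD₂ : D ⊆ D₂ := hDD.trans Finset.subset_union_left
    have hOO₂ : O ⊆ O₂ := hOO.trans Finset.subset_union_left
    have hD₂' : ∀ q ∈ D₂, q ∉ D → R.Below y q.1 := fun q hq hqD => by
      rcases Finset.mem_union.1 hq with hq | hq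
      · exact hD₁ q hq hqD
      · exact hyx.star (mem_cellSlots.1 (Finset.mem_sdiff.1 hq).1).1
    have hO₂' : ∀ q ∈ O₂, q ∉ O → q ∉ D ∧ R.Below y q.1 ∧ (q.1 = y → q.2 = t % N) :=
      fun q hq hqO => by
        rcases Finset.mem_union.1 hq with hq | hq
        · obtain ⟨h3, h4, h5⟩ := hO₁ q hq hqO
          exact ⟨h3, h4, fun h => absurd h h5⟩
        · obtain ⟨h3, h4, h5⟩ := hAQ q hq
          exact ⟨fun h => h5 (hDD h), hyx.star h3, fun _ => h4⟩
    have hstar : ∀ z ∈ R.star x, (z, t % N) ∈ D₂ := fun z hz => by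
      by_cases h : (z, t % N) ∈ D₁
      · exact Finset.mem_union_left _ h
      · exact Finset.mem_union_right _
          (Finset.mem_sdiff.2 ⟨mem_cellSlots.2 ⟨hz, rfl⟩, h⟩)
    -- as long as the edge above `y` carries no bar in this cell, the excursion goes on
    have hgo : (x = y → (y, t % N) ∉ O₂) →
        ∀ q ∈ O₂, q ∉ O → q ∉ D ∧ R.Below y q.1 ∧ q.1 ≠ y := fun hne q hq hqO => by
      obtain ⟨h3, h4, h5⟩ := hO₂' q hq hqO
      refine ⟨h3, h4, fun h => ?_⟩
      rcases Finset.mem_union.1 hq with hq' | hq'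
      · exact (hO₁ q hq' hqO).2.2 h
      · have hyx' : x = y := by
          rcases mem_star.1 (hAQ q hq').1 with h6 | h6
          · rw [← h6, h]
          · exact absurd (h ▸ h6) fun h7 => not_below_child h7 hyx
        refine hne hyx' ?_
        have : q = (y, t % N) := Prod.ext h (h5 h)
        rwa [← this]
    rcases R.star_pattern {z | (z, t % N) ∈ O₂} x with h0 | ⟨z, hz, h0⟩ | h0 |
      ⟨z, hz, z', hz', hne, h0, h0'⟩
    · rw [inter_exitEvent_none hx hstar h0, inter_exitEvent_none hx hstar h0]
      exact ih x (t + 1) D₂ O₂ hyx hOD₂ hDD₂ hOO₂ hD₂'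
        (hgo fun h => h ▸ h0 x (self_mem_star x))
    · rw [inter_exitEvent_child hx hz hstar h0, inter_exitEvent_child hx hz hstar h0]
      refine ih z (t + 1) D₂ O₂ (hyx.child hz) hOD₂ hDD₂ hOO₂ hD₂' (hgo fun h h' => ?_)
      subst h
      exact ne_of_mem_children hz ((h0 x (self_mem_star x)).1 h').symm
    · by_cases hxy : x = y
      · subst hxy
        rw [inter_exitEvent_up_self hx hstar h0, inter_exitEvent_up hx hxw hstar h0,
          parent_child hy]
        exact hexit D₂ O₂ k t hOD₂ hDD₂ hOO₂ hD₂' hO₂' ((h0 x (self_mem_star x)).2 rfl)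
      · rw [inter_exitEvent_up hx hxw hstar h0, inter_exitEvent_up hx hxy hstar h0]
        exact ih _ (t + 1) D₂ O₂ (hyx.parent hxy) hOD₂ hDD₂ hOO₂ hD₂'
          (hgo fun h => absurd h hxy)
    · rw [inter_exitEvent_two hz hz' hne hOD₂ h0 h0', inter_exitEvent_two hz hz' hne hOD₂ h0 h0']
      simp

end ParentTree

/-! ### Returns to vertices visited only once -/

theorem Nat.add_mod_injective {N a i j : ℕ} (hi : i < N) (hj : j < N)
    (h : (a + i) % N = (a + j) % N) : i = j := by
  have h1 : i % N = j % N := Nat.ModEq.add_left_cancel' a h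
  rwa [Nat.mod_eq_of_lt hi, Nat.mod_eq_of_lt hj] at h1

theorem Nat.exists_add_mod_eq {N : ℕ} (hN : 0 < N) (a c : ℕ) :
    ∃ d < N, (a + d) % N = c % N := by
  have ha := Nat.mod_lt a hN
  refine ⟨(c + (N - a % N)) % N, Nat.mod_lt _ hN, ?_⟩
  rw [Nat.add_mod_mod, ← Nat.mod_add_mod]
  have : a % N + (c + (N - a % N)) = c + N := by omega
  rw [this, Nat.add_mod_right]

namespace ParentTree

variable {V Ω : Type*} [DecidableEq V]

/-- What is known about the walk arriving at the beginning of cell `t` at a vertex `w` that has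
never been visited before: of the bars on the edge above `w` only the one just crossed has been
found, and nothing is known about the edges below `w`. -/
structure Fresh (R : ParentTree V) (N : ℕ) (D O : Finset (V × ℕ)) (w : V) (t : ℕ) : Prop where
  up : ∀ c, (w, c) ∈ O → (c + 1) % N = t % N
  below : ∀ z, R.Below w z → z ≠ w → ∀ c, (z, c) ∉ D

/-- What is known when the walk has arrived at `u` from the parent of `u`, at the beginning of
cell `a`, has left `u` in cell `a + l` for its child `y`, and has not been at `u` at any other
time. -/
structure OnceVisited (R : ParentTree V) (N : ℕ) (D O : Finset (V × ℕ)) (u y : V) (a l : ℕ) :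
    Prop where
  child : y ∈ R.children u
  sibling_bar : ∀ z ∈ R.children u, z ≠ y → ∀ c, (z, c) ∉ O
  sibling : ∀ z ∈ R.children u, z ≠ y → ∀ c, (z, c) ∈ D → ∃ j ≤ l, c = (a + j) % N
  sibling_below : ∀ z ∈ R.children u, z ≠ y → ∀ z', R.Below z z' → z' ≠ z → ∀ c, (z', c) ∉ D
  up : ∀ c, (u, c) ∈ O → (c + 1) % N = a % N
  down : ∀ c, (y, c) ∈ O → c = (a + l) % N
  down_known : ∀ j ≤ l, (y, (a + j) % N) ∈ D

variable {R : ParentTree V} {n N : ℕ} {b : Ω → Set (V × ℕ)} {w x y u : V} {k t : ℕ}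
  {D O D' O' : Finset (V × ℕ)}

/-- The knowledge in `ParentTree.OnceVisited` is not affected by explorations of the subtree
of `y`. -/
theorem OnceVisited.extend {a l : ℕ} (h : R.OnceVisited N D O u y a l) (hDD : D ⊆ D')
    (hD : ∀ q ∈ D', q ∉ D → R.Below y q.1)
    (hO : ∀ q ∈ O', q ∉ O → R.Below y q.1 ∧ q.1 ≠ y) : R.OnceVisited N D' O' u y a l where
  child := h.child
  sibling_bar z hz hne c hc := by
    by_cases hc' : (z, c) ∈ O
    · exact h.sibling_bar z hz hne c hc'
    · exact hne (children_eq_of_below hz h.child (Below.refl z) (hO _ hc hc').1)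
  sibling z hz hne c hc := by
    by_cases hc' : (z, c) ∈ D
    · exact h.sibling z hz hne c hc'
    · exact absurd (children_eq_of_below hz h.child (Below.refl z) (hD _ hc hc')) hne
  sibling_below z hz hne z' hzz' hne' c hc := by
    by_cases hc' : (z', c) ∈ D
    · exact h.sibling_below z hz hne z' hzz' hne' c hc'
    · exact hne (children_eq_of_below hz h.child hzz' (hD _ hc hc'))
  up c hc := by
    by_cases hc' : (u, c) ∈ O
    · exact h.up c hc'
    · exact absurd (hO _ hc hc').1 (not_below_child h.child)
  down c hc := by
    by_cases hc' : (y, c) ∈ O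
    · exact h.down c hc'
    · exact absurd rfl (hO _ hc hc').2
  down_known j hj := hDD (h.down_known j hj)

variable [MeasurableSpace Ω]

/-- The walk that visits `w` for the first time escapes, with conditional probability at least
`p`, from the subtree of `w`: it does not return through the edge above `w` before reaching
depth `n`. -/
def EscapeBound (R : ParentTree V) (n N : ℕ) (P : Measure Ω) (b : Ω → Set (V × ℕ)) (p : ℝ)
    (w : V) : Prop :=
  ∀ (D O : Finset (V × ℕ)) (t k : ℕ), O ⊆ D → R.Fresh N D O w t →
    P.real (bitCylinder b D O ∩ R.exitEvent n N b w k w t)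
      ≤ (1 - p) * P.real (bitCylinder b D O)

variable {P : Measure Ω} [IsProbabilityMeasure P] {r : ℝ}

/-- Suppose that the walk, arriving from `y` at the vertex `u` that had been visited only once
before, does so neither shortly before the cell of its first arrival at `u`, nor within the
former visit. Then it has a chance to find within `L` cells a bar to an unvisited child, and to
escape there. -/
theorem exitEvent_le_of_return (hb : IsBernoulliSet P b (R.slots N) r) (hN : 0 < N)
    (hr0 : 0 ≤ r) (hr1 : r ≤ 1) {L M : ℕ} (hcard : ∀ x, (R.star x).card ≤ M)
    (htwo : ∀ x, 1 < (R.children x).card) {ρ p : ℝ} (hp : 0 ≤ p)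
    (hρ : ρ ≤ L * r * (1 - r) ^ (M * L))
    (hw : 0 < R.depth w) (hR : ∀ z, R.depth w < R.depth z → R.EscapeBound n N P b p z)
    (hwu : R.Below w u) {a l d : ℕ} (hu : R.OnceVisited N D O u y a l) (hld : l ≤ d)
    (hdN : d + L + 2 ≤ N) (hOD' : O' ⊆ D')
    (hD' : ∀ q ∈ D', q ∉ D → R.Below y q.1)
    (hO' : ∀ q ∈ O', q ∉ O → R.Below y q.1 ∧ (q.1 = y → q.2 = (a + d) % N))
    (ht : t % N = (a + d) % N) {β : ℝ} (hβ : 0 ≤ β)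
    (hfall : ∀ (D'' O'' : Finset (V × ℕ)) (x : V) (t k : ℕ), R.Below u x → O'' ⊆ D'' →
      D' ⊆ D'' → O' ⊆ O'' → (∀ q ∈ D'', q ∉ D' → R.Below u q.1) →
      (∀ q ∈ O'', q ∉ O' → R.Below u q.1) →
      P.real (bitCylinder b D'' O'' ∩ R.exitEvent n N b w k x t)
        ≤ β * P.real (bitCylinder b D'' O'')) :
    P.real (bitCylinder b D' O' ∩ R.exitEvent n N b w k u (t + 1))
      ≤ (β - ρ * p * β) * P.real (bitCylinder b D' O') := by
  have hy := hu.child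
  obtain ⟨z, hz, hzy⟩ := Finset.exists_mem_ne (htwo u) y
  have hcell : ∀ i, (t + 1 + i) % N = (a + (d + 1 + i)) % N := fun i => by
    rw [show t + 1 + i = t + (1 + i) by ring, show a + (d + 1 + i) = (a + d) + (1 + i) by ring,
      Nat.add_mod, ht, ← Nat.add_mod]
  have hu0 : 0 < R.depth u := hw.trans_le hwu.1
  -- no bar at `u` is known in the next `L` cells
  have hO'no : ∀ z' ∈ R.star u, ∀ i < L, (z', (t + 1 + i) % N) ∉ O' := fun z' hz' i hi hmem => by
    rw [hcell] at hmem
    by_cases hold : (z', (a + (d + 1 + i)) % N) ∈ O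
    · rcases mem_star.1 hz' with rfl | hz'
      · have h := hu.up _ hold
        rw [Nat.mod_add_mod, add_assoc] at h
        have h1 := Nat.add_mod_injective (N := N) (a := a) (i := d + 1 + i + 1) (j := 0)
          (by omega) (by omega) (by simpa using h)
        omega
      · by_cases hzy' : z' = y
        · subst hzy'
          have h := Nat.add_mod_injective (by omega) (by omega) (hu.down _ hold)
          omega
        · exact hu.sibling_bar z' hz' hzy' _ hold
    · obtain ⟨h1, h2⟩ := hO' _ hmem hold
      rcases mem_star.1 hz' with rfl | hz'
      · exact not_below_child hy h1
      · have h3 := children_eq_of_below hz' hy (Below.refl z') h1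
        have h := Nat.add_mod_injective (by omega) (by omega) (h2 h3)
        omega
  have hzD' : ∀ c, (z, c) ∈ D' → ∃ j ≤ l, c = (a + j) % N := fun c hc => by
    by_cases hold : (z, c) ∈ D
    · exact hu.sibling z hz hzy c hold
    · exact absurd (children_eq_of_below hz hy (Below.refl z) (hD' _ hc hold)) hzy
  set Q₀ : Finset (V × ℕ) :=
    (R.star u ×ˢ Finset.range L).image (fun q => (q.1, (t + 1 + q.2) % N)) with hQ₀
  set Q := Q₀ \ D' with hQ
  set S : Finset (V × ℕ) := (Finset.range L).image (fun j => (z, (t + 1 + j) % N)) with hS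
  have hmemQ₀ : ∀ q, q ∈ Q₀ ↔ q.1 ∈ R.star u ∧ ∃ i < L, q.2 = (t + 1 + i) % N := fun q => by
    rw [hQ₀, Finset.mem_image]
    constructor
    · rintro ⟨⟨z', i⟩, h, rfl⟩
      rw [Finset.mem_product, Finset.mem_range] at h
      exact ⟨h.1, i, h.2, rfl⟩
    · rintro ⟨h, i, hi, h'⟩
      exact ⟨(q.1, i), Finset.mem_product.2 ⟨h, Finset.mem_range.2 hi⟩, Prod.ext rfl h'.symm⟩
  have hSQ : S ⊆ Q := fun q hq => by
    obtain ⟨j, hj, rfl⟩ := Finset.mem_image.1 hq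
    rw [Finset.mem_range] at hj
    refine Finset.mem_sdiff.2 ⟨(hmemQ₀ _).2 ⟨child_mem_star hz, j, hj, rfl⟩, fun hc => ?_⟩
    obtain ⟨j', hj', h⟩ := hzD' _ hc
    rw [hcell] at h
    have := Nat.add_mod_injective (by omega) (by omega) h
    omega
  have hScard : S.card = L := by
    rw [hS, Finset.card_image_of_injOn, Finset.card_range]
    intro i hi j hj hij
    simp only [Finset.coe_range, Set.mem_Iio] at hi hj
    have hij' := (Prod.mk.inj hij).2
    simp only [hcell] at hij'
    have := Nat.add_mod_injective (by omega) (by omega) hij'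
    omega
  have hQcard : Q.card - 1 ≤ M * L := by
    have h1 : Q.card ≤ Q₀.card := Finset.card_le_card Finset.sdiff_subset
    have h2 : Q₀.card ≤ (R.star u).card * L := by
      refine Finset.card_image_le.trans ?_
      rw [Finset.card_product, Finset.card_range]
    have h3 : (R.star u).card * L ≤ M * L := Nat.mul_le_mul_right _ (hcard u)
    omega
  have hQD : ∀ q ∈ D' ∪ Q, q ∉ D' → q.1 ∈ R.star u := fun q hq hqD => by
    rcases Finset.mem_union.1 hq with h | h
    · exact absurd h hqD
    · exact ((hmemQ₀ q).1 (Finset.mem_sdiff.1 h).1).1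
  have hfallA : ∀ A ⊆ Q, P.real (bitCylinder b (D' ∪ Q) (O' ∪ A) ∩ R.exitEvent n N b w k u (t + 1))
      ≤ β * P.real (bitCylinder b (D' ∪ Q) (O' ∪ A)) := fun A hA => by
    refine hfall _ _ u (t + 1) k (Below.refl u) (Finset.union_subset_union hOD' hA)
      Finset.subset_union_left Finset.subset_union_left
      (fun q hq hqD => (Below.refl u).star (hQD q hq hqD)) (fun q hq hqO => ?_)
    rcases Finset.mem_union.1 hq with h | h
    · exact absurd h hqO
    · exact (Below.refl u).star ((hmemQ₀ q).1 (Finset.mem_sdiff.1 (hA h)).1).1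
  have hmain := hb.le_of_split_card_le_one (R.exitEvent n N b w k u (t + 1)) hOD' Q
    Finset.sdiff_disjoint (fun q hq => by
      obtain ⟨h1, i, -, h2⟩ := (hmemQ₀ q).1 (Finset.mem_sdiff.1 hq).1
      exact ⟨depth_pos_of_mem_star hu0 h1, h2 ▸ Nat.mod_lt _ hN⟩) β 0
    (fun q => if q ∈ S then p * β else 0)
    (by simpa using hfallA ∅ (Finset.empty_subset _)) (fun q hq => ?_)
    (fun A hA _ => hfallA A hA)
  · refine hmain.trans (mul_le_mul_of_nonneg_right ?_ measureReal_nonneg)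
    have h1 : ∑ q ∈ Q, (if q ∈ S then p * β else 0) = L * (p * β) := by
      rw [← Finset.sum_filter, Finset.filter_mem_eq_inter, Finset.inter_eq_right.2 hSQ,
        Finset.sum_const, hScard, nsmul_eq_mul]
    rw [h1]
    have h2 : (1 - r) ^ (M * L) ≤ (1 - r) ^ (Q.card - 1) :=
      pow_le_pow_of_le_one (by linarith) (by linarith) hQcard
    have h3 : ρ ≤ L * r * (1 - r) ^ (Q.card - 1) :=
      hρ.trans (mul_le_mul_of_nonneg_left h2 (by positivity))
    have h4 := mul_le_mul_of_nonneg_right h3 (mul_nonneg hp hβ)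
    linarith
  · split_ifs with hqS
    swap
    · rw [sub_zero]
      exact hfallA {q} (Finset.singleton_subset_iff.2 hq)
    -- the first bar found leads to the unvisited child `z`
    obtain ⟨j, hj, rfl⟩ := Finset.mem_image.1 hqS
    rw [Finset.mem_range] at hj
    set q : V × ℕ := (z, (t + 1 + j) % N) with hq'
    set D₂ := D' ∪ Q with hD₂
    set O₂ := O' ∪ {q} with hO₂
    have hOD₂ : O₂ ⊆ D₂ :=
      Finset.union_subset_union hOD' (Finset.singleton_subset_iff.2 hq)
    have hknown : ∀ z' ∈ R.star u, ∀ i < L, (z', (t + 1 + i) % N) ∈ D₂ := fun z' hz' i hi => by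
      by_cases h : (z', (t + 1 + i) % N) ∈ D'
      · exact Finset.mem_union_left _ h
      · exact Finset.mem_union_right _
          (Finset.mem_sdiff.2 ⟨(hmemQ₀ _).2 ⟨hz', i, hi, rfl⟩, h⟩)
    have hbars : ∀ z' ∈ R.star u, ∀ i < L,
        (z', (t + 1 + i) % N) ∈ O₂ ↔ (z' = z ∧ i = j) := fun z' hz' i hi => by
      rw [hO₂, Finset.mem_union, or_iff_right (hO'no z' hz' i hi), Finset.mem_singleton, hq',
        Prod.mk.injEq]
      refine and_congr_right fun _ => ⟨fun h => ?_, fun h => by rw [h]⟩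
      rw [hcell, hcell] at h
      have := Nat.add_mod_injective (by omega) (by omega) h
      omega
    have hsub : bitCylinder b D₂ O₂ ∩ R.exitEvent n N b w k u (t + 1)
        ⊆ bitCylinder b D₂ O₂ ∩ R.exitEvent n N b w (k - (j + 1)) z (t + 1 + j + 1) := by
      rintro ω ⟨h1, h2⟩
      refine ⟨h1, exits_wait_child j (fun i hi z' hz' => ?_) hz (fun z' hz' => ?_) h2⟩
      · rw [h1 _ (hknown z' hz' i (by omega)), hbars z' hz' i (by omega)]
        omega
      · rw [h1 _ (hknown z' hz' j hj), hbars z' hz' j hj]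
        tauto
    have hfresh : R.Fresh N D₂ O₂ z (t + 1 + j + 1) := by
      constructor
      · intro c hc
        rcases Finset.mem_union.1 hc with h | h
        · by_cases hold : (z, c) ∈ O
          · exact absurd hold (hu.sibling_bar z hz hzy c)
          · exact absurd (children_eq_of_below hz hy (Below.refl z) (hO' _ h hold).1) hzy
        · rw [Finset.mem_singleton, hq', Prod.mk.injEq] at h
          rw [h.2, Nat.mod_add_mod]
      · intro z' hzz' hne c hc
        rcases Finset.mem_union.1 hc with h | h
        · by_cases hold : (z', c) ∈ D
          · exact hu.sibling_below z hz hzy z' hzz' hne c hold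
          · exact hzy (children_eq_of_below hz hy hzz' (hD' _ h hold))
        · rcases mem_star.1 ((hmemQ₀ _).1 (Finset.mem_sdiff.1 h).1).1 with h3 | h3
          · exact not_below_child hz (h3 ▸ hzz')
          · exact hne (children_eq_of_below h3 hz (Below.refl z') hzz')
    have hzd : R.depth w < R.depth z := by
      rw [depth_child hz]
      exact Nat.lt_succ_of_le hwu.1
    calc P.real (bitCylinder b D₂ O₂ ∩ R.exitEvent n N b w k u (t + 1))
        ≤ P.real (bitCylinder b D₂ O₂ ∩
            R.exitEvent n N b w (k - (j + 1)) z (t + 1 + j + 1)) := measureReal_mono hsub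
      _ ≤ β * P.real (bitCylinder b D₂ O₂ ∩
            R.exitEvent n N b z (k - (j + 1)) z (t + 1 + j + 1)) := by
          refine exitEvent_le_of_excursion hb hN hw hz hwu hOD₂ (fun D₃ O₃ k' t' h1 h2 h3 h4 h5 _ =>
            hfall D₃ O₃ u (t' + 1) k' (Below.refl u) h1 (Finset.subset_union_left.trans h2)
              (Finset.subset_union_left.trans h3) (fun q hq hqD => ?_) (fun q hq hqO => ?_))
            (Below.refl z)
          · by_cases hq2 : q ∈ D₂
            · exact (Below.refl u).star (hQD q hq2 hqD)
            · exact ((Below.refl u).child hz).trans (h4 q hq hq2)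
          · by_cases hq2 : q ∈ O₂
            · rcases Finset.mem_union.1 hq2 with h | h
              · exact absurd h hqO
              · rw [Finset.mem_singleton.1 h]
                exact (Below.refl u).child hz
            · exact ((Below.refl u).child hz).trans (h5 q hq hq2).2.1
      _ ≤ β * ((1 - p) * P.real (bitCylinder b D₂ O₂)) :=
          mul_le_mul_of_nonneg_left (hR z hzd D₂ O₂ _ _ hOD₂ hfresh) hβ
      _ = (β - p * β) * P.real (bitCylinder b D₂ O₂) := by ring

/-- The walk at `x`, in order to exit at `w`, has to pass all the ancestors of `x` that have been
visited only once, and at each of them it has a chance to escape into the subtree of an unvisited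
child. The parity assumption separates these ancestors. -/
theorem exitEvent_le_pow (hb : IsBernoulliSet P b (R.slots N) r) (hN : 0 < N)
    (hr0 : 0 ≤ r) (hr1 : r ≤ 1) {L M τ : ℕ} (hcard : ∀ x, (R.star x).card ≤ M)
    (htwo : ∀ x, 1 < (R.children x).card) {ρ p : ℝ} (hp : 0 ≤ p)
    (hρp0 : 0 ≤ ρ * p) (hρp1 : ρ * p ≤ 1)
    (hρ : ρ ≤ L * r * (1 - r) ^ (M * L)) (hL : 1 / 2 ≤ (1 - r) ^ (L + 1))
    (hτ : τ + L + 2 ≤ N)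
    (hw : 0 < R.depth w) (hR : ∀ z, R.depth w < R.depth z → R.EscapeBound n N P b p z)
    (Γ : Finset V) (hOD : O ⊆ D)
    (hpar : ∀ u ∈ Γ, ∀ u' ∈ Γ, R.depth u % 2 = R.depth u' % 2)
    (hΓ : ∀ u ∈ Γ, R.Below w u ∧ ∃ y a l, l ≤ τ ∧ R.Below y x ∧ R.OnceVisited N D O u y a l) :
    P.real (bitCylinder b D O ∩ R.exitEvent n N b w k x t)
      ≤ (1 - ρ * p / 2) ^ Γ.card * P.real (bitCylinder b D O) := by
  induction hg : Γ.card generalizing Γ D O x t k with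
  | zero =>
    rw [pow_zero, one_mul]
    exact measureReal_mono Set.inter_subset_left
  | succ g ih =>
    -- The deepest member `u` of `Γ` is passed first, and contributes one factor.
    obtain ⟨u, huΓ, hmax⟩ := Finset.exists_max_image Γ R.depth
      (Finset.card_pos.1 (by omega))
    obtain ⟨hwu, y, a, l, hl, hyx, hu⟩ := hΓ u huΓ
    have hy := hu.child
    have hux : R.Below u x := ((Below.refl u).child hy).trans hyx
    set β := (1 - ρ * p / 2) ^ g with hβ
    have hβ0 : 0 ≤ β := pow_nonneg (by linarith) _
    have hfall : ∀ (D' O' : Finset (V × ℕ)) (x' : V) (t k : ℕ), R.Below u x' → O' ⊆ D' →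
        D ⊆ D' → O ⊆ O' → (∀ q ∈ D', q ∉ D → R.Below u q.1) →
        (∀ q ∈ O', q ∉ O → R.Below u q.1) →
        P.real (bitCylinder b D' O' ∩ R.exitEvent n N b w k x' t)
          ≤ β * P.real (bitCylinder b D' O') := by
      intro D' O' x' t k hux' hOD' hDD' hOO' hD' hO'
      refine ih (Γ.erase u) hOD' (fun v hv v' hv' => hpar v (Finset.mem_of_mem_erase hv) v'
        (Finset.mem_of_mem_erase hv')) (fun v hv => ?_)
        (by rw [Finset.card_erase_of_mem huΓ, hg]; rfl)
      have hvΓ := Finset.mem_of_mem_erase hv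
      obtain ⟨hwv, y', a', l', hl', hyx', hv'⟩ := hΓ v hvΓ
      have hvx : R.Below v x := ((Below.refl v).child hv'.child).trans hyx'
      have hne : R.depth v ≠ R.depth u := fun h =>
        Finset.ne_of_mem_erase hv (hvx.eq_of_depth_eq hux h)
      have hlt : R.depth y' < R.depth u := by
        have h1 := hmax v hvΓ
        have h2 := hpar v hvΓ u huΓ
        have h3 := depth_child hv'.child
        omega
      have hyu : R.Below y' u := hux.of_depth_le hyx' hlt.le
      refine ⟨hwv, y', a', l', hl', hyu.trans hux', hv'.extend hDD'
        (fun q hq hqD => hyu.trans (hD' q hq hqD)) (fun q hq hqO => ⟨hyu.trans (hO' q hq hqO), ?_⟩)⟩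
      rintro rfl
      exact absurd (hO' q hq hqO).1 (by omega)
    -- Explore the edge above `y` in the `L + 1` cells before `a`. If it has no bars there, the walk
    -- comes back to `u` at a time of the clock after which `L` unexplored cells follow.
    set Q : Finset (V × ℕ) :=
      ((Finset.range (L + 1)).image (fun j => (y, (a + (N - 1 - j)) % N))) \ D with hQ
    have hQy : ∀ q ∈ Q, q.1 = y ∧ q.2 < N := fun q hq => by
      obtain ⟨j, -, rfl⟩ := Finset.mem_image.1 (Finset.mem_sdiff.1 hq).1
      exact ⟨rfl, Nat.mod_lt _ hN⟩
    have hQcard : Q.card ≤ L + 1 :=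
      (Finset.card_le_card Finset.sdiff_subset).trans
        (Finset.card_image_le.trans (Finset.card_range _).le)
    have hQb : ∀ q ∈ D ∪ Q, q ∉ D → q.1 = y := fun q hq hqD => by
      rcases Finset.mem_union.1 hq with h | h
      · exact absurd h hqD
      · exact (hQy q h).1
    have huy : R.Below u y := (Below.refl u).child hy
    have hfallA : ∀ A ⊆ Q, P.real (bitCylinder b (D ∪ Q) (O ∪ A) ∩ R.exitEvent n N b w k x t)
        ≤ β * P.real (bitCylinder b (D ∪ Q) (O ∪ A)) := fun A hA => by
      refine hfall _ _ x t k hux (Finset.union_subset_union hOD hA) Finset.subset_union_left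
        Finset.subset_union_left (fun q hq hqD => (hQb q hq hqD).symm ▸ huy) (fun q hq hqO => ?_)
      rcases Finset.mem_union.1 hq with h | h
      · exact absurd h hqO
      · exact (hQy q (hA h)).1.symm ▸ huy
    have hy0 : 0 < R.depth y := hw.trans_le (hwu.child hy).1
    have hmain := hb.le_of_split_card_le_one (R.exitEvent n N b w k x t) hOD Q
      Finset.sdiff_disjoint (fun q hq => ⟨(hQy q hq).1.symm ▸ hy0, (hQy q hq).2⟩) β (ρ * p * β)
      (fun _ => 0) ?_
      (fun q hq => by rw [sub_zero]; exact hfallA {q} (Finset.singleton_subset_iff.2 hq))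
      (fun A hA _ => hfallA A hA)
    · refine hmain.trans (mul_le_mul_of_nonneg_right ?_ measureReal_nonneg)
      have h2 : (1 - r) ^ (L + 1) ≤ (1 - r) ^ Q.card :=
        pow_le_pow_of_le_one (by linarith) (by linarith) hQcard
      have h3 := mul_le_mul_of_nonneg_right (hL.trans h2) (mul_nonneg hρp0 hβ0)
      rw [Finset.sum_const_zero, mul_zero, add_zero, pow_succ]
      linarith
    · -- there is no bar on the edge above `y` in the `L + 1` cells before `a`
      have hu' : R.OnceVisited N (D ∪ Q) O u y a l :=
        hu.extend Finset.subset_union_left (fun q hq hqD => hQb q hq hqD ▸ Below.refl _)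
          (fun q hq hqO => absurd hq hqO)
      have hOD' : O ⊆ D ∪ Q := hOD.trans Finset.subset_union_left
      have hc0 : 0 ≤ β - ρ * p * β := by
        have := mul_le_mul_of_nonneg_right hρp1 hβ0
        linarith
      refine (exitEvent_le_of_excursion hb hN hw hy hwu hOD' (c := β - ρ * p * β) ?_ hyx).trans
        (mul_le_mul_of_nonneg_left (measureReal_mono Set.inter_subset_left) hc0)
      intro D' O' k' t' hOD₁ hDD₁ hOO₁ hD₁ hO₁ hyO
      obtain ⟨d, hd, hdt⟩ := Nat.exists_add_mod_eq hN a t'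
      -- the bar through which the walk returns was not known to be absent
      have hknown : ∀ d', d' < N → (y, (a + d') % N) ∈ D ∪ Q → d = d' → d' = l :=
        fun d' hd' hmem hdd => by
          subst hdd
          by_cases hold : (y, (a + d) % N) ∈ O
          · exact Nat.add_mod_injective hd (by omega) (hu.down _ hold)
          · exact absurd hmem (hO₁ _ (hdt ▸ hyO) hold).1
      have hld : l ≤ d := by
        by_contra hlt
        have := hknown d hd (Finset.mem_union_left _ (hu.down_known d (by omega))) rfl
        omega
      have hdN : d + L + 2 ≤ N := by
        by_contra hlt
        have hmem : (y, (a + d) % N) ∈ D ∪ Q := by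
          by_cases h : (y, (a + d) % N) ∈ D
          · exact Finset.mem_union_left _ h
          · refine Finset.mem_union_right _ (Finset.mem_sdiff.2 ⟨Finset.mem_image.2
              ⟨N - 1 - d, Finset.mem_range.2 (by omega), ?_⟩, h⟩)
            rw [show N - 1 - (N - 1 - d) = d by omega]
        have := hknown d hd hmem rfl
        omega
      refine exitEvent_le_of_return hb hN hr0 hr1 hcard htwo hp hρ hw hR hwu hu' hld hdN hOD₁
        hD₁ (fun q hq hqO => ⟨(hO₁ q hq hqO).2.1, fun h => by
          rw [(hO₁ q hq hqO).2.2 h, hdt]⟩) hdt.symm hβ0 ?_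
      intro D'' O'' x' t'' k'' hux' hOD₂ hDD₂ hOO₂ hD₂ hO₂
      refine hfall D'' O'' x' t'' k'' hux' hOD₂
        (Finset.subset_union_left.trans (hDD₁.trans hDD₂)) (hOO₁.trans hOO₂)
        (fun q hq hqD => ?_) (fun q hq hqO => ?_)
      · by_cases h1 : q ∈ D'
        · by_cases h2 : q ∈ D ∪ Q
          · exact (hQb q h2 hqD).symm ▸ huy
          · exact huy.trans (hD₁ q h1 h2)
        · exact hD₂ q hq h1
      · by_cases h1 : q ∈ O'
        · exact huy.trans (hO₁ q h1 hqO).2.1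
        · exact hO₂ q hq h1

end ParentTree

/-! ### Runs inside the subtree of an unvisited vertex -/

namespace ParentTree

variable {V Ω : Type*}

/-- What is known when the walk, having arrived at the unvisited vertex `w` at the beginning of
cell `t₀`, is `s` cells later at `x`, at height `m` above `w`, without having left the subtree of
`w`. The set `Γ` consists of ancestors of `x` that have been visited only once, at even heights. -/
structure Run (R : ParentTree V) (N τ : ℕ) (w : V) (t₀ : ℕ) (D O : Finset (V × ℕ)) (x : V)
    (s m : ℕ) (Γ : Finset V) : Prop where
  subset : O ⊆ D
  below : R.Below w x
  depth : R.depth x = R.depth w + m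
  up : ∀ c, (w, c) ∈ O → (c + 1) % N = t₀ % N
  cells : ∀ z, R.Below w z → z ≠ w → ∀ c, (z, c) ∈ D → ∃ j < s, c = (t₀ + j) % N
  good : ∀ u ∈ Γ, R.Below w u ∧ (R.depth u - R.depth w) % 2 = 0 ∧
    ∃ y a l, l ≤ τ ∧ R.Below y x ∧ R.OnceVisited N D O u y a l

/-- The run is at its greatest height so far, and visits its present location `x` for the first
time, since cell `t₀ + a`. -/
structure RunRecord (R : ParentTree V) (N : ℕ) (w : V) (t₀ : ℕ) (D O : Finset (V × ℕ)) (x : V)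
    (s m a : ℕ) : Prop where
  le : a ≤ s
  deep : ∀ z, R.Below w z → ∀ c, (z, c) ∈ D → R.depth z ≤ R.depth w + m ∨
    (z ∈ R.children x ∧ (z, c) ∉ O ∧ ∃ j, a ≤ j ∧ j < s ∧ c = (t₀ + j) % N)
  up : ∀ c, (x, c) ∈ O → (c + 1) % N = (t₀ + a) % N
  known : ∀ z ∈ R.children x, ∀ j, a ≤ j → j < s → (z, (t₀ + j) % N) ∈ D

/-- The run has visited the heights below `h` only. -/
structure RunBelow (R : ParentTree V) (w : V) (D O : Finset (V × ℕ)) (h : ℕ) : Prop where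
  deep : ∀ z, R.Below w z → ∀ c, (z, c) ∈ D → R.depth z ≤ R.depth w + h
  deep_bar : ∀ z, R.Below w z → ∀ c, (z, c) ∈ O → R.depth z < R.depth w + h

variable {R : ParentTree V} {n N τ : ℕ} {b : Ω → Set (V × ℕ)} {w x y z u : V} {k t t₀ s m : ℕ}
  {D O : Finset (V × ℕ)} {Γ : Finset V}

namespace Run

theorem cell_not_mem (h : R.Run N τ w t₀ D O x s m Γ) (hs : s < N) (hz : R.Below w z)
    (hzw : z ≠ w) : (z, (t₀ + s) % N) ∉ D := fun hc => by
  obtain ⟨j, hj, he⟩ := h.cells z hz hzw _ hc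
  have := Nat.add_mod_injective hs (by omega) he
  omega

theorem child_not_mem (h : R.Run N τ w t₀ D O x s m Γ) (hs : s < N) (hz : z ∈ R.children x) :
    (z, (t₀ + s) % N) ∉ D :=
  h.cell_not_mem hs (h.below.child hz) (h.below.ne_child hz)

theorem up_not_mem (h : R.Run N τ w t₀ D O x s m Γ) (hs : s + 1 < N) :
    (x, (t₀ + s) % N) ∉ O := fun hc => by
  by_cases hxw : x = w
  · subst hxw
    have h1 := h.up _ hc
    rw [Nat.mod_add_mod, add_assoc] at h1
    have := Nat.add_mod_injective (N := N) (a := t₀) (i := s + 1) (j := 0) hs (by omega)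
      (by simpa using h1)
    omega
  · exact h.cell_not_mem (by omega) h.below hxw (h.subset hc)

theorem ancestor_lt (h : R.Run N τ w t₀ D O x s m Γ) (hu : u ∈ Γ) :
    R.Below u x ∧ R.depth w ≤ R.depth u ∧ R.depth u < R.depth w + m := by
  obtain ⟨h1, -, y, a, l, -, hyx, hy⟩ := h.good u hu
  have h2 := depth_child hy.child
  have h3 := hyx.1
  have h4 := h.depth
  exact ⟨((Below.refl u).child hy.child).trans hyx, h1.1, by omega⟩

theorem card_le (h : R.Run N τ w t₀ D O x s m Γ) : Γ.card ≤ (m + 1) / 2 := by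
  rw [← Finset.card_range ((m + 1) / 2)]
  refine Finset.card_le_card_of_injOn (fun u => (R.depth u - R.depth w) / 2) (fun u hu => ?_)
    (fun u hu v hv huv => ?_)
  · obtain ⟨-, h1, h2⟩ := h.ancestor_lt hu
    have h3 := (h.good u hu).2.1
    simp only [Finset.coe_range, Set.mem_Iio]
    omega
  · obtain ⟨h1, h2, -⟩ := h.ancestor_lt hu
    obtain ⟨h1', h2', -⟩ := h.ancestor_lt hv
    have h3 := (h.good u hu).2.1
    have h3' := (h.good v hv).2.1
    simp only at huv
    exact h1.eq_of_depth_eq h1' (by omega)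

theorem record_bar (h : R.Run N τ w t₀ D O x s m Γ) {a : ℕ}
    (hrec : R.RunRecord N w t₀ D O x s m a) (hz : R.Below w z) {c : ℕ} (hc : (z, c) ∈ O) :
    R.depth z ≤ R.depth w + m := by
  rcases hrec.deep z hz c (h.subset hc) with h1 | h1
  · exact h1
  · exact absurd hc h1.2.1

theorem record_deep (h : R.Run N τ w t₀ D O x s m Γ) {a : ℕ}
    (hrec : R.RunRecord N w t₀ D O x s m a) (hz : R.Below w z) {c : ℕ} (hc : (z, c) ∈ D) :
    R.depth z ≤ R.depth w + (m + 1) := by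
  have h3 := h.depth
  rcases hrec.deep z hz c hc with h1 | h1
  · omega
  · have := depth_child h1.1
    omega

theorem record_children (h : R.Run N τ w t₀ D O x s m Γ) {a : ℕ}
    (hrec : R.RunRecord N w t₀ D O x s m a) : ∀ z ∈ R.children x, ∀ c, (z, c) ∉ O :=
  fun z hz c hc => by
    have h1 := h.record_bar hrec (h.below.child hz) hc
    have h2 := depth_child hz
    have h3 := h.depth
    omega

variable [DecidableEq V]

/-- The knowledge of a run after the exploration of its present cell, when no bar is found. -/
theorem wait (h : R.Run N τ w t₀ D O x s m Γ) :
    R.Run N τ w t₀ (D ∪ (R.cellSlots x ((t₀ + s) % N) \ D)) O x (s + 1) m Γ where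
  subset := h.subset.trans Finset.subset_union_left
  below := h.below
  depth := h.depth
  up := h.up
  cells z hz hzw c hc := by
    rcases Finset.mem_union.1 hc with hc | hc
    · obtain ⟨j, hj, he⟩ := h.cells z hz hzw c hc
      exact ⟨j, by omega, he⟩
    · exact ⟨s, by omega, (mem_cellSlots.1 (Finset.mem_sdiff.1 hc).1).2⟩
  good u hu := by
    obtain ⟨h1, h2, y, a, l, hl, hyx, hy⟩ := h.good u hu
    refine ⟨h1, h2, y, a, l, hl, hyx, hy.extend Finset.subset_union_left (fun q hq hqD => ?_)
      (fun q hq hqO => absurd hq hqO)⟩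
    rcases Finset.mem_union.1 hq with hq | hq
    · exact absurd hq hqD
    · exact hyx.star (mem_cellSlots.1 (Finset.mem_sdiff.1 hq).1).1

/-- The knowledge of a run after a step to the child `z`. -/
theorem stepDown (h : R.Run N τ w t₀ D O x s m Γ) (hs : s < N) (hz : z ∈ R.children x) :
    R.Run N τ w t₀ (D ∪ (R.cellSlots x ((t₀ + s) % N) \ D)) (O ∪ {(z, (t₀ + s) % N)}) z (s + 1)
      (m + 1) Γ where
  subset := Finset.union_subset_union h.subset (Finset.singleton_subset_iff.2 (Finset.mem_sdiff.2
    ⟨mem_cellSlots.2 ⟨child_mem_star hz, rfl⟩, h.child_not_mem hs hz⟩))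
  below := h.below.child hz
  depth := by rw [depth_child hz, h.depth, add_assoc]
  up c hc := by
    rcases Finset.mem_union.1 hc with hc | hc
    · exact h.up c hc
    · exact absurd (Prod.mk.inj (Finset.mem_singleton.1 hc)).1.symm (h.below.ne_child hz)
  cells := h.wait.cells
  good u hu := by
    obtain ⟨h1, h2, y, a, l, hl, hyx, hy⟩ := h.wait.good u hu
    refine ⟨h1, h2, y, a, l, hl, hyx.child hz, hy.extend subset_rfl (fun q hq hqD => absurd hq hqD)
      (fun q hq hqO => ?_)⟩
    rcases Finset.mem_union.1 hq with hq | hq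
    · exact absurd hq hqO
    · rw [Finset.mem_singleton.1 hq]
      exact ⟨hyx.child hz, hyx.ne_child hz⟩

/-- The knowledge of a run after a step to the parent. -/
theorem stepUp (h : R.Run N τ w t₀ D O x s m Γ) (hs : s < N) (hxw : x ≠ w) :
    R.Run N τ w t₀ (D ∪ (R.cellSlots x ((t₀ + s) % N) \ D)) (O ∪ {(x, (t₀ + s) % N)})
      (R.parent x) (s + 1) (m - 1) (Γ.erase (R.parent x)) where
  subset := Finset.union_subset_union h.subset (Finset.singleton_subset_iff.2 (Finset.mem_sdiff.2
    ⟨mem_cellSlots.2 ⟨self_mem_star x, rfl⟩, h.cell_not_mem hs h.below hxw⟩))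
  below := h.below.parent hxw
  depth := by
    have h1 := h.below.depth_lt hxw
    have h2 := R.depth_parent (y := x) (by omega)
    have h3 := h.depth
    omega
  up c hc := by
    rcases Finset.mem_union.1 hc with hc | hc
    · exact h.up c hc
    · exact absurd (Prod.mk.inj (Finset.mem_singleton.1 hc)).1.symm hxw
  cells := h.wait.cells
  good u hu := by
    obtain ⟨h1, h2, y, a, l, hl, hyx, hy⟩ := h.wait.good u (Finset.mem_of_mem_erase hu)
    have hne : x ≠ y := by
      rintro rfl
      exact Finset.ne_of_mem_erase hu (parent_child hy.child).symm
    refine ⟨h1, h2, y, a, l, hl, hyx.parent hne, hy.extend subset_rfl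
      (fun q hq hqD => absurd hq hqD) (fun q hq hqO => ?_)⟩
    rcases Finset.mem_union.1 hq with hq | hq
    · exact absurd hq hqO
    · rw [Finset.mem_singleton.1 hq]
      exact ⟨hyx, hne⟩

/-- The vertex `x`, when it is left for a child during the first visit, joins the ancestors that
have been visited only once. -/
theorem onceVisited (h : R.Run N τ w t₀ D O x s m Γ) {a : ℕ}
    (hrec : R.RunRecord N w t₀ D O x s m a) (hz : z ∈ R.children x) :
    R.OnceVisited N (D ∪ (R.cellSlots x ((t₀ + s) % N) \ D)) (O ∪ {(z, (t₀ + s) % N)}) x z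
      (t₀ + a) (s - a) where
  child := hz
  sibling_bar z' hz' hne c hc := by
    rcases Finset.mem_union.1 hc with hc | hc
    · rcases hrec.deep z' (h.below.child hz') c (h.subset hc) with h1 | h1
      · have h2 := depth_child hz'
        have h3 := h.depth
        omega
      · exact h1.2.1 hc
    · exact hne (Prod.mk.inj (Finset.mem_singleton.1 hc)).1
  sibling z' hz' hne c hc := by
    have hle := hrec.le
    rcases Finset.mem_union.1 hc with hc | hc
    · rcases hrec.deep z' (h.below.child hz') c hc with h1 | ⟨-, -, j, hj, hj', rfl⟩
      · have h2 := depth_child hz'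
        have h3 := h.depth
        omega
      · exact ⟨j - a, by omega, by congr 1; omega⟩
    · refine ⟨s - a, le_rfl, ?_⟩
      have h1 : c = (t₀ + s) % N := (mem_cellSlots.1 (Finset.mem_sdiff.1 hc).1).2
      rw [h1]
      congr 1
      omega
  sibling_below z' hz' hne z'' hzz hne' c hc := by
    have h2 := depth_child hz'
    have h3 := h.depth
    have h4 := hzz.depth_lt hne'
    rcases Finset.mem_union.1 hc with hc | hc
    · rcases hrec.deep z'' ((h.below.child hz').trans hzz) c hc with h1 | ⟨h1, -⟩
      · omega
      · have := depth_child h1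
        omega
    · rcases mem_star.1 (mem_cellSlots.1 (Finset.mem_sdiff.1 hc).1).1 with h1 | h1
      · simp only at h1
        subst h1
        omega
      · have := depth_child h1
        simp only at this
        omega
  up c hc := by
    rcases Finset.mem_union.1 hc with hc | hc
    · exact hrec.up c hc
    · exact absurd (Prod.mk.inj (Finset.mem_singleton.1 hc)).1.symm (ne_of_mem_children hz)
  down c hc := by
    have hle := hrec.le
    rcases Finset.mem_union.1 hc with hc | hc
    · rcases hrec.deep z (h.below.child hz) c (h.subset hc) with h1 | h1
      · have h2 := depth_child hz
        have h3 := h.depth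
        omega
      · exact absurd hc h1.2.1
    · rw [(Prod.mk.inj (Finset.mem_singleton.1 hc)).2]
      congr 1
      omega
  down_known j hj := by
    have hle := hrec.le
    rw [add_assoc]
    rcases Nat.lt_or_ge (a + j) s with h1 | h1
    · exact Finset.mem_union_left _ (hrec.known z hz (a + j) (by omega) h1)
    · rw [show a + j = s by omega]
      by_cases h2 : (z, (t₀ + s) % N) ∈ D
      · exact Finset.mem_union_left _ h2
      · exact Finset.mem_union_right _
          (Finset.mem_sdiff.2 ⟨mem_cellSlots.2 ⟨child_mem_star hz, rfl⟩, h2⟩)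

theorem depth_le_of_mem_cell (h : R.Run N τ w t₀ D O x s m Γ) {c c' : ℕ}
    (hc : (z, c) ∈ R.cellSlots x c' \ D) : R.depth z ≤ R.depth w + m + 1 := by
  have h3 := h.depth
  rcases mem_star.1 (mem_cellSlots.1 (Finset.mem_sdiff.1 hc).1).1 with h1 | h1
  · simp only at h1
    subst h1
    omega
  · have := depth_child h1
    simp only at this
    omega

theorem record_wait (h : R.Run N τ w t₀ D O x s m Γ) {a : ℕ}
    (hrec : R.RunRecord N w t₀ D O x s m a) (hs : s < N) :
    R.RunRecord N w t₀ (D ∪ (R.cellSlots x ((t₀ + s) % N) \ D)) O x (s + 1) m a where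
  le := by have := hrec.le; omega
  deep z hz c hc := by
    have hle := hrec.le
    rcases Finset.mem_union.1 hc with hc | hc
    · rcases hrec.deep z hz c hc with h1 | ⟨h1, h2, j, hj, hj', h3⟩
      · exact Or.inl h1
      · exact Or.inr ⟨h1, h2, j, hj, by omega, h3⟩
    · obtain ⟨h1, h2⟩ := mem_cellSlots.1 (Finset.mem_sdiff.1 hc).1
      simp only at h1 h2
      rcases mem_star.1 h1 with h1 | h1
      · exact Or.inl (h1 ▸ h.depth.le)
      · refine Or.inr ⟨h1, fun h3 => h.child_not_mem hs h1 ?_, s, hle, by omega, h2⟩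
        exact h.subset (h2 ▸ h3)
  up := hrec.up
  known z hz j hj hj' := by
    rcases Nat.lt_or_ge j s with h1 | h1
    · exact Finset.mem_union_left _ (hrec.known z hz j hj h1)
    · rw [show j = s by omega]
      exact Finset.mem_union_right _ (Finset.mem_sdiff.2
        ⟨mem_cellSlots.2 ⟨child_mem_star hz, rfl⟩, h.child_not_mem hs hz⟩)

/-- Stepping to a child at a new record height. -/
theorem record_stepDown (h : R.Run N τ w t₀ D O x s m Γ)
    (hdeep : ∀ z, R.Below w z → ∀ c, (z, c) ∈ D → R.depth z ≤ R.depth w + (m + 1))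
    (hbar : ∀ z ∈ R.children x, ∀ c, (z, c) ∉ O) (hz : z ∈ R.children x) :
    R.RunRecord N w t₀ (D ∪ (R.cellSlots x ((t₀ + s) % N) \ D)) (O ∪ {(z, (t₀ + s) % N)}) z
      (s + 1) (m + 1) (s + 1) where
  le := le_rfl
  deep z' hz' c hc := by
    rcases Finset.mem_union.1 hc with hc | hc
    · exact Or.inl (hdeep z' hz' c hc)
    · exact Or.inl (h.depth_le_of_mem_cell hc)
  up c hc := by
    rcases Finset.mem_union.1 hc with hc | hc
    · exact absurd hc (hbar z hz c)
    · rw [(Prod.mk.inj (Finset.mem_singleton.1 hc)).2, Nat.mod_add_mod, add_assoc]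
  known _ _ j hj hj' := by omega

/-- The heights found so far, after exploring the present cell. -/
theorem runBelow_union (h : R.Run N τ w t₀ D O x s m Γ) {hh c : ℕ} (hm : m < hh)
    (hdeep : ∀ z, R.Below w z → ∀ c, (z, c) ∈ D → R.depth z ≤ R.depth w + hh)
    (hbar : ∀ z, R.Below w z → ∀ c, (z, c) ∈ O → R.depth z < R.depth w + hh)
    {A : Finset (V × ℕ)} (hA : ∀ q ∈ A, R.depth q.1 < R.depth w + hh) :
    R.RunBelow w (D ∪ (R.cellSlots x c \ D)) (O ∪ A) hh where
  deep z hz c hc := by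
    rcases Finset.mem_union.1 hc with hc | hc
    · exact hdeep z hz c hc
    · have := h.depth_le_of_mem_cell hc
      omega
  deep_bar z hz c hc := by
    rcases Finset.mem_union.1 hc with hc | hc
    · exact hbar z hz c hc
    · exact hA _ hc

end Run

variable [DecidableEq V] [MeasurableSpace Ω] {P : Measure Ω} [IsProbabilityMeasure P] {r : ℝ}

/-- One step of the walk from a vertex `x` at which the present cell is unexplored, except possibly
for the edge above `x`. Going down brings a gain `δd`, going up a loss `δu`, waiting a loss `ε`. -/
theorem exitEvent_le_of_step (hb : IsBernoulliSet P b (R.slots N) r) (hN : 0 < N)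
    (hr0 : 0 ≤ r) (hr1 : r ≤ 1) (htwo : ∀ x, 1 < (R.children x).card)
    (hx0 : 0 < R.depth x) (hOD : O ⊆ D) (hDx : ∀ z ∈ R.children x, (z, t % N) ∉ D)
    (hOx : (x, t % N) ∉ O) {c ε δd δu : ℝ} (hc : 0 ≤ c) (hε : 0 ≤ ε) (hδd : 0 ≤ δd)
    (hδu : 0 ≤ δu) (hsum : ε ≤ r * (2 * δd - δu))
    (hnone : P.real (bitCylinder b (D ∪ (R.cellSlots x (t % N) \ D)) O ∩
        R.exitEvent n N b w k x (t + 1))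
      ≤ (c + ε) * P.real (bitCylinder b (D ∪ (R.cellSlots x (t % N) \ D)) O))
    (hdown : ∀ z ∈ R.children x,
      P.real (bitCylinder b (D ∪ (R.cellSlots x (t % N) \ D)) (O ∪ {(z, t % N)}) ∩
        R.exitEvent n N b w k z (t + 1))
      ≤ (c - δd) * P.real (bitCylinder b (D ∪ (R.cellSlots x (t % N) \ D)) (O ∪ {(z, t % N)})))
    (hexit : x = w → 1 ≤ c + δu)
    (hup : x ≠ w →
      P.real (bitCylinder b (D ∪ (R.cellSlots x (t % N) \ D)) (O ∪ {(x, t % N)}) ∩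
        R.exitEvent n N b w k (R.parent x) (t + 1))
      ≤ (c + δu) * P.real (bitCylinder b (D ∪ (R.cellSlots x (t % N) \ D)) (O ∪ {(x, t % N)}))) :
    P.real (bitCylinder b D O ∩ R.exitEvent n N b w (k + 1) x t)
      ≤ c * P.real (bitCylinder b D O) := by
  rcases le_or_gt n (R.depth x) with hxn | hxn
  · rw [inter_exitEvent_of_depth hxn, measureReal_empty]
    exact mul_nonneg hc measureReal_nonneg
  set Q := R.cellSlots x (t % N) \ D with hQ
  have hOstar : ∀ z ∈ R.star x, (z, t % N) ∉ O := fun z hz => by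
    rcases mem_star.1 hz with rfl | hz
    · exact hOx
    · exact fun h => hDx z hz (hOD h)
  have hstar : ∀ z ∈ R.star x, (z, t % N) ∈ D ∪ Q := fun z hz => by
    by_cases h : (z, t % N) ∈ D
    · exact Finset.mem_union_left _ h
    · exact Finset.mem_union_right _ (Finset.mem_sdiff.2 ⟨mem_cellSlots.2 ⟨hz, rfl⟩, h⟩)
  have hpat : ∀ z' ∈ R.star x, ∀ z ∈ R.star x, (z, t % N) ∈ O ∪ {(z', t % N)} ↔ z = z' :=
    fun z' _ z hz => by
      rw [Finset.mem_union, or_iff_right (hOstar z hz), Finset.mem_singleton, Prod.mk.injEq,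
        and_iff_left rfl]
  have hchQ : (R.children x).image (·, t % N) ⊆ Q := fun q hq => by
    obtain ⟨z, hz, rfl⟩ := Finset.mem_image.1 hq
    exact Finset.mem_sdiff.2 ⟨mem_cellSlots.2 ⟨child_mem_star hz, rfl⟩, hDx z hz⟩
  have hmain := hb.le_of_split_card_le_one (R.exitEvent n N b w (k + 1) x t) hOD Q
    Finset.sdiff_disjoint (cellSlots_subset_slots hx0 hN) c (-ε)
    (fun q => if q.1 = x then -δu else δd) ?_ ?_ ?_
  · refine hmain.trans (mul_le_mul_of_nonneg_right ?_ measureReal_nonneg)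
    have hcardim : ((R.children x).image (·, t % N)).card = (R.children x).card :=
      Finset.card_image_of_injective _ fun a b h => (Prod.mk.inj h).1
    have hQ1 : 1 ≤ Q.card := by
      have h1 := Finset.card_le_card hchQ
      have h2 := htwo x
      omega
    have hgain : 2 * δd - δu ≤ ∑ q ∈ Q, (if q.1 = x then -δu else δd) := by
      rw [← Finset.sum_sdiff hchQ]
      have h1 : ∑ q ∈ (R.children x).image (·, t % N), (if q.1 = x then -δu else δd)
          = (R.children x).card * δd := by
        rw [Finset.sum_congr rfl (g := fun _ => δd), Finset.sum_const, hcardim, nsmul_eq_mul]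
        intro q hq
        obtain ⟨z, hz, rfl⟩ := Finset.mem_image.1 hq
        exact if_neg (ne_of_mem_children hz)
      have h2 : -δu ≤ ∑ q ∈ Q \ (R.children x).image (·, t % N),
          (if q.1 = x then -δu else δd) := by
        have h3 : Q \ (R.children x).image (·, t % N) ⊆ {(x, t % N)} := fun q hq => by
          obtain ⟨h4, h5⟩ := Finset.mem_sdiff.1 hq
          obtain ⟨h6, h7⟩ := mem_cellSlots.1 (Finset.mem_sdiff.1 h4).1
          rcases mem_star.1 h6 with h8 | h8
          · exact Finset.mem_singleton.2 (Prod.ext h8 h7)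
          · exact absurd (Finset.mem_image.2
              ⟨q.1, h8, (Prod.ext rfl h7.symm : (q.1, t % N) = q)⟩) h5
        rcases Finset.subset_singleton_iff.1 h3 with h4 | h4
        · rw [h4, Finset.sum_empty]; linarith
        · rw [h4, Finset.sum_singleton, if_pos rfl]
      have h3 : (2 : ℝ) * δd ≤ (R.children x).card * δd :=
        mul_le_mul_of_nonneg_right (by exact_mod_cast htwo x) hδd
      linarith
    obtain ⟨q, hq⟩ := Nat.exists_eq_add_of_le' hQ1
    rw [hq, Nat.add_sub_cancel, pow_succ]
    have h1 : 0 ≤ (1 - r) ^ q := pow_nonneg (by linarith) _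
    have h2 : ε * (1 - r) ≤ r * ∑ q ∈ Q, (if q.1 = x then -δu else δd) := by
      have h3 := mul_le_mul_of_nonneg_left hgain hr0
      have h4 : 0 ≤ ε * r := mul_nonneg hε hr0
      linarith
    have h3 := mul_le_mul_of_nonneg_left h2 h1
    linarith
  · rw [inter_exitEvent_none hxn hstar hOstar, sub_neg_eq_add]
    exact hnone
  · intro q hq
    obtain ⟨h6, h7⟩ := mem_cellSlots.1 (Finset.mem_sdiff.1 hq).1
    obtain ⟨z, c'⟩ := q
    simp only at h6 h7
    subst h7
    rcases mem_star.1 h6 with rfl | hz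
    · rw [if_pos rfl, sub_neg_eq_add]
      by_cases hzw : z = w
      · subst hzw
        rw [inter_exitEvent_up_self hxn hstar (hpat z h6)]
        exact le_mul_of_one_le_left measureReal_nonneg (hexit rfl)
      · rw [inter_exitEvent_up hxn hzw hstar (hpat z h6)]
        exact hup hzw
    · rw [if_neg (ne_of_mem_children hz), inter_exitEvent_child hxn hz hstar (hpat z h6)]
      exact hdown z hz
  · intro A hA hcard
    obtain ⟨q, hq, q', hq', hne⟩ := Finset.one_lt_card.1 hcard
    obtain ⟨h1, h2⟩ := mem_cellSlots.1 (Finset.mem_sdiff.1 (hA hq)).1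
    obtain ⟨h1', h2'⟩ := mem_cellSlots.1 (Finset.mem_sdiff.1 (hA hq')).1
    have hqe : q = (q.1, t % N) := Prod.ext rfl h2
    have hqe' : q' = (q'.1, t % N) := Prod.ext rfl h2'
    rw [inter_exitEvent_two h1 h1' (fun h => hne (Prod.ext h (h2.trans h2'.symm)))
      (Finset.union_subset_union hOD hA) (Finset.mem_union_right _ (hqe ▸ hq))
      (Finset.mem_union_right _ (hqe' ▸ hq')), measureReal_empty]
    exact mul_nonneg hc measureReal_nonneg

end ParentTree

/-! ### The potential of a run -/

theorem one_sub_pow_le_one_sub_mul {x : ℝ} (hx0 : 0 ≤ x) (hx1 : x ≤ 1) (g : ℕ) (hg : g * x ≤ 1) :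
    (1 - x) ^ g ≤ 1 - g * x / 2 := by
  have h1 : 1 + g * x ≤ (1 + x) ^ g := one_add_mul_le_pow (by linarith) g
  have h2 : (1 - x) ^ g * (1 + x) ^ g ≤ 1 := by
    rw [← mul_pow]
    exact pow_le_one₀ (mul_nonneg (by linarith) (by linarith)) (by nlinarith)
  have h3 : 0 ≤ (1 - x) ^ g := pow_nonneg (by linarith) g
  have h4 : (1 - x) ^ g * (1 + g * x) ≤ 1 := (mul_le_mul_of_nonneg_left h1 h3).trans h2
  have h5 : 0 ≤ g * x := mul_nonneg (Nat.cast_nonneg g) hx0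
  have h6 : 1 ≤ (1 - g * x / 2) * (1 + g * x) := by nlinarith
  exact le_of_mul_le_mul_right (h4.trans h6) (by linarith)

namespace ParentTree

variable {V Ω : Type*}

/-- A lower bound, in expectation, for the number of ancestors visited only once that the run will
have when it reaches height `2 * K`. The first sum discounts each present such ancestor by the
chance that it is visited again, as if the walk went down with probability `4 / 7` only. The second
summand is the expected contribution of the heights to come, from which the third removes the
heights already used up. The last summand penalises long durations. -/
noncomputable def runPotential (R : ParentTree V) (w : V) (K : ℕ) (α r : ℝ) (Γ : Finset V)
    (m h s : ℕ) : ℝ :=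
  ∑ u ∈ Γ, (1 - (3 / 4 : ℝ) ^ (m - (R.depth u - R.depth w))) + K / 6 * (1 - (3 / 4) ^ (m + 1))
    - (((h + 1) / 2 : ℕ) : ℝ) / 6 - α * (s + (2 * K - m) * (2 / r))

/-- The part of the potential that is sensitive to going up and down. -/
noncomputable def runWeight (R : ParentTree V) (w : V) (K : ℕ) (Γ : Finset V) (m : ℕ) : ℝ :=
  ∑ u ∈ Γ, (3 / 4 : ℝ) ^ (m - (R.depth u - R.depth w)) + K / 6 * (3 / 4) ^ (m + 1)

variable {R : ParentTree V} {n N τ K : ℕ} {b : Ω → Set (V × ℕ)} {w x y z u : V} {k t t₀ s m h : ℕ}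
  {D O : Finset (V × ℕ)} {Γ : Finset V} {α r : ℝ}

theorem runWeight_nonneg : 0 ≤ R.runWeight w K Γ m := by
  unfold runWeight
  positivity

theorem runPotential_wait : R.runPotential w K α r Γ m h (s + 1)
    = R.runPotential w K α r Γ m h s - α := by
  unfold runPotential
  push_cast
  ring

theorem runPotential_down (hΓ : ∀ u ∈ Γ, R.depth u - R.depth w < m) :
    R.runPotential w K α r Γ (m + 1) h (s + 1)
      = R.runPotential w K α r Γ m h s + (R.runWeight w K Γ m / 4 + α * (2 / r) - α) := by
  have h1 : ∑ u ∈ Γ, (1 - (3 / 4 : ℝ) ^ (m + 1 - (R.depth u - R.depth w)))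
      = ∑ u ∈ Γ, (1 - (3 / 4 : ℝ) ^ (m - (R.depth u - R.depth w)))
        + (∑ u ∈ Γ, (3 / 4 : ℝ) ^ (m - (R.depth u - R.depth w))) / 4 := by
    rw [Finset.sum_div, ← Finset.sum_add_distrib]
    refine Finset.sum_congr rfl fun u hu => ?_
    rw [Nat.sub_add_comm (hΓ u hu).le, pow_succ]
    ring
  unfold runPotential runWeight
  rw [h1]
  push_cast
  ring

theorem runPotential_insert [DecidableEq V] (hx : x ∉ Γ) (hxm : R.depth x = R.depth w + m)
    (hm : m % 2 = 0) :
    R.runPotential w K α r (insert x Γ) (m + 1) (m + 1) s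
      = R.runPotential w K α r Γ (m + 1) m s + 1 / 12 := by
  have h1 : (m + 1 + 1) / 2 = (m + 1) / 2 + 1 := by omega
  have h2 : m + 1 - (R.depth x - R.depth w) = 1 := by omega
  unfold runPotential
  rw [Finset.sum_insert hx, h1, h2]
  push_cast
  ring

theorem runPotential_height {m' : ℕ} :
    R.runPotential w K α r Γ m' (m + 1) s
      = R.runPotential w K α r Γ m' m s - (if m % 2 = 0 then 1 else 0) / 6 := by
  unfold runPotential
  split_ifs with hm
  · have h1 : (m + 1 + 1) / 2 = (m + 1) / 2 + 1 := by omega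
    rw [h1]
    push_cast
    ring
  · have h1 : (m + 1 + 1) / 2 = (m + 1) / 2 := by omega
    rw [h1]
    ring

theorem runPotential_up [DecidableEq V] (hΓ : ∀ u ∈ Γ, R.depth u - R.depth w < m)
    (hm : 0 < m) (hx : R.depth x = R.depth w + (m - 1)) :
    R.runPotential w K α r (Γ.erase x) (m - 1) h (s + 1)
      = R.runPotential w K α r Γ m h s - (R.runWeight w K Γ m / 3 + α * (2 / r) + α) := by
  obtain ⟨m, rfl⟩ := Nat.exists_eq_add_of_le' hm
  rw [Nat.add_sub_cancel] at hx ⊢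
  have h1 : ∑ u ∈ Γ.erase x, (1 - (3 / 4 : ℝ) ^ (m - (R.depth u - R.depth w)))
      = ∑ u ∈ Γ, (1 - (3 / 4 : ℝ) ^ (m + 1 - (R.depth u - R.depth w)))
        - (∑ u ∈ Γ, (3 / 4 : ℝ) ^ (m + 1 - (R.depth u - R.depth w))) / 3 := by
    rw [Finset.sum_erase, Finset.sum_div, ← Finset.sum_sub_distrib]
    · refine Finset.sum_congr rfl fun u hu => ?_
      rw [Nat.sub_add_comm (Nat.lt_succ_iff.1 (hΓ u hu)), pow_succ]
      ring
    · rw [hx]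
      simp
  unfold runPotential runWeight
  rw [h1]
  push_cast
  ring

theorem runPotential_le {m : ℕ} (hα : 0 ≤ α) (hr : 0 < r) (hm : m ≤ 2 * K) :
    R.runPotential w K α r Γ m h s ≤ Γ.card + (K - ((h + 1) / 2 : ℕ)) / 6 - α * s := by
  have h1 : ∑ u ∈ Γ, (1 - (3 / 4 : ℝ) ^ (m - (R.depth u - R.depth w))) ≤ Γ.card := by
    calc _ ≤ ∑ u ∈ Γ, (1 : ℝ) := Finset.sum_le_sum fun u _ => by
          have : (0 : ℝ) ≤ (3 / 4) ^ (m - (R.depth u - R.depth w)) := by positivity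
          linarith
      _ = _ := by simp
  have h2 : (K : ℝ) / 6 * (1 - (3 / 4) ^ (m + 1)) ≤ K / 6 := by
    refine mul_le_of_le_one_right (by positivity) ?_
    have : (0 : ℝ) ≤ (3 / 4) ^ (m + 1) := by positivity
    linarith
  have h3 : 0 ≤ α * ((2 * K - m) * (2 / r)) := by
    have : (m : ℝ) ≤ 2 * K := by exact_mod_cast hm
    have : (0 : ℝ) ≤ 2 * K - m := by linarith
    positivity
  unfold runPotential
  linarith

variable [DecidableEq V] [MeasurableSpace Ω] {P : Measure Ω} [IsProbabilityMeasure P]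

/-- The conditional probability of escape in the course of a run is at least proportional to the
potential. -/
theorem exitEvent_le_of_run (hb : IsBernoulliSet P b (R.slots N) r) (hN : 0 < N)
    (hr0 : 0 < r) (hr1 : r ≤ 1 / 3) {L M τ K : ℕ} (hcard : ∀ x, (R.star x).card ≤ M)
    (htwo : ∀ x, 1 < (R.children x).card) {ρ p : ℝ} (hp : 0 ≤ p)
    (hρ0 : 0 ≤ ρ) (hρp1 : ρ * p ≤ 1)
    (hρ : ρ ≤ L * r * (1 - r) ^ (M * L)) (hL : 1 / 2 ≤ (1 - r) ^ (L + 1))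
    (hτ : τ + L + 2 ≤ N) (hK : K * (ρ * p / 2) ≤ 1) (hα : 0 ≤ α) (hατ : 2 * K ≤ α * τ)
    (hw : 0 < R.depth w) (hR : ∀ z, R.depth w < R.depth z → R.EscapeBound n N P b p z)
    (h : R.Run N τ w t₀ D O x s m Γ) (hm : m ≤ 2 * K) (hs : s ≤ τ) {hh : ℕ}
    (hmode : (hh = m ∧ ∃ a, R.RunRecord N w t₀ D O x s m a) ∨ (m < hh ∧ R.RunBelow w D O hh)) :
    P.real (bitCylinder b D O ∩ R.exitEvent n N b w k x (t₀ + s))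
      ≤ (1 - ρ * p / 4 * R.runPotential w K α r Γ m hh s) * P.real (bitCylinder b D O) := by
  have hρp0 : 0 ≤ ρ * p := mul_nonneg hρ0 hp
  have htriv : ∀ S : Set Ω, P.real (bitCylinder b D O ∩ S) ≤ P.real (bitCylinder b D O) :=
    fun S => measureReal_mono Set.inter_subset_left
  induction k generalizing D O x s m Γ hh with
  | zero =>
    have hemp : bitCylinder b D O ∩ R.exitEvent n N b w 0 x (t₀ + s) = ∅ := by
      simp [exitEvent, Exits]
    rw [hemp, measureReal_empty]
    refine mul_nonneg ?_ measureReal_nonneg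
    have h1 := runPotential_le (R := R) (w := w) (Γ := Γ) (h := hh) (s := s) hα hr0 hm
    have h2 : (Γ.card : ℝ) ≤ K := by
      have := h.card_le
      exact_mod_cast (by omega : Γ.card ≤ K)
    have h3 : (0 : ℝ) ≤ ((hh + 1) / 2 : ℕ) := Nat.cast_nonneg _
    have h4 : 0 ≤ α * s := by positivity
    have hK0 : (0 : ℝ) ≤ K := Nat.cast_nonneg _
    have h5 : R.runPotential w K α r Γ m hh s ≤ 2 * K := by linarith
    have h6 := mul_le_mul_of_nonneg_left h5 (by positivity : 0 ≤ ρ * p / 4)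
    linarith
  | succ k ih =>
    set H := R.runPotential w K α r Γ m hh s with hH
    set κ := ρ * p / 4 with hκ
    have hκ0 : 0 ≤ κ := by positivity
    rcases le_or_gt (κ * H) 0 with hneg | hpos
    · exact (htriv _).trans (le_mul_of_one_le_left measureReal_nonneg (by linarith))
    have hHpos : 0 < H := pos_of_mul_pos_right hpos hκ0
    have hcardK : Γ.card ≤ K := by
      have := h.card_le
      omega
    have hcardK' : (Γ.card : ℝ) ≤ K := by exact_mod_cast hcardK
    have hK0 : (0 : ℝ) ≤ K := Nat.cast_nonneg _
    have hHle := runPotential_le (R := R) (w := w) (Γ := Γ) (h := hh) (s := s) hα hr0 hm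
    rw [← hH] at hHle
    have hhh0 : (0 : ℝ) ≤ ((hh + 1) / 2 : ℕ) := Nat.cast_nonneg _
    have hαs : 0 ≤ α * s := by positivity
    have hmh : m ≤ hh := by
      rcases hmode with ⟨rfl, -⟩ | ⟨h1, -⟩ <;> omega
    have hc0 : 0 ≤ 1 - κ * H := by
      have h5 : H ≤ 2 * K := by linarith
      have h6 := mul_le_mul_of_nonneg_left h5 hκ0
      rw [hκ] at h6 ⊢
      linarith
    rcases hm.eq_or_lt with hm2 | hm2
    · -- the run has reached its final height
      refine (exitEvent_le_pow hb hN hr0.le (by linarith) hcard htwo hp hρp0 hρp1 hρ hL hτ hw hR Γ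
        h.subset (fun u hu u' hu' => ?_) (fun u hu => ?_)).trans
        (mul_le_mul_of_nonneg_right ?_ measureReal_nonneg)
      · have h1 := (h.good u hu).2.1
        have h2 := (h.good u' hu').2.1
        have h3 := (h.ancestor_lt hu).2.1
        have h4 := (h.ancestor_lt hu').2.1
        omega
      · exact ⟨(h.good u hu).1, (h.good u hu).2.2⟩
      · have h1 : (K : ℝ) ≤ ((hh + 1) / 2 : ℕ) := by
          exact_mod_cast (by omega : K ≤ (hh + 1) / 2)
        have h2 : H ≤ Γ.card := by linarith
        have h3 := mul_le_mul_of_nonneg_left h2 hκ0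
        have h4 : Γ.card * (ρ * p / 2) ≤ 1 :=
          (mul_le_mul_of_nonneg_right hcardK' (by positivity)).trans hK
        have h5 := one_sub_pow_le_one_sub_mul (by positivity : 0 ≤ ρ * p / 2) (by linarith)
          Γ.card h4
        rw [hκ] at h3 ⊢
        linarith
    rcases hs.eq_or_lt with hs2 | hs2
    · -- after half a turn the penalty for the duration makes the potential non-positive
      exfalso
      rw [← hs2] at hατ
      linarith
    set Θ := R.runWeight w K Γ m with hΘ
    have hΘ0 : 0 ≤ Θ := runWeight_nonneg
    have hsN : s + 1 < N := by omega
    have hΓlt : ∀ u ∈ Γ, R.depth u - R.depth w < m := fun u hu => by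
      have := h.ancestor_lt hu
      omega
    have h2r : 6 ≤ 2 / r := by
      rw [le_div_iff₀ hr0]
      linarith
    have hα2r : α * 6 ≤ α * (2 / r) := mul_le_mul_of_nonneg_left h2r hα
    -- `f` is the additional effect of leaving, at an even record height, the vertex `x`
    obtain ⟨f, hf0, hnone, hdown, hup⟩ : ∃ f : ℝ, 0 ≤ f ∧
        P.real (bitCylinder b (D ∪ (R.cellSlots x ((t₀ + s) % N) \ D)) O ∩
            R.exitEvent n N b w k x (t₀ + (s + 1)))
          ≤ (1 - κ * (H - α)) *
            P.real (bitCylinder b (D ∪ (R.cellSlots x ((t₀ + s) % N) \ D)) O) ∧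
        (∀ z ∈ R.children x,
          P.real (bitCylinder b (D ∪ (R.cellSlots x ((t₀ + s) % N) \ D))
            (O ∪ {(z, (t₀ + s) % N)}) ∩ R.exitEvent n N b w k z (t₀ + (s + 1)))
          ≤ (1 - κ * (H + (Θ / 4 + α * (2 / r) - α + f / 12))) *
            P.real (bitCylinder b (D ∪ (R.cellSlots x ((t₀ + s) % N) \ D))
              (O ∪ {(z, (t₀ + s) % N)}))) ∧
        (x ≠ w →
          P.real (bitCylinder b (D ∪ (R.cellSlots x ((t₀ + s) % N) \ D))
            (O ∪ {(x, (t₀ + s) % N)}) ∩ R.exitEvent n N b w k (R.parent x) (t₀ + (s + 1)))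
          ≤ (1 - κ * (H - (Θ / 3 + α * (2 / r) + α + f / 6))) *
            P.real (bitCylinder b (D ∪ (R.cellSlots x ((t₀ + s) % N) \ D))
              (O ∪ {(x, (t₀ + s) % N)}))) := by
      have htriv' : ∀ (D' O' : Finset (V × ℕ)) (S : Set Ω),
          P.real (bitCylinder b D' O' ∩ S) ≤ P.real (bitCylinder b D' O') :=
        fun D' O' S => measureReal_mono Set.inter_subset_left
      have hparent : x ≠ w → 0 < m ∧ R.depth (R.parent x) = R.depth w + (m - 1) := fun hxw => by
        have h1 := h.below.depth_lt hxw
        have h2 := R.depth_parent (y := x) (by omega)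
        have h3 := h.depth
        omega
      rcases hmode with ⟨rfl, a, hrec⟩ | ⟨hmlt, hbelow⟩
      · refine ⟨if hh % 2 = 0 then 1 else 0, by positivity, ?_, fun z hz => ?_, fun hxw => ?_⟩
        · have := ih h.wait hm (by omega) (Or.inl ⟨rfl, a, h.record_wait hrec (by omega)⟩)
            (htriv' _ _)
          rwa [runPotential_wait] at this
        · have hrec' := h.record_stepDown (fun z' hz' c hc => h.record_deep hrec hz' hc)
            (h.record_children hrec) hz
          split_ifs with hpar
          · have hxΓ : x ∉ Γ := fun hx => by
              have := (h.ancestor_lt hx).2.2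
              have := h.depth
              omega
            have hrun := h.stepDown (by omega) hz
            have hrun' : R.Run N τ w t₀ _ _ z (s + 1) (hh + 1) (insert x Γ) :=
              ⟨hrun.subset, hrun.below, hrun.depth, hrun.up, hrun.cells, fun u hu => by
                rcases Finset.mem_insert.1 hu with rfl | hu
                · refine ⟨h.below, ?_, z, t₀ + a, s - a, by omega, Below.refl z,
                    h.onceVisited hrec hz⟩
                  have := h.depth
                  omega
                · exact hrun.good u hu⟩
            have := ih hrun' (by omega) (by omega) (Or.inl ⟨rfl, _, hrec'⟩) (htriv' _ _)
            rw [runPotential_insert hxΓ h.depth hpar, runPotential_down hΓlt, ← hΘ, ← hH] at this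
            refine this.trans (le_of_eq ?_)
            ring
          · have := ih (h.stepDown (by omega) hz) (by omega) (by omega) (Or.inl ⟨rfl, _, hrec'⟩)
              (htriv' _ _)
            rw [runPotential_height, if_neg hpar, runPotential_down hΓlt, ← hΘ, ← hH] at this
            refine this.trans (le_of_eq ?_)
            ring
        · have hbel : R.RunBelow w (D ∪ (R.cellSlots x ((t₀ + s) % N) \ D))
              (O ∪ {(x, (t₀ + s) % N)}) (hh + 1) :=
            h.runBelow_union (by omega) (fun z' hz' c hc => h.record_deep hrec hz' hc)
              (fun z' hz' c hc => by have := h.record_bar hrec hz' hc; omega)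
              (fun q hq => by
                rw [Finset.mem_singleton.1 hq]
                have := h.depth
                simp only
                omega)
          obtain ⟨hm0, hpd⟩ := hparent hxw
          have := ih (h.stepUp (by omega) hxw) (by omega) (by omega)
            (Or.inr ⟨by omega, hbel⟩) (htriv' _ _)
          rw [runPotential_height, runPotential_up hΓlt hm0 hpd, ← hΘ, ← hH] at this
          refine this.trans (le_of_eq ?_)
          ring
      · refine ⟨0, le_rfl, ?_, fun z hz => ?_, fun hxw => ?_⟩
        · have hbel := h.runBelow_union (c := (t₀ + s) % N) hmlt hbelow.deep hbelow.deep_bar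
            (A := ∅) (by simp)
          rw [Finset.union_empty] at hbel
          have := ih h.wait hm (by omega) (Or.inr ⟨hmlt, hbel⟩) (htriv' _ _)
          rwa [runPotential_wait] at this
        · have hmode' : (hh = m + 1 ∧ ∃ a, R.RunRecord N w t₀
              (D ∪ (R.cellSlots x ((t₀ + s) % N) \ D)) (O ∪ {(z, (t₀ + s) % N)}) z (s + 1)
              (m + 1) a) ∨ (m + 1 < hh ∧ R.RunBelow w (D ∪ (R.cellSlots x ((t₀ + s) % N) \ D))
                (O ∪ {(z, (t₀ + s) % N)}) hh) := by
            have hzd := depth_child hz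
            have hxd := h.depth
            rcases Nat.lt_or_ge (m + 1) hh with h1 | h1
            · exact Or.inr ⟨h1, h.runBelow_union hmlt hbelow.deep hbelow.deep_bar (fun q hq => by
                rw [Finset.mem_singleton.1 hq]
                simp only
                omega)⟩
            · obtain rfl : hh = m + 1 := by omega
              exact Or.inl ⟨rfl, _, h.record_stepDown hbelow.deep (fun z' hz' c hc => by
                have h2 := hbelow.deep_bar z' (h.below.child hz') c hc
                have h3 := depth_child hz'
                omega) hz⟩
          have := ih (h.stepDown (by omega) hz) (by omega) (by omega) hmode' (htriv' _ _)
          rw [runPotential_down hΓlt, ← hΘ, ← hH] at this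
          refine this.trans (le_of_eq ?_)
          ring
        · have hbel : R.RunBelow w (D ∪ (R.cellSlots x ((t₀ + s) % N) \ D))
              (O ∪ {(x, (t₀ + s) % N)}) hh :=
            h.runBelow_union hmlt hbelow.deep hbelow.deep_bar (fun q hq => by
                rw [Finset.mem_singleton.1 hq]
                have := h.depth
                simp only
                omega)
          obtain ⟨hm0, hpd⟩ := hparent hxw
          have := ih (h.stepUp (by omega) hxw) (by omega) (by omega)
            (Or.inr ⟨by omega, hbel⟩) (htriv' _ _)
          rw [runPotential_up hΓlt hm0 hpd, ← hΘ, ← hH] at this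
          refine this.trans (le_of_eq ?_)
          ring
    refine exitEvent_le_of_step hb hN hr0.le (by linarith) htwo (hw.trans_le h.below.1) h.subset
      (fun z hz => h.child_not_mem (by omega) hz) (h.up_not_mem hsN) hc0 (ε := κ * α)
      (δd := κ * (Θ / 4 + α * (2 / r) - α + f / 12))
      (δu := κ * (Θ / 3 + α * (2 / r) + α + f / 6))
      (by positivity) (mul_nonneg hκ0 (by linarith)) (mul_nonneg hκ0 (by linarith)) ?_
      (hnone.trans (le_of_eq (by ring))) (fun z hz => (hdown z hz).trans (le_of_eq (by ring)))
      ?_ (fun hxw => (hup hxw).trans (le_of_eq (by ring)))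
    · have h1 : r * (2 / r) = 2 := by field_simp
      have h2 : α ≤ r * (Θ / 6 + α * (2 / r) - 3 * α) := by
        have h3 : r * (α * (2 / r)) = 2 * α := by
          rw [mul_left_comm, h1]
          ring
        have h4 : 0 ≤ r * Θ := by positivity
        have h5 : r * α ≤ 1 / 3 * α := mul_le_mul_of_nonneg_right hr1 hα
        linarith
      have h3 := mul_le_mul_of_nonneg_left h2 hκ0
      refine h3.trans (le_of_eq ?_)
      ring
    · intro hxw
      subst hxw
      have hm0 : m = 0 := by
        have := h.depth
        omega
      subst hm0
      have hΓ0 : Γ = ∅ := by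
        rw [← Finset.card_eq_zero]
        have := h.card_le
        omega
      have h1 : Θ = K / 6 * (3 / 4) := by
        rw [hΘ, hΓ0]
        simp [runWeight]
      have h2 : H ≤ K / 24 := by
        have h3 : H = K / 6 * (1 - 3 / 4) - (((hh + 1) / 2 : ℕ) : ℝ) / 6
            - α * (s + 2 * K * (2 / r)) := by
          rw [hH, hΓ0]
          simp [runPotential]
        have h4 : 0 ≤ α * (s + 2 * K * (2 / r)) := by positivity
        linarith
      have h3 : H ≤ Θ / 3 + α * (2 / r) + α + f / 6 := by
        have : 0 ≤ α * (2 / r) := by linarith [mul_nonneg hα (by norm_num : (0 : ℝ) ≤ 6)]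
        linarith
      have h4 := mul_le_mul_of_nonneg_left h3 hκ0
      linarith

/-- The escape probability from a subtree visited for the first time is at least `p`. -/
theorem escapeBound (hb : IsBernoulliSet P b (R.slots N) r) (hN : 0 < N)
    (hr0 : 0 < r) (hr1 : r ≤ 1 / 3) {L M τ K : ℕ} (hcard : ∀ x, (R.star x).card ≤ M)
    (htwo : ∀ x, 1 < (R.children x).card) {ρ p : ℝ} (hp : 0 ≤ p) (hp1 : p ≤ 1)
    (hρ0 : 0 ≤ ρ) (hρ1 : ρ ≤ 1)
    (hρ : ρ ≤ L * r * (1 - r) ^ (M * L)) (hL : 1 / 2 ≤ (1 - r) ^ (L + 1))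
    (hτ : τ + L + 2 ≤ N) (hK : K * (ρ * p / 2) ≤ 1) (hα : 0 ≤ α) (hατ : 2 * K ≤ α * τ)
    (hstart : 4 ≤ ρ * (K / 24 - 4 * K * α / r)) (hw : 0 < R.depth w) :
    R.EscapeBound n N P b p w := by
  induction hd : n - R.depth w using Nat.strong_induction_on generalizing w with
  | _ d ih =>
    intro D O t k hOD hF
    rcases le_or_gt n (R.depth w) with hn | hn
    · rw [inter_exitEvent_of_depth hn, measureReal_empty]
      exact mul_nonneg (by linarith) measureReal_nonneg
    have hrun : R.Run N τ w t D O w 0 0 ∅ :=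
      ⟨hOD, Below.refl w, rfl, hF.up, fun z hz hzw c hc => absurd hc (hF.below z hz hzw c),
        by simp⟩
    have hrec : R.RunRecord N w t D O w 0 0 0 :=
      ⟨le_rfl, fun z hz c hc => Or.inl (by
        by_cases hzw : z = w
        · rw [hzw]; rfl
        · exact absurd hc (hF.below z hz hzw c)), hF.up, fun _ _ j _ hj => by omega⟩
    have hmain := exitEvent_le_of_run (k := k) hb hN hr0 hr1 hcard htwo hp hρ0
      (mul_le_one₀ hρ1 hp hp1) hρ hL hτ hK hα hατ hw
      (fun z hz => ih (n - R.depth z) (by omega) (hw.trans hz) rfl) hrun (by omega) (by omega)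
      (Or.inl ⟨rfl, 0, hrec⟩)
    refine hmain.trans (mul_le_mul_of_nonneg_right ?_ measureReal_nonneg)
    have h1 : R.runPotential w K α r ∅ 0 0 0 = K / 24 - 4 * K * α / r := by
      simp only [runPotential, Finset.sum_empty]
      norm_num
      ring
    rw [h1]
    have h2 := mul_le_mul_of_nonneg_left hstart hp
    linarith

end ParentTree

/-! ### Escapes -/

namespace ParentTree

variable {V Ω : Type*} [DecidableEq V]

/-- For large `T` and a fine discretisation, the escape probability is bounded below, uniformly in
the tree and in the depth `n` that has to be reached. -/
theorem exists_escapeBound (M : ℕ) (hM : 3 ≤ M) : ∃ T₀ : ℝ, 0 < T₀ ∧ ∃ p : ℝ, 0 < p ∧ p ≤ 1 ∧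
    ∀ T : ℝ, T₀ ≤ T → ∃ N₀ : ℕ, 0 < N₀ ∧ ∀ N : ℕ, N₀ ≤ N →
      0 ≤ 1 - Real.exp (-(T / N)) ∧ 1 - Real.exp (-(T / N)) ≤ 1 ∧
      T / 2 ≤ N * (1 - Real.exp (-(T / N))) ∧
      ∀ {V Ω : Type*} [DecidableEq V] [MeasurableSpace Ω] (R : ParentTree V) (P : Measure Ω)
        [IsProbabilityMeasure P] (b : Ω → Set (V × ℕ)) (n : ℕ) (w : V),
        (∀ x, (R.star x).card ≤ M) → (∀ x, 1 < (R.children x).card) → 0 < R.depth w →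
        IsBernoulliSet P b (R.slots N) (1 - Real.exp (-(T / N))) →
        R.EscapeBound n N P b p w := by
  have hM' : (3 : ℝ) ≤ M := by exact_mod_cast hM
  -- A window of `L ≈ 1 / (2 * M * r)` cells shows exactly one bar at a given vertex, on a given
  -- edge, with probability at least `ρ = 1 / (8 * M)`. As the initial potential is about `K / 48`,
  -- the induction on the depth closes if `4 ≤ ρ * K / 48`.
  set K : ℕ := 1536 * M with hK
  have hKr : (K : ℝ) = 1536 * M := by rw [hK]; push_cast; ring
  have hKpos : (0 : ℝ) < K := by rw [hKr]; positivity
  refine ⟨3072 * K, by positivity, 1 / K, by positivity, ?_, fun T hT => ?_⟩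
  · rw [div_le_one hKpos, hKr]
    linarith
  obtain ⟨N₀, hN₀⟩ := exists_nat_ge (4 * M * T)
  have hTpos : 0 < T := lt_of_lt_of_le (by positivity) hT
  refine ⟨N₀ + 8, by omega, fun N hN => ?_⟩
  have hN8 : (8 : ℝ) ≤ N := by exact_mod_cast (by omega : 8 ≤ N)
  have hN4 : 4 * M * T ≤ N := hN₀.trans (by exact_mod_cast (by omega : N₀ ≤ N))
  have hNpos : (0 : ℝ) < N := by linarith
  set x := T / N with hx
  have hxpos : 0 < x := by positivity
  have hxM : x * (4 * M) ≤ 1 := by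
    rw [hx, div_mul_eq_mul_div, div_le_one hNpos]
    linarith
  have hx1 : x ≤ 1 := by nlinarith
  set r := 1 - Real.exp (-x) with hr
  have hrx : r ≤ x := by
    have := Real.add_one_le_exp (-x)
    rw [hr]; linarith
  have hrx2 : x / 2 ≤ r := by
    have h1 := Real.add_one_le_exp x
    have h2 : Real.exp (-x) ≤ 1 - x / 2 := by
      rw [Real.exp_neg]
      refine inv_le_of_inv_le₀ (by linarith) ?_
      rw [inv_le_comm₀ (by linarith) (Real.exp_pos x)]
      refine le_trans ?_ (le_of_eq rfl)
      rw [inv_le_comm₀ (Real.exp_pos x) (by linarith)]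
      refine le_trans ?_ h1
      rw [inv_le_comm₀ (by linarith) (by linarith)]
      rw [inv_eq_one_div, div_le_iff₀ (by linarith)]
      nlinarith
    rw [hr]; linarith
  have hrpos : 0 < r := by linarith
  have hr1 : r ≤ 1 := by have := Real.exp_pos (-x); rw [hr]; linarith
  have hrM : r * (4 * M) ≤ 1 := (mul_le_mul_of_nonneg_right hrx (by positivity)).trans hxM
  have hr3 : r ≤ 1 / 3 := by nlinarith
  have hNx : N * x = T := by rw [hx]; field_simp
  refine ⟨hrpos.le, hr1, by rw [← hNx]; nlinarith, ?_⟩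
  intro V Ω _ _ R P _ b n w hcard htwo hw hb
  set L : ℕ := ⌊1 / (2 * M * r)⌋₊ with hLdef
  have hden : 0 < 2 * M * r := by positivity
  have hL1 : (L : ℝ) ≤ 1 / (2 * M * r) := Nat.floor_le (by positivity)
  have hL2 : 1 / (2 * M * r) < L + 1 := Nat.lt_floor_add_one _
  rw [le_div_iff₀ hden] at hL1
  rw [div_lt_iff₀ hden] at hL2
  have hLr : (L : ℝ) * r ≤ 1 / 6 := by
    have : 0 ≤ (L : ℝ) * r := by positivity
    nlinarith
  have hpow : ∀ g : ℕ, g * r ≤ 1 / 2 → 1 / 2 ≤ (1 - r) ^ g := fun g hg => by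
    have h1 := one_add_mul_le_pow (a := -r) (by linarith) g
    rw [← sub_eq_add_neg] at h1
    linarith
  have hτ1 : ((N / 2 : ℕ) : ℝ) ≤ N / 2 := Nat.cast_div_le
  have hτ2 : (N : ℝ) / 4 ≤ (N / 2 : ℕ) := by
    have h1 : N ≤ 2 * (N / 2) + 1 := by omega
    have h2 : (N : ℝ) ≤ 2 * (N / 2 : ℕ) + 1 := by exact_mod_cast h1
    linarith
  have hτpos : (0 : ℝ) < (N / 2 : ℕ) := by linarith
  refine escapeBound (τ := N / 2) (L := L) (M := M) (K := K) (ρ := 1 / (8 * M))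
    (α := 2 * K / (N / 2 : ℕ)) hb (by omega) hrpos hr3 hcard htwo (by positivity) ?_
    (by positivity) ?_ ?_ (hpow _ ?_) ?_ ?_ (by positivity) ?_ ?_ hw
  · rw [div_le_one hKpos, hKr]; linarith
  · rw [div_le_one (by positivity)]; linarith
  · have h1 : 1 / 2 ≤ (1 - r) ^ (M * L) := hpow _ (by push_cast; nlinarith)
    have h2 : 1 / (4 * M) ≤ L * r := by
      rw [div_le_iff₀ (by positivity)]
      nlinarith
    calc 1 / (8 * (M : ℝ)) = 1 / (4 * M) * (1 / 2) := by field_simp; norm_num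
      _ ≤ L * r * (1 - r) ^ (M * L) := mul_le_mul h2 h1 (by norm_num) (by positivity)
  · push_cast
    linarith
  · have hLN : (L : ℝ) ≤ N / 8 := by
      have h1 : (L : ℝ) * (M * x) ≤ 1 := by
        have h0 : (M : ℝ) * x ≤ 2 * M * r := by nlinarith
        exact (mul_le_mul_of_nonneg_left h0 (Nat.cast_nonneg L)).trans hL1
      have h2 : (L : ℝ) * (M * T) ≤ N := by
        rw [← hNx]
        calc (L : ℝ) * (M * (N * x)) = N * (L * (M * x)) := by ring
          _ ≤ N := mul_le_of_le_one_right hNpos.le h1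
      have h3 : (8 : ℝ) ≤ M * T := by
        have : (1 : ℝ) ≤ K := by rw [hKr]; linarith
        nlinarith
      have h4 := mul_le_mul_of_nonneg_left h3 (Nat.cast_nonneg (α := ℝ) L)
      linarith
    have h5 : ((N / 2 : ℕ) : ℝ) + L + 2 ≤ N := by linarith
    exact_mod_cast h5
  · rw [mul_div_assoc', div_le_one (by norm_num)]
    field_simp
    linarith
  · rw [div_mul_cancel₀ _ hτpos.ne']
  · have h1 : 384 * (K : ℝ) ≤ (N / 2 : ℕ) * r := by
      have h2 : (N : ℝ) / 4 * (x / 2) ≤ (N / 2 : ℕ) * r :=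
        mul_le_mul hτ2 hrx2 (by positivity) hτpos.le
      have h3 : (N : ℝ) / 4 * (x / 2) = T / 8 := by rw [← hNx]; ring
      linarith
    have h2 : 4 * K * (2 * K / (N / 2 : ℕ)) / r ≤ K / 48 := by
      have h3 : 4 * K * (2 * K / (N / 2 : ℕ)) / r = 8 * K ^ 2 / ((N / 2 : ℕ) * r) := by
        field_simp; norm_num
      rw [h3, div_le_iff₀ (by positivity)]
      have h4 := mul_le_mul_of_nonneg_left h1 (by positivity : 0 ≤ (K : ℝ) / 48)
      calc 8 * (K : ℝ) ^ 2 = K / 48 * (384 * K) := by ring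
        _ ≤ _ := h4
    have h5 : 32 * (M : ℝ) ≤ K / 24 - 4 * K * (2 * K / (N / 2 : ℕ)) / r := by
      rw [hKr] at h2 ⊢
      linarith
    have h6 := mul_le_mul_of_nonneg_left h5 (by positivity : 0 ≤ 1 / (8 * (M : ℝ)))
    refine le_trans (le_of_eq ?_) h6
    field_simp
    norm_num

/-- The bits `b` are such that the edges at the root carry exactly one bar, and the walk that
enters the subtree of a child of the root through this bar never leaves this subtree before it
reaches depth `n`. -/
def StartEscapes (R : ParentTree V) (n N : ℕ) (b : Set (V × ℕ)) (root : V) : Prop :=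
  ∃ y ∈ R.children root, ∃ j < N,
    (∀ z ∈ R.children root, ∀ c < N, (z, c) ∈ b ↔ z = y ∧ c = j) ∧
    ∀ k, ¬ R.Exits n N b y k y (j + 1)

theorem exits_mono_le {R : ParentTree V} {n N : ℕ} {b : Set (V × ℕ)} {w x : V} {k k' t : ℕ}
    (hk : k ≤ k') (h : R.Exits n N b w k x t) : R.Exits n N b w k' x t := by
  induction hk with
  | refl => exact h
  | step _ ih => exact exits_mono ih

variable [MeasurableSpace Ω] {P : Measure Ω} [IsProbabilityMeasure P] {r : ℝ}

/-- The probability of exactly one bar at the root is at least `N * r * (1 - r) ^ (M * N)`, and then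
the child at this bar is visited for the first time, with its subtree unexplored. -/
theorem measure_not_startEscapes_le {R : ParentTree V} {n N M : ℕ} {b : Ω → Set (V × ℕ)}
    {root : V} (hb : IsBernoulliSet P b (R.slots N) r) (hr0 : 0 ≤ r) (hr1 : r ≤ 1)
    (hN : 0 < N) (hroot : R.depth root = 0) (hcard : (R.children root).card ≤ M)
    (hone : 0 < (R.children root).card) {p : ℝ} (hp : 0 ≤ p)
    (hE : ∀ w, 0 < R.depth w → R.EscapeBound n N P b p w) :
    P {ω | ¬ R.StartEscapes n N (b ω) root}
      ≤ ENNReal.ofReal (1 - N * r * (1 - r) ^ (M * N) * p) := by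
  set bad : ℕ → Set Ω := fun k => {ω | ∀ y ∈ R.children root, ∀ j < N,
    (∀ z ∈ R.children root, ∀ c < N, (z, c) ∈ b ω ↔ z = y ∧ c = j) →
    R.Exits n N (b ω) y k y (j + 1)} with hbad
  have hmono : Monotone bad := fun k k' hk ω hω y hy j hj h => exits_mono_le hk (hω y hy j hj h)
  have hsub : {ω | ¬ R.StartEscapes n N (b ω) root} ⊆ ⋃ k, bad k := fun ω hω => by
    by_cases h : ∃ y ∈ R.children root, ∃ j < N,
        ∀ z ∈ R.children root, ∀ c < N, (z, c) ∈ b ω ↔ z = y ∧ c = j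
    · obtain ⟨y, hy, j, hj, h⟩ := h
      have h1 : ∃ k, R.Exits n N (b ω) y k y (j + 1) := by
        by_contra hc
        push Not at hc
        exact hω ⟨y, hy, j, hj, h, hc⟩
      obtain ⟨k, hk⟩ := h1
      refine Set.mem_iUnion.2 ⟨k, fun y' hy' j' hj' h' => ?_⟩
      obtain ⟨rfl, rfl⟩ := (h' y hy j hj).1 ((h y hy j hj).2 ⟨rfl, rfl⟩)
      exact hk
    · exact Set.mem_iUnion.2 ⟨0, fun y hy j hj h' => absurd ⟨y, hy, j, hj, h'⟩ h⟩
  have hk : ∀ k, P (bad k) ≤ ENNReal.ofReal (1 - N * r * (1 - r) ^ (M * N) * p) := fun k => by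
    set Q : Finset (V × ℕ) := R.children root ×ˢ Finset.range N with hQ
    have hempty : bitCylinder b ∅ ∅ = Set.univ := by
      ext ω; simp [bitCylinder]
    have hmain := hb.le_of_split_card_le_one (bad k) (D := ∅) (O := ∅) subset_rfl Q
      (Finset.disjoint_empty_right Q) (fun q hq => ?_) 1 0 (fun _ => p) ?_ (fun q hq => ?_) ?_
    · rw [hempty, Set.univ_inter, probReal_univ, mul_one, Finset.sum_const,
        nsmul_eq_mul, mul_zero, zero_add] at hmain
      rw [← ofReal_measureReal]
      refine ENNReal.ofReal_le_ofReal (hmain.trans ?_)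
      have hQc : Q.card = (R.children root).card * N := by
        rw [hQ, Finset.card_product, Finset.card_range]
      have h1 : N ≤ Q.card := by
        rw [hQc]; exact Nat.le_mul_of_pos_left N hone
      have h2 : Q.card - 1 ≤ M * N := by
        have : Q.card ≤ M * N := by
          rw [hQc]; exact Nat.mul_le_mul_right N hcard
        omega
      have h3 : (1 - r) ^ (M * N) ≤ (1 - r) ^ (Q.card - 1) :=
        pow_le_pow_of_le_one (by linarith) (by linarith) h2
      have h4 : (N : ℝ) * p ≤ Q.card * p :=
        mul_le_mul_of_nonneg_right (by exact_mod_cast h1) hp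
      have h5 : r * (1 - r) ^ (M * N) ≤ r * (1 - r) ^ (Q.card - 1) :=
        mul_le_mul_of_nonneg_left h3 hr0
      have h6 := mul_le_mul h5 h4 (by positivity)
        (mul_nonneg hr0 (pow_nonneg (by linarith) _))
      linarith
    · obtain ⟨h1, h2⟩ := Finset.mem_product.1 hq
      exact ⟨by rw [depth_child h1]; omega, Finset.mem_range.1 h2⟩
    · rw [sub_zero, one_mul]
      exact measureReal_mono Set.inter_subset_left
    · obtain ⟨y, j⟩ := q
      obtain ⟨hy, hj⟩ := Finset.mem_product.1 hq
      simp only [Finset.mem_range] at hy hj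
      rw [Finset.empty_union, Finset.empty_union]
      have hsub' : bitCylinder b Q {(y, j)} ∩ bad k
          ⊆ bitCylinder b Q {(y, j)} ∩ R.exitEvent n N b y k y (j + 1) := by
        rintro ω ⟨h1, h2⟩
        refine ⟨h1, h2 y hy j hj fun z hz c hc => ?_⟩
        rw [h1 (z, c) (Finset.mem_product.2 ⟨hz, Finset.mem_range.2 hc⟩), Finset.mem_singleton,
          Prod.mk.injEq]
      refine (measureReal_mono hsub').trans (hE y (by rw [depth_child hy]; omega) Q {(y, j)} _ _
        (Finset.singleton_subset_iff.2 hq) ⟨fun c hc => ?_, fun z hz hne c hc => ?_⟩)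
      · rw [(Prod.mk.inj (Finset.mem_singleton.1 hc)).2]
      · exact hne (children_eq_of_below (Finset.mem_product.1 hc).1 hy (Below.refl z) hz)
    · intro A hA _
      rw [one_mul]
      exact measureReal_mono Set.inter_subset_left
  calc P {ω | ¬ R.StartEscapes n N (b ω) root} ≤ P (⋃ k, bad k) := measure_mono hsub
    _ = ⨆ k, P (bad k) := hmono.measure_iUnion
    _ ≤ _ := iSup_le hk

end ParentTree

/-! ### Trees as graphs -/

namespace ParentTree

variable {V : Type*}

/-- `R` presents the tree `G` rooted at `φ`. -/
structure Presents (R : ParentTree V) (G : SimpleGraph V) (φ : V) : Prop where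
  adj_iff : ∀ {x y}, G.Adj x y ↔ y ∈ R.children x ∨ x ∈ R.children y
  depth_eq_zero_iff : ∀ {x}, R.depth x = 0 ↔ x = φ

/-- Each rooted tree is presented by the parent map that goes to the second vertex of the path to
the root, and its `offspring` are among the children for this map. -/
theorem exists_presents (G : SimpleGraph V) [G.LocallyFinite] (φ : V) (hG : G.IsTree) :
    ∃ R : ParentTree V, R.Presents G φ ∧ (∀ x, offspring G φ x ⊆ R.children x) ∧
      ∀ x, (R.children x).card ≤ G.degree x := by
  classical
  choose q hq huniq using fun v => hG.existsUnique_path v φ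
  have hpar : ∀ {v w : V}, G.Adj v w → G.dist v φ = G.dist w φ + 1 → (q v).snd = w := by
    intro v w h hd
    obtain ⟨r, hr⟩ := hG.connected.exists_walk_length_eq_dist w φ
    have h1 : (SimpleGraph.Walk.cons h r).IsPath :=
      SimpleGraph.Walk.isPath_of_length_eq_dist _ (by simp [hr, hd])
    rw [← huniq v _ h1]
    simp
  have hdist : ∀ v, (q v).length = G.dist v φ := fun v => by
    obtain ⟨r, hr, hl⟩ := hG.connected.exists_path_of_dist v φ
    rw [← huniq v r hr, hl]
  have hpos : ∀ {v}, v ≠ φ → G.Adj v (q v).snd ∧ G.dist (q v).snd φ + 1 = G.dist v φ := by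
    intro v hv
    have hnil : ¬ (q v).Nil := SimpleGraph.Walk.not_nil_of_ne hv
    have hadj := SimpleGraph.Walk.adj_snd hnil
    refine ⟨hadj, ?_⟩
    have h1 : (q v).tail = q (q v).snd := huniq _ _ (hq v).tail
    rw [← hdist, ← hdist, ← h1, SimpleGraph.Walk.length_tail_add_one hnil]
  have hzero : ∀ {v}, G.dist v φ = 0 ↔ v = φ := fun {v} => hG.connected.dist_eq_zero_iff
  let R : ParentTree V :=
    { parent := fun v => (q v).snd
      depth := fun v => G.dist v φ
      children := fun x => (G.neighborFinset x).filter fun y => G.dist y φ = G.dist x φ + 1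
      mem_children := by
        intro x y
        rw [Finset.mem_filter, SimpleGraph.mem_neighborFinset]
        constructor
        · rintro ⟨h1, h2⟩
          exact ⟨hpar h1.symm h2, by omega⟩
        · rintro ⟨rfl, h⟩
          have := hpos (v := y) (fun h' => by rw [h', SimpleGraph.dist_self] at h; omega)
          exact ⟨this.1.symm, this.2.symm⟩
      depth_parent := fun {y} h => (hpos (v := y) fun h' => by
        rw [h', SimpleGraph.dist_self] at h; omega).2 }
  refine ⟨R, ⟨fun {x y} => ?_, hzero⟩, fun x y hy => ?_, fun x => ?_⟩
  · simp only [R, Finset.mem_filter, SimpleGraph.mem_neighborFinset]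
    constructor
    · intro h
      have h1 := hG.dist_eq_dist_add_one_of_adj φ h
      rw [SimpleGraph.dist_comm (v := x), SimpleGraph.dist_comm (v := y)] at h1
      rcases h1 with h1 | h1
      · exact Or.inr ⟨h.symm, h1⟩
      · exact Or.inl ⟨h, h1⟩
    · rintro (h | h)
      · exact h.1
      · exact h.1.symm
  · obtain ⟨hne, p, hp, rfl⟩ := hy
    rw [huniq y p hp]
    simp only [R, Finset.mem_coe, Finset.mem_filter, SimpleGraph.mem_neighborFinset]
    exact ⟨(hpos hne).1.symm, (hpos hne).2.symm⟩
  · exact (Finset.card_filter_le _ _).trans (SimpleGraph.card_neighborFinset_eq_degree G x).le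

theorem label_unique {R : ParentTree V} {z z' : V} (hz : 0 < R.depth z) (hz' : 0 < R.depth z')
    (h : s(z, R.parent z) = s(z', R.parent z')) : z = z' := by
  rcases Sym2.eq_iff.1 h with h | h
  · exact h.1
  · have h1 := R.depth_parent hz
    have h2 := R.depth_parent hz'
    rw [h.2] at h1
    rw [← h.1] at h2
    omega

namespace Presents

variable {R : ParentTree V} {G : SimpleGraph V} {φ : V}

theorem finite_depth_le (hR : R.Presents G φ) (n : ℕ) : {x | R.depth x ≤ n}.Finite := by
  induction n with
  | zero =>
    refine (Set.finite_singleton φ).subset fun x hx => ?_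
    exact hR.depth_eq_zero_iff.1 (Nat.le_zero.1 hx)
  | succ n ih =>
    refine ((Set.finite_singleton φ).union (ih.biUnion fun x _ =>
      (R.children x).finite_toSet)).subset fun x hx => ?_
    rcases Nat.eq_zero_or_pos (R.depth x) with h | h
    · exact Or.inl (hR.depth_eq_zero_iff.1 h)
    · refine Or.inr (Set.mem_biUnion (x := R.parent x) ?_ (mem_children_parent h))
      have := R.depth_parent h
      have : R.depth x ≤ n + 1 := hx
      simp only [Set.mem_ofPred_eq]
      omega

theorem countable (hR : R.Presents G φ) : Countable V := by
  have h : (Set.univ : Set V) = ⋃ n, {x | R.depth x ≤ n} := by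
    ext x
    simp only [Set.mem_univ, Set.mem_iUnion, true_iff]
    exact ⟨R.depth x, le_refl (R.depth x)⟩
  rw [← Set.countable_univ_iff, h]
  exact Set.countable_iUnion fun n => (hR.finite_depth_le n).countable

theorem adj_parent (hR : R.Presents G φ) {x : V} (hx : 0 < R.depth x) : G.Adj x (R.parent x) :=
  hR.adj_iff.2 (Or.inr (mem_children_parent hx))

theorem exists_label (hR : R.Presents G φ) (e : G.edgeSet) :
    ∃ z, 0 < R.depth z ∧ (e : Sym2 V) = s(z, R.parent z) := by
  obtain ⟨e, he⟩ := e
  induction e using Sym2.ind with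
  | _ x y =>
    rcases hR.adj_iff.1 (show G.Adj x y from he) with h | h
    · obtain ⟨rfl, h'⟩ := R.mem_children.1 h
      exact ⟨y, h', Sym2.eq_swap⟩
    · obtain ⟨rfl, h'⟩ := R.mem_children.1 h
      exact ⟨x, h', rfl⟩

end Presents

end ParentTree

/-! ### Poisson bars -/

namespace IsPoissonBars

variable {V Ω : Type*} {G : SimpleGraph V} {T : ℝ} [MeasurableSpace Ω] {P : Measure Ω}
  {B : Ω → Set (Bar G)}

theorem measurableSet_inter_nonempty (hB : IsPoissonBars G T P B) {A : Set (Bar G)}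
    (hA : MeasurableSet A) : MeasurableSet {ω | (B ω ∩ A).Nonempty} := by
  have h : {ω | (B ω ∩ A).Nonempty} = (fun ω => barCount A (B ω)) ⁻¹' {0}ᶜ := by
    ext ω
    simp [barCount, Set.nonempty_iff_ne_empty]
  rw [h]
  exact hB.measurable_count A hA MeasurableSet.of_discrete

theorem measure_inter_eq_empty (hB : IsPoissonBars G T P B) {A : Set (Bar G)}
    (hA : MeasurableSet A) (hfin : barMeasure G T A < ∞) :
    P {ω | B ω ∩ A = ∅} = ENNReal.ofReal (Real.exp (-(barMeasure G T A).toReal)) := by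
  have h := hB.law_count A hA hfin 0
  rw [poissonMeasure_singleton] at h
  simpa [barCount, ← ENNReal.coe_toNNReal_eq_toReal] using h

/-- The numbers of bars in the members of a family of disjoint sets are independent. -/
theorem iIndepFun_barCount (hB : IsPoissonBars G T P B) {ι : Type*} (A : ι → Set (Bar G))
    (hA : ∀ i, MeasurableSet (A i)) (hdisj : Pairwise (Function.onFun Disjoint A)) :
    iIndepFun (fun i ω => barCount (A i) (B ω)) P := by
  rw [iIndepFun_iff_finset]
  intro s
  have h := hB.indep_count s.card (fun i => A (s.equivFin.symm i)) (fun i => hA _)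
    (fun i j hij => hdisj fun h => hij (s.equivFin.symm.injective (Subtype.ext h)))
  have h1 := h.precomp s.equivFin.injective
  have h2 : s.restrict (fun i ω => barCount (A i) (B ω))
      = fun (i : s) ω => barCount (A i) (B ω) := rfl
  rw [h2]
  simpa using h1

variable [IsProbabilityMeasure P]

theorem real_inter_nonempty (hB : IsPoissonBars G T P B) {A : Set (Bar G)}
    (hA : MeasurableSet A) (hfin : barMeasure G T A < ∞) :
    P.real {ω | (B ω ∩ A).Nonempty} = 1 - Real.exp (-(barMeasure G T A).toReal) := by
  have h : {ω | B ω ∩ A = ∅} = {ω | (B ω ∩ A).Nonempty}ᶜ := by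
    ext ω
    simp [Set.not_nonempty_iff_eq_empty]
  have h1 := hB.measure_inter_eq_empty hA hfin
  have h2 := probReal_compl_eq_one_sub (μ := P) (hB.measurableSet_inter_nonempty hA)
  rw [← h, measureReal_def, h1, ENNReal.toReal_ofReal (Real.exp_pos _).le] at h2
  linarith

/-- Almost surely there are no bars in a null set. -/
theorem ae_inter_eq_empty (hB : IsPoissonBars G T P B) {A : Set (Bar G)}
    (hA : MeasurableSet A) (h0 : barMeasure G T A = 0) : ∀ᵐ ω ∂P, B ω ∩ A = ∅ := by
  have h := hB.real_inter_nonempty hA (by simp [h0])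
  rw [h0] at h
  have h1 : P {ω | (B ω ∩ A).Nonempty} = 0 := by
    rw [← measureReal_eq_zero_iff]
    simpa using h
  filter_upwards [measure_eq_zero_iff_ae_notMem.1 h1] with ω hω
  exact Set.not_nonempty_iff_eq_empty.1 hω

/-- Almost surely there are finitely many bars in a set of finite measure. -/
theorem ae_inter_finite (hB : IsPoissonBars G T P B) {A : Set (Bar G)}
    (hA : MeasurableSet A) (hfin : barMeasure G T A < ∞) : ∀ᵐ ω ∂P, (B ω ∩ A).Finite := by
  have hmeas : ∀ k : ℕ, MeasurableSet {ω | barCount A (B ω) = k} := fun k =>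
    (hB.measurable_count A hA) (t := {(k : ℕ∞)}) MeasurableSet.of_discrete
  have h1 : P (⋃ k : ℕ, {ω | barCount A (B ω) = k}) = 1 := by
    rw [measure_iUnion _ hmeas]
    · simp_rw [hB.law_count A hA hfin]
      rw [← measure_iUnion _ fun k => measurableSet_singleton k]
      · rw [Set.iUnion_of_singleton]
        exact measure_univ
      · intro i j hij
        simpa [Function.onFun] using hij
    · intro i j hij
      refine Set.disjoint_left.2 fun ω hi hj => hij ?_
      have : (i : ℕ∞) = j := hi.symm.trans hj
      exact_mod_cast this
  have h2 := (prob_compl_eq_zero_iff (μ := P) (MeasurableSet.iUnion hmeas)).2 h1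
  filter_upwards [measure_eq_zero_iff_ae_notMem.1 h2] with ω hω
  simp only [Set.mem_compl_iff, not_not, Set.mem_iUnion] at hω
  obtain ⟨k, hk⟩ := hω
  exact Set.finite_of_encard_eq_coe hk

theorem measure_two_le_encard_le (hB : IsPoissonBars G T P B) {A : Set (Bar G)}
    (hA : MeasurableSet A) (hfin : barMeasure G T A < ∞) :
    P {ω | 2 ≤ (B ω ∩ A).encard} ≤ ENNReal.ofReal ((barMeasure G T A).toReal ^ 2) := by
  set m := (barMeasure G T A).toReal with hm
  have hm0 : 0 ≤ m := ENNReal.toReal_nonneg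
  have hmeas : ∀ k : ℕ, MeasurableSet {ω | barCount A (B ω) = k} := fun k =>
    (hB.measurable_count A hA) (t := {(k : ℕ∞)}) MeasurableSet.of_discrete
  have h0 := hB.law_count A hA hfin 0
  have h1 := hB.law_count A hA hfin 1
  rw [poissonMeasure_singleton] at h0 h1
  have hcompl : {ω | 2 ≤ (B ω ∩ A).encard}
      = ({ω | barCount A (B ω) = (0 : ℕ)} ∪ {ω | barCount A (B ω) = (1 : ℕ)})ᶜ := by
    ext ω
    simp only [barCount, Set.mem_ofPred_eq, Set.compl_union, Set.mem_inter_iff, Set.mem_compl_iff]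
    generalize (B ω ∩ A).encard = e
    induction e using ENat.recTopCoe with
    | top => simp
    | coe a =>
      norm_cast
      omega
  have hdisj : Disjoint {ω | barCount A (B ω) = (0 : ℕ)} {ω | barCount A (B ω) = (1 : ℕ)} :=
    Set.disjoint_left.2 fun ω h h' => by
      have h2 : ((0 : ℕ) : ℕ∞) = (1 : ℕ) := Eq.trans (Eq.symm h) h'
      exact absurd (Nat.cast_injective h2) (by norm_num)
  rw [← ofReal_measureReal, hcompl, probReal_compl_eq_one_sub ((hmeas 0).union (hmeas 1)),
    measureReal_union hdisj (hmeas 1), measureReal_def, measureReal_def, h0, h1,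
    ENNReal.toReal_ofReal (by positivity), ENNReal.toReal_ofReal (by positivity)]
  refine ENNReal.ofReal_le_ofReal ?_
  have hc : ((barMeasure G T A).toNNReal : ℝ) = m := rfl
  rw [hc]
  have h2 := Real.add_one_le_exp (-m)
  simp only [pow_zero, Nat.factorial_zero, Nat.cast_one, mul_one, div_one, pow_one,
    Nat.factorial_one]
  nlinarith

/-- The random set of the indices of those sets, among disjoint sets, that carry a bar, is
Bernoulli. -/
theorem isBernoulliSet (hB : IsPoissonBars G T P B) {ι : Type*} (A : ι → Set (Bar G))
    (hA : ∀ i, MeasurableSet (A i)) (hdisj : Pairwise (Function.onFun Disjoint A))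
    (valid : Set ι) (m : ℝ) (hm : 0 ≤ m)
    (hv : ∀ i ∈ valid, barMeasure G T (A i) = ENNReal.ofReal m) :
    IsBernoulliSet P (fun ω => {i | (B ω ∩ A i).Nonempty}) valid (1 - Real.exp (-m)) := by
  classical
  refine ⟨fun i => hB.measurableSet_inter_nonempty (hA i), fun D O q hq hqv => ?_⟩
  have hind := (iIndepFun_iff_measure_inter_preimage_eq_mul.1 (hB.iIndepFun_barCount A hA hdisj))
  have hpre : ∀ (i : ι) (Q : Prop), {ω | (B ω ∩ A i).Nonempty ↔ Q}
      = (fun ω => barCount (A i) (B ω)) ⁻¹' {c | c ≠ 0 ↔ Q} := fun i Q => by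
    ext ω
    simp [barCount, Set.nonempty_iff_ne_empty]
  let S : ι → Set ℕ∞ := fun i => {c | c ≠ 0 ↔ (i ∈ O ∨ i = q)}
  have hcyl : bitCylinder (fun ω => {i | (B ω ∩ A i).Nonempty}) D O
      = ⋂ i ∈ D, (fun ω => barCount (A i) (B ω)) ⁻¹' S i := by
    ext ω
    simp only [bitCylinder, Set.mem_ofPred_eq, Set.mem_iInter]
    refine forall₂_congr fun i hi => ?_
    have hne : i ≠ q := fun h => hq (h ▸ hi)
    simp [S, barCount, Set.nonempty_iff_ne_empty, hne]
  have hqs : {ω | q ∈ {i | (B ω ∩ A i).Nonempty}} = (fun ω => barCount (A q) (B ω)) ⁻¹' S q := by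
    ext ω
    simp [S, barCount, Set.nonempty_iff_ne_empty]
  have h1 := hind D (sets := S) fun i _ => MeasurableSet.of_discrete
  have h2 := hind (insert q D) (sets := S) fun i _ => MeasurableSet.of_discrete
  rw [Finset.prod_insert hq, ← h1, Finset.set_biInter_insert, ← hcyl, ← hqs] at h2
  have h3 := hB.real_inter_nonempty (hA q) (by rw [hv q hqv]; exact ENNReal.ofReal_lt_top)
  rw [hv q hqv, ENNReal.toReal_ofReal hm] at h3
  rw [Set.inter_comm, measureReal_def, h2, ENNReal.toReal_mul, ← h3]
  rfl

end IsPoissonBars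

/-- The part of the space of bars that is formed by the edges in `W` and the `c`-th of `N` cells of
equal length of the time circle. -/
def barCell {V : Type*} {G : SimpleGraph V} (T : ℝ) (N : ℕ) (W : Set G.edgeSet) (c : ℕ) :
    Set (Bar G) := W ×ˢ Set.Ico (c * (T / N)) ((c + 1) * (T / N))

section BarCell

variable {V : Type*} {G : SimpleGraph V} {T : ℝ} {N c : ℕ} {W : Set G.edgeSet}

theorem measurableSet_edges (W : Set G.edgeSet) : MeasurableSet W := trivial

theorem measurableSet_barCell : MeasurableSet (barCell T N W c) :=
  (measurableSet_edges W).prod measurableSet_Ico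

theorem barMeasure_barCell (hT : 0 < T) (hc : c < N) :
    barMeasure G T (barCell T N W c) = Measure.count W * ENNReal.ofReal (T / N) := by
  have hN : (0 : ℝ) < N := by exact_mod_cast Nat.zero_lt_of_lt hc
  have hd : 0 < T / N := div_pos hT hN
  have hcN : ((c : ℝ) + 1) ≤ N := by exact_mod_cast hc
  have h1 : (c + 1) * (T / N) ≤ T := by
    calc (c + 1) * (T / N) ≤ N * (T / N) := mul_le_mul_of_nonneg_right hcN hd.le
      _ = T := by field_simp
  rw [barMeasure, barCell, Measure.prod_prod, Measure.restrict_apply measurableSet_Ico,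
    Set.inter_eq_left.2 (Set.Ico_subset_Ico (by positivity) h1), Real.volume_Ico]
  congr 2
  ring

theorem disjoint_Ico_mul {d : ℝ} (hd : 0 < d) {c c' : ℕ} (h : c ≠ c') :
    Disjoint (Set.Ico (c * d) ((c + 1) * d)) (Set.Ico (c' * d) ((c' + 1) * d)) := by
  refine Set.disjoint_left.2 fun x hx hx' => h ?_
  have h1 : (c : ℝ) < c' + 1 := lt_of_mul_lt_mul_right (hx.1.trans_lt hx'.2) hd.le
  have h2 : (c' : ℝ) < c + 1 := lt_of_mul_lt_mul_right (hx'.1.trans_lt hx.2) hd.le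
  have h3 : c < c' + 1 := by exact_mod_cast h1
  have h4 : c' < c + 1 := by exact_mod_cast h2
  omega

end BarCell

namespace ParentTree

variable {V Ω : Type*} {R : ParentTree V} {G : SimpleGraph V} {T : ℝ} {N : ℕ}

variable (R) in
/-- The bars that give rise to the bit `q = (y, c)`: those in cell `c`, on the edge from `y` to its
parent. There are none if `q` is not in `R.slots N`. -/
def slotCell (G : SimpleGraph V) (T : ℝ) (N : ℕ) (q : V × ℕ) : Set (Bar G) :=
  barCell T N {e | q ∈ R.slots N ∧ (e : Sym2 V) = s(q.1, R.parent q.1)} q.2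

variable (R) in
/-- The bits of a bar collection: `(y, c)` is one of them if there is a bar in the `c`-th of `N`
cells of the time circle, on the edge from `y` to its parent. -/
def barBits (T : ℝ) (N : ℕ) (B : Set (Bar G)) : Set (V × ℕ) :=
  {q | (B ∩ R.slotCell G T N q).Nonempty}

theorem pairwise_disjoint_slotCell (hT : 0 < T) (hN : 0 < N) :
    Pairwise (Function.onFun Disjoint (R.slotCell G T N)) := by
  intro q q' hne
  refine Set.disjoint_left.2 fun b hb hb' => hne ?_
  obtain ⟨⟨h1, h2⟩, h3⟩ := hb
  obtain ⟨⟨h1', h2'⟩, h3'⟩ := hb'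
  refine Prod.ext (label_unique h1.1 h1'.1 (h2.symm.trans h2')) ?_
  by_contra hc
  exact Set.disjoint_left.1 (disjoint_Ico_mul (div_pos hT (by exact_mod_cast hN)) hc) h3 h3'

theorem Presents.isBernoulliSet_barBits [MeasurableSpace Ω] {P : Measure Ω} {φ : V}
    [IsProbabilityMeasure P] (hR : R.Presents G φ) (hT : 0 < T) (hN : 0 < N)
    {B : Ω → Set (Bar G)} (hB : IsPoissonBars G T P B) :
    IsBernoulliSet P (fun ω => R.barBits T N (B ω)) (R.slots N) (1 - Real.exp (-(T / N))) := by
  refine hB.isBernoulliSet (R.slotCell G T N) (fun q => measurableSet_barCell)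
    (pairwise_disjoint_slotCell hT hN) _ _ (by positivity) fun q hq => ?_
  have h1 : {e : G.edgeSet | q ∈ R.slots N ∧ (e : Sym2 V) = s(q.1, R.parent q.1)}
      = {⟨s(q.1, R.parent q.1), hR.adj_parent hq.1⟩} := by
    ext e
    simp [hq, Subtype.ext_iff]
  rw [slotCell, barMeasure_barCell hT hq.2, h1,
    Measure.count_singleton' (measurableSet_edges _), one_mul]

end ParentTree

/-! ### Almost sure properties of the bars -/

namespace ParentTree

variable {V Ω : Type*} {R : ParentTree V} {G : SimpleGraph V} {φ : V} {T : ℝ} {n N c : ℕ}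

theorem mem_barBits {B : Set (Bar G)} {q : V × ℕ} : q ∈ R.barBits T N B ↔ q ∈ R.slots N ∧
    ∃ b ∈ B, (b.1 : Sym2 V) = s(q.1, R.parent q.1) ∧
      b.2 ∈ Set.Ico (q.2 * (T / N)) ((q.2 + 1) * (T / N)) := by
  constructor
  · rintro ⟨b, hb, ⟨h1, h2⟩, h3⟩
    exact ⟨h1, b, hb, h2, h3⟩
  · rintro ⟨h1, b, hb, h2, h3⟩
    exact ⟨b, hb, ⟨h1, h2⟩, h3⟩

theorem exists_cell {h : ℝ} (hT : 0 < T) (hN : 0 < N) (hh : h ∈ Set.Ico 0 T) :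
    ∃ c < N, h ∈ Set.Ico (c * (T / N)) ((c + 1) * (T / N)) := by
  have hN' : (0 : ℝ) < N := by exact_mod_cast hN
  have hd : 0 < T / N := div_pos hT hN'
  have h0 : 0 ≤ h / (T / N) := div_nonneg hh.1 hd.le
  have h1 := Nat.floor_le h0
  have h2 := Nat.lt_floor_add_one (h / (T / N))
  rw [le_div_iff₀ hd] at h1
  rw [div_lt_iff₀ hd] at h2
  refine ⟨⌊h / (T / N)⌋₊, ?_, h1, h2⟩
  rw [Nat.floor_lt h0, div_lt_iff₀ hd]
  calc h < T := hh.2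
    _ = N * (T / N) := by field_simp

/-- A left neighbourhood of any height is contained in a cell. -/
theorem exists_cell_left {h : ℝ} (hT : 0 < T) (hN : 0 < N) (hh : h ∈ Set.Ioc 0 T) :
    ∃ c < N, c * (T / N) < h ∧ h ≤ (c + 1) * (T / N) := by
  have hN' : (0 : ℝ) < N := by exact_mod_cast hN
  have hd : 0 < T / N := div_pos hT hN'
  have h0 : 0 < h / (T / N) := div_pos hh.1 hd
  have h1 := Nat.le_ceil (h / (T / N))
  have h2 := Nat.ceil_lt_add_one h0.le
  have h3 : 0 < ⌈h / (T / N)⌉₊ := Nat.ceil_pos.2 h0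
  obtain ⟨c, hc⟩ := Nat.exists_eq_add_of_le' h3
  rw [hc] at h1 h2
  push_cast at h1 h2
  rw [div_le_iff₀ hd] at h1
  have h4 : (c : ℝ) < h / (T / N) := by linarith
  rw [lt_div_iff₀ hd] at h4
  refine ⟨c, ?_, h4, h1⟩
  have h5 : (c : ℝ) * (T / N) < N * (T / N) := by
    calc (c : ℝ) * (T / N) < h := h4
      _ ≤ T := hh.2
      _ = N * (T / N) := by field_simp
  exact_mod_cast lt_of_mul_lt_mul_right h5 hd.le

variable (R) in
/-- The edges whose lower endpoints have depth at most `n`. -/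
def edgesUpTo (G : SimpleGraph V) (n : ℕ) : Set G.edgeSet :=
  {e | ∃ z, 0 < R.depth z ∧ R.depth z ≤ n ∧ (e : Sym2 V) = s(z, R.parent z)}

theorem finite_label (z : V) : {e : G.edgeSet | (e : Sym2 V) = s(z, R.parent z)}.Finite :=
  Set.Subsingleton.finite fun _ he _ he' => Subtype.ext (he.trans (Eq.symm he'))

namespace Presents

theorem finite_edgesUpTo (hR : R.Presents G φ) (n : ℕ) : (R.edgesUpTo G n).Finite := by
  refine ((hR.finite_depth_le n).biUnion fun z _ => finite_label (R := R) (G := G) z).subset ?_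
  rintro e ⟨z, -, hz, he⟩
  exact Set.mem_biUnion (x := z) hz he

/-- The edges at a vertex are labelled by the members of its star. -/
theorem exists_label_star [DecidableEq V] (hR : R.Presents G φ) {e : G.edgeSet} {v : V}
    (hv : v ∈ (e : Sym2 V)) :
    ∃ z ∈ R.star v, 0 < R.depth z ∧ (e : Sym2 V) = s(z, R.parent z) := by
  obtain ⟨z, hz, he⟩ := hR.exists_label e
  refine ⟨z, mem_star.2 ?_, hz, he⟩
  rw [he, Sym2.mem_iff] at hv
  rcases hv with rfl | rfl
  · exact Or.inl rfl
  · exact Or.inr (mem_children_parent hz)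

theorem finite_edges_at (hR : R.Presents G φ) (v : V) :
    {e : G.edgeSet | v ∈ (e : Sym2 V)}.Finite := by
  refine (hR.finite_edgesUpTo (R.depth v + 1)).subset fun e he => ?_
  obtain ⟨z, hz, he'⟩ := hR.exists_label e
  refine ⟨z, hz, ?_, he'⟩
  have he : v ∈ (e : Sym2 V) := he
  rw [he', Sym2.mem_iff] at he
  have := R.depth_parent hz
  rcases he with rfl | rfl <;> omega

end Presents

variable (R) in
/-- Two bars on edges of depth at most `n` lie in the same cell. -/
def Crowded (T : ℝ) (n N : ℕ) (B : Set (Bar G)) : Prop :=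
  ∃ c < N, 2 ≤ (B ∩ barCell T N (R.edgesUpTo G n) c).encard

theorem eq_of_not_crowded {B : Set (Bar G)} (h : ¬ R.Crowded T n N B) (hc : c < N)
    {b b' : Bar G} (hb : b ∈ B) (hb' : b' ∈ B) (h1 : b.1 ∈ R.edgesUpTo G n)
    (h1' : b'.1 ∈ R.edgesUpTo G n) (h2 : b.2 ∈ Set.Ico (c * (T / N)) ((c + 1) * (T / N)))
    (h2' : b'.2 ∈ Set.Ico (c * (T / N)) ((c + 1) * (T / N))) : b = b' := by
  by_contra hne
  refine h ⟨c, hc, ?_⟩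
  rw [← one_add_one_eq_two]
  refine Order.add_one_le_of_lt ?_
  rw [Set.one_lt_encard_iff]
  exact ⟨b, b', ⟨hb, h1, h2⟩, ⟨hb', h1', h2'⟩, hne⟩

variable [MeasurableSpace Ω] {P : Measure Ω} [IsProbabilityMeasure P] {B : Ω → Set (Bar G)}

theorem Presents.measure_crowded_le (hR : R.Presents G φ) (hT : 0 < T)
    (hB : IsPoissonBars G T P B) (n : ℕ) : ∃ C : ℝ, ∀ N : ℕ, 0 < N →
      P {ω | R.Crowded T n N (B ω)} ≤ ENNReal.ofReal (C / N) := by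
  set m : ℝ≥0∞ := Measure.count (R.edgesUpTo G n) with hm
  have hmfin : m < ∞ := (Measure.count_apply_lt_top' (measurableSet_edges _)).2
    (hR.finite_edgesUpTo n)
  refine ⟨(m.toReal * T) ^ 2, fun N hN => ?_⟩
  have hN' : (0 : ℝ) < N := by exact_mod_cast hN
  have hsub : {ω | R.Crowded T n N (B ω)} ⊆ ⋃ c ∈ Finset.range N,
      {ω | 2 ≤ (B ω ∩ barCell T N (R.edgesUpTo G n) c).encard} := by
    rintro ω ⟨c, hc, h⟩
    exact Set.mem_biUnion (Finset.mem_coe.2 (Finset.mem_range.2 hc)) h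
  have hcell : ∀ c ∈ Finset.range N,
      P {ω | 2 ≤ (B ω ∩ barCell T N (R.edgesUpTo G n) c).encard}
        ≤ ENNReal.ofReal ((m.toReal * (T / N)) ^ 2) := fun c hc => by
    have h1 := barMeasure_barCell (W := R.edgesUpTo G n) hT (Finset.mem_range.1 hc)
    have h2 := hB.measure_two_le_encard_le (A := barCell T N (R.edgesUpTo G n) c)
      measurableSet_barCell (by rw [h1]; exact ENNReal.mul_lt_top hmfin ENNReal.ofReal_lt_top)
    rwa [h1, ENNReal.toReal_mul, ENNReal.toReal_ofReal (by positivity)] at h2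
  refine (measure_mono hsub).trans ((measure_biUnion_finset_le _ _).trans
    ((Finset.sum_le_sum hcell).trans ?_))
  rw [Finset.sum_const, Finset.card_range, nsmul_eq_mul, ← ENNReal.ofReal_natCast,
    ← ENNReal.ofReal_mul (by positivity)]
  refine ENNReal.ofReal_le_ofReal (le_of_eq ?_)
  field_simp

theorem Presents.tendsto_measure_crowded (hR : R.Presents G φ) (hT : 0 < T)
    (hB : IsPoissonBars G T P B) (n : ℕ) :
    Tendsto (fun N => P {ω | R.Crowded T n N (B ω)}) atTop (𝓝 0) := by
  obtain ⟨C, hC⟩ := hR.measure_crowded_le hT hB n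
  have h1 : Tendsto (fun N : ℕ => ENNReal.ofReal (C / N)) atTop (𝓝 0) := by
    rw [← ENNReal.ofReal_zero]
    exact ENNReal.tendsto_ofReal (tendsto_const_div_atTop_nhds_zero_nat C)
  refine tendsto_of_tendsto_of_tendsto_of_le_of_le' tendsto_const_nhds h1
    (Eventually.of_forall fun _ => zero_le) ?_
  filter_upwards [eventually_gt_atTop 0] with N hN using hC N hN

theorem Presents.ae_exists_not_crowded (hR : R.Presents G φ) (hT : 0 < T)
    (hB : IsPoissonBars G T P B) (n : ℕ) : ∀ᵐ ω ∂P, ∃ N > 0, ¬ R.Crowded T n N (B ω) := by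
  have h : P {ω | ¬ ∃ N > 0, ¬ R.Crowded T n N (B ω)} = 0 := by
    refine le_antisymm (ge_of_tendsto (hR.tendsto_measure_crowded hT hB n) ?_) zero_le
    filter_upwards [eventually_gt_atTop 0] with N hN
    refine measure_mono fun ω hω => ?_
    by_contra hc
    exact hω ⟨N, hN, hc⟩
  exact h

/-! ### Open paths -/

variable (R) in
/-- There is a path of `k` edges from `u` away from the root, all of them carrying bars in
cell `c`. -/
def OpenChain (b : Set (V × ℕ)) (c : ℕ) : ℕ → V → Prop
  | 0, _ => True
  | k + 1, u => ∃ y ∈ R.children u, (y, c) ∈ b ∧ OpenChain b c k y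

theorem OpenChain.mono {b : Set (V × ℕ)} {k m : ℕ} {u : V} (hk : k ≤ m)
    (h : R.OpenChain b c m u) : R.OpenChain b c k u := by
  induction k generalizing m u with
  | zero => trivial
  | succ k ih =>
    obtain ⟨m, rfl⟩ := Nat.exists_eq_add_of_le' (Nat.zero_lt_of_lt hk)
    obtain ⟨y, hy, hb, h⟩ := h
    exact ⟨y, hy, hb, ih (by omega) h⟩

variable {r : ℝ} {M : ℕ}

theorem real_openChain_le [DecidableEq V] {b : Ω → Set (V × ℕ)}
    (hb : IsBernoulliSet P b (R.slots N) r) (hr : 0 ≤ r)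
    (hM : ∀ x, (R.children x).card ≤ M) (hc : c < N) (k : ℕ) (u : V) (D O : Finset (V × ℕ))
    (hD : ∀ q ∈ D, R.depth q.1 ≤ R.depth u) :
    P.real (bitCylinder b D O ∩ {ω | R.OpenChain (b ω) c k u})
      ≤ (M * r) ^ k * P.real (bitCylinder b D O) := by
  induction k generalizing u D O with
  | zero => simp [OpenChain]
  | succ k ih =>
    have hnot : ∀ y ∈ R.children u, (y, c) ∉ D := fun y hy h => by
      have h1 := hD _ h
      have h2 := depth_child hy
      simp only at h1
      omega
    have hsub : bitCylinder b D O ∩ {ω | R.OpenChain (b ω) c (k + 1) u}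
        ⊆ ⋃ y ∈ R.children u, bitCylinder b (insert (y, c) D) (insert (y, c) O)
          ∩ {ω | R.OpenChain (b ω) c k y} := by
      rintro ω ⟨h1, y, hy, hyb, h2⟩
      refine Set.mem_biUnion (Finset.mem_coe.2 hy) ⟨?_, h2⟩
      rw [bitCylinder_insert_true (hnot y hy)]
      exact ⟨h1, hyb⟩
    have hy : ∀ y ∈ R.children u,
        P.real (bitCylinder b (insert (y, c) D) (insert (y, c) O)
          ∩ {ω | R.OpenChain (b ω) c k y}) ≤ (M * r) ^ k * (r * P.real (bitCylinder b D O)) :=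
      fun y hy => by
        have h2 := depth_child hy
        have h1 := ih y (insert (y, c) D) (insert (y, c) O) fun q hq => by
          rcases Finset.mem_insert.1 hq with rfl | hq
          · exact le_rfl
          · have := hD q hq
            omega
        rwa [hb.real_insert_true (hnot y hy) ⟨by simp only; omega, hc⟩] at h1
    calc P.real (bitCylinder b D O ∩ {ω | R.OpenChain (b ω) c (k + 1) u})
        ≤ P.real (⋃ y ∈ R.children u, bitCylinder b (insert (y, c) D) (insert (y, c) O)
          ∩ {ω | R.OpenChain (b ω) c k y}) := measureReal_mono hsub (measure_ne_top _ _)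
      _ ≤ ∑ y ∈ R.children u, P.real (bitCylinder b (insert (y, c) D) (insert (y, c) O)
          ∩ {ω | R.OpenChain (b ω) c k y}) := measureReal_biUnion_finset_le _ _
      _ ≤ ∑ y ∈ R.children u, (M * r) ^ k * (r * P.real (bitCylinder b D O)) :=
        Finset.sum_le_sum hy
      _ = (R.children u).card * ((M * r) ^ k * (r * P.real (bitCylinder b D O))) := by
        rw [Finset.sum_const, nsmul_eq_mul]
      _ ≤ M * ((M * r) ^ k * (r * P.real (bitCylinder b D O))) :=
        mul_le_mul_of_nonneg_right (by exact_mod_cast hM u) (by positivity)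
      _ = _ := by ring

/-- In a subcritical environment all open paths are finite. -/
theorem ae_exists_not_openChain {b : Ω → Set (V × ℕ)}
    (hb : IsBernoulliSet P b (R.slots N) r) (hr : 0 ≤ r) (hM : ∀ x, (R.children x).card ≤ M)
    (hMr : M * r < 1) (hc : c < N) (u : V) :
    ∀ᵐ ω ∂P, ∃ k, ¬ R.OpenChain (b ω) c k u := by
  classical
  have h0 : ∀ k, P {ω | ¬ ∃ k, ¬ R.OpenChain (b ω) c k u} ≤ ENNReal.ofReal ((M * r) ^ k) :=
    fun k => by
      have h1 := real_openChain_le hb hr hM hc k u ∅ ∅ (by simp)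
      have h2 : bitCylinder b ∅ ∅ = Set.univ := by ext ω; simp [bitCylinder]
      rw [h2, Set.univ_inter, probReal_univ, mul_one] at h1
      rw [← ofReal_measureReal]
      refine ENNReal.ofReal_le_ofReal (le_trans (measureReal_mono fun ω hω => ?_) h1)
      by_contra hn
      exact hω ⟨k, hn⟩
  have h : P {ω | ¬ ∃ k, ¬ R.OpenChain (b ω) c k u} = 0 := by
    have h1 : Tendsto (fun k : ℕ => ENNReal.ofReal ((M * r) ^ k)) atTop (𝓝 0) := by
      rw [← ENNReal.ofReal_zero]
      exact ENNReal.tendsto_ofReal (tendsto_pow_atTop_nhds_zero_of_lt_one (by positivity) hMr)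
    exact le_antisymm (ge_of_tendsto' h1 h0) zero_le
  exact h

end ParentTree

/-- A bar collection for which the meander is well defined: each vertex has finitely many joints,
distinct bars at a vertex have distinct heights, and the bars in a short time interval before any
given height join each vertex to finitely many vertices only. -/
structure IsGoodBars {V : Type*} {G : SimpleGraph V} (T : ℝ) (B : Set (Bar G)) : Prop where
  finite_joints : ∀ v, {h | IsJoint B v h}.Finite
  unique : ∀ b ∈ B, ∀ b' ∈ B, ∀ v, v ∈ (b.1 : Sym2 V) → v ∈ (b'.1 : Sym2 V) → b.2 = b'.2 → b = b'
  exists_finite : ∀ h ∈ Set.Ioc 0 T, ∃ a < h, ∀ v, ∃ S : Set V, S.Finite ∧ v ∈ S ∧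
    ∀ b ∈ B, b.2 ∈ Set.Ioo a h → ∀ x ∈ S, ∀ y, (b.1 : Sym2 V) = s(x, y) → y ∈ S

namespace ParentTree

variable {V Ω : Type*} {R : ParentTree V} {G : SimpleGraph V} {φ : V} {T : ℝ} {n N c : ℕ}

/-- The vertices joined to `v` by open edges are contained in the finite set of those joined to an
ancestor of `v` by open paths away from the root. -/
theorem Presents.exists_finite_closed (hR : R.Presents G φ) {B : Set (Bar G)} (hc : c < N)
    (h : ∀ u, ∃ k, ¬ R.OpenChain (R.barBits T N B) c k u) (v : V) :
    ∃ S : Set V, S.Finite ∧ v ∈ S ∧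
      ∀ b ∈ B, b.2 ∈ Set.Ico (c * (T / N)) ((c + 1) * (T / N)) →
        ∀ x ∈ S, ∀ y, (b.1 : Sym2 V) = s(x, y) → y ∈ S := by
  choose k hk using h
  set step : V → V → Prop := fun x y => y ∈ R.children x ∧ (y, c) ∈ R.barBits T N B with hstep
  have hdepth : ∀ u x, Relation.ReflTransGen step u x →
      ∃ m, R.depth x = R.depth u + m ∧ R.OpenChain (R.barBits T N B) c m u := by
    intro u x hux
    induction hux using Relation.ReflTransGen.head_induction_on with
    | refl => exact ⟨0, rfl, trivial⟩
    | head h1 _ ih =>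
      obtain ⟨m, hm, ho⟩ := ih
      have := depth_child h1.1
      exact ⟨m + 1, by omega, _, h1.1, h1.2, ho⟩
  refine ⟨{x | ∃ u, R.Below u v ∧ Relation.ReflTransGen step u x}, ?_, ⟨v, Below.refl v, .refl⟩, ?_⟩
  · refine ((hR.finite_depth_le (R.depth v)).biUnion fun u _ =>
      hR.finite_depth_le (R.depth u + k u)).subset ?_
    rintro x ⟨u, hu, hx⟩
    refine Set.mem_biUnion (x := u) hu.depth_le ?_
    obtain ⟨m, hm, ho⟩ := hdepth u x hx
    by_contra hlt
    simp only [Set.mem_ofPred_eq, not_le] at hlt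
    exact hk u (ho.mono (by omega))
  · rintro b hb hbc x ⟨u, hu, hx⟩ y hxy
    have hadj : G.Adj x y := by
      have := b.1.2
      rwa [hxy] at this
    rcases hR.adj_iff.1 hadj with hy | hy
    · refine ⟨u, hu, hx.tail ⟨hy, mem_barBits.2 ⟨⟨(R.mem_children.1 hy).2, hc⟩, b, hb, ?_, hbc⟩⟩⟩
      rw [hxy, parent_child hy, Sym2.eq_swap]
    · rcases Relation.ReflTransGen.cases_tail hx with rfl | ⟨w, hw, hwx⟩
      · exact ⟨y, ((Below.refl y).child hy).trans hu, .refl⟩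
      · have : w = y := (parent_child hwx.1).symm.trans (parent_child hy)
        exact ⟨u, hu, this ▸ hw⟩

variable [MeasurableSpace Ω] {P : Measure Ω} [IsProbabilityMeasure P] {B : Ω → Set (Bar G)}

theorem Presents.ae_isGoodBars (hR : R.Presents G φ) {M : ℕ}
    (hM : ∀ x, (R.children x).card ≤ M) (hT : 0 < T)
    (hB : IsPoissonBars G T P B) : ∀ᵐ ω ∂P, IsGoodBars T (B ω) := by
  have := hR.countable
  obtain ⟨N, hN⟩ := exists_nat_gt (M * T)
  have hN' : (0 : ℝ) < N := lt_of_le_of_lt (by positivity) hN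
  have hN0 : 0 < N := by exact_mod_cast hN'
  have hr : 0 ≤ 1 - Real.exp (-(T / N)) := by
    have : Real.exp (-(T / N)) ≤ 1 := Real.exp_le_one_iff.2 (by
      have : 0 < T / N := div_pos hT hN'
      linarith)
    linarith
  have hMr : M * (1 - Real.exp (-(T / N))) < 1 := by
    have h1 := Real.add_one_le_exp (-(T / N))
    calc M * (1 - Real.exp (-(T / N))) ≤ M * (T / N) :=
          mul_le_mul_of_nonneg_left (by linarith) (Nat.cast_nonneg M)
      _ = M * T / N := by ring
      _ < 1 := (div_lt_one hN').2 hN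
  have hopen : ∀ᵐ ω ∂P, ∀ c : Fin N, ∀ u, ∃ k, ¬ R.OpenChain (R.barBits T N (B ω)) c k u :=
    ae_all_iff.2 fun c => ae_all_iff.2 fun u =>
      ae_exists_not_openChain (hR.isBernoulliSet_barBits hT hN0 hB) hr hM hMr c.2 u
  have hcrowd : ∀ᵐ ω ∂P, ∀ n, ∃ N > 0, ¬ R.Crowded T n N (B ω) :=
    ae_all_iff.2 fun n => hR.ae_exists_not_crowded hT hB n
  have hfin : ∀ᵐ ω ∂P, ∀ v, (B ω ∩ {e : G.edgeSet | v ∈ (e : Sym2 V)} ×ˢ Set.univ).Finite := by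
    refine ae_all_iff.2 fun v => hB.ae_inter_finite
      ((measurableSet_edges _).prod MeasurableSet.univ) ?_
    rw [barMeasure, Measure.prod_prod, Measure.restrict_apply MeasurableSet.univ, Set.univ_inter,
      Real.volume_Ico]
    exact ENNReal.mul_lt_top ((Measure.count_apply_lt_top' (measurableSet_edges _)).2
      (hR.finite_edges_at v)) ENNReal.ofReal_lt_top
  filter_upwards [hopen, hcrowd, hfin] with ω h1 h2 h3
  refine ⟨fun v => ?_, ?_, ?_⟩
  · refine ((h3 v).image Prod.snd).subset ?_
    rintro h ⟨b, hb, hv, rfl⟩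
    exact ⟨b, ⟨hb, hv, trivial⟩, rfl⟩
  · intro b hb b' hb' v hv hv' hbb'
    obtain ⟨z, hz, he⟩ := hR.exists_label b.1
    obtain ⟨z', hz', he'⟩ := hR.exists_label b'.1
    obtain ⟨N', hN', hnc⟩ := h2 (R.depth z + R.depth z')
    obtain ⟨c, hc, hcell⟩ := exists_cell hT hN' (hB.height_mem ω b hb)
    exact eq_of_not_crowded hnc hc hb hb' ⟨z, hz, by omega, he⟩ ⟨z', hz', by omega, he'⟩ hcell
      (hbb' ▸ hcell)
  · intro h hh
    obtain ⟨c, hc, hc1, hc2⟩ := exists_cell_left hT hN0 hh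
    refine ⟨c * (T / N), hc1, fun v => ?_⟩
    obtain ⟨S, hS, hv, hcl⟩ := hR.exists_finite_closed hc (h1 ⟨c, hc⟩) v
    exact ⟨S, hS, hv, fun b hb hbh => hcl b hb ⟨hbh.1.le, hbh.2.trans_le hc2⟩⟩

/-- Almost surely no bar has a height on a grid. -/
theorem ae_ne_grid (hB : IsPoissonBars G T P B) :
    ∀ᵐ ω ∂P, ∀ (N c : ℕ), ∀ b ∈ B ω, b.2 ≠ c * (T / N) := by
  refine ae_all_iff.2 fun N => ae_all_iff.2 fun c => ?_
  have h := hB.ae_inter_eq_empty (A := Set.univ ×ˢ {c * (T / N)})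
    (MeasurableSet.univ.prod (measurableSet_singleton _)) ?_
  · filter_upwards [h] with ω hω b hb hbc
    have : b ∈ B ω ∩ Set.univ ×ˢ {c * (T / N)} := ⟨hb, trivial, hbc⟩
    rw [hω] at this
    exact this
  · rw [barMeasure, Measure.prod_prod]
    simp

end ParentTree

/-! ### The meander -/

section Clock

variable {T : ℝ} (hT : 0 < T)

theorem cyclicHeight_cyclicHeight (h : ℝ) (s t : ℝ≥0) :
    cyclicHeight hT (cyclicHeight hT h s) t = cyclicHeight hT h (s + t) := by
  unfold cyclicHeight
  rw [toIcoMod_eq_iff]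
  refine ⟨toIcoMod_mem_Ico hT 0 _, toIcoDiv hT 0 (h + ↑(s + t)) - toIcoDiv hT 0 (h + s), ?_⟩
  have h1 := toIcoMod_add_toIcoDiv_zsmul hT 0 (h + s)
  have h2 := toIcoMod_add_toIcoDiv_zsmul hT 0 (h + ↑(s + t))
  rw [sub_smul]
  push_cast at h1 h2 ⊢
  linarith

theorem cyclicHeight_zero_zero : cyclicHeight hT 0 0 = 0 := by
  unfold cyclicHeight
  rw [toIcoMod_eq_iff]
  exact ⟨⟨by simp, by simpa using hT⟩, 0, by simp⟩

theorem cyclicHeight_eq {t : ℝ≥0} {h : ℝ} (hh : h ∈ Set.Ico 0 T) (z : ℤ)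
    (h' : (t : ℝ) = h + z * T) : cyclicHeight hT 0 t = h := by
  unfold cyclicHeight
  rw [toIcoMod_eq_iff]
  exact ⟨by simpa using hh, z, by simp [h']⟩

/-- A bounded set of times with finitely many heights is finite. -/
theorem finite_cyclicHeight_mem {H : Set ℝ} (hH : H.Finite) (t : ℝ≥0) :
    {u : ℝ≥0 | u ≤ t ∧ cyclicHeight hT 0 u ∈ H}.Finite := by
  refine Set.Finite.of_finite_image (f := fun u : ℝ≥0 =>
    (toIcoDiv hT 0 (u : ℝ), toIcoMod hT 0 (u : ℝ))) ?_ ?_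
  · refine ((Set.finite_Icc (0 : ℤ) ⌊(t : ℝ) / T⌋).prod hH).subset ?_
    rintro _ ⟨u, ⟨hu, huH⟩, rfl⟩
    simp only [cyclicHeight, zero_add] at huH
    refine ⟨?_, huH⟩
    simp only [toIcoDiv_eq_floor, sub_zero, Set.mem_Icc]
    have hut : (u : ℝ) ≤ t := by exact_mod_cast hu
    exact ⟨Int.floor_nonneg.2 (by positivity), Int.floor_le_floor (by gcongr)⟩
  · intro u _ u' _ h
    have h1 := toIcoMod_add_toIcoDiv_zsmul hT 0 (u : ℝ)
    have h2 := toIcoMod_add_toIcoDiv_zsmul hT 0 (u' : ℝ)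
    simp only [Prod.mk.injEq] at h
    rw [h.1, h.2, h2] at h1
    exact_mod_cast h1.symm

/-- Just before a given time, the height is an affine function of time. -/
theorem exists_cyclicHeight_left (t : ℝ≥0) : ∃ h ∈ Set.Ioc 0 T,
    ∀ u : ℝ≥0, u < t → (t : ℝ) - h ≤ u → cyclicHeight hT 0 u = u - (t - h) := by
  have hmem := toIocMod_mem_Ioc hT 0 (t : ℝ)
  rw [zero_add] at hmem
  refine ⟨toIocMod hT 0 (t : ℝ), hmem, fun u hut hu => ?_⟩
  have h1 := toIocMod_add_toIocDiv_zsmul hT 0 (t : ℝ)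
  rw [zsmul_eq_mul] at h1
  have hut' : (u : ℝ) < t := by exact_mod_cast hut
  have h2 := hmem.2
  exact cyclicHeight_eq hT ⟨by linarith, by linarith⟩ (toIocDiv hT 0 (t : ℝ)) (by linarith)

end Clock

section Meander

variable {V : Type*} {G : SimpleGraph V} {T : ℝ} (hT : 0 < T) (B : Set (Bar G))

/-- At time `t`, the height of the meander is that of a joint at `v`. -/
def JointAt (v : V) (t : ℝ≥0) : Prop := IsJoint B v (cyclicHeight hT 0 t)

/-- The meander that is at the vertex `p.1` at time `p.2` remains there until time `q.2`, when it
goes to `q.1`. To have infinitely many steps even if no further joint is met, a step may also end,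
with no change of the vertex, after a unit of time. -/
structure IsStep (p q : V × ℝ≥0) : Prop where
  lt : p.2 < q.2
  not_jointAt : ∀ u, p.2 < u → u < q.2 → ¬ JointAt hT B p.1 u
  jump : ∀ b ∈ B, ∀ w, (b.1 : Sym2 V) = s(p.1, w) → b.2 = cyclicHeight hT 0 q.2 → q.1 = w
  stay : ¬ JointAt hT B p.1 q.2 → q.1 = p.1
  jointAt_or : JointAt hT B p.1 q.2 ∨ q.2 = p.2 + 1

/-- The successive steps of the meander from `(φ, 0)`. -/
structure IsStepSeq (φ : V) (f : ℕ → V × ℝ≥0) : Prop where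
  init : f 0 = (φ, 0)
  step : ∀ k, IsStep hT B (f k) (f (k + 1))
  unbounded : ∀ t, ∃ k, t < (f k).2

variable {hT} {B}

theorem IsStep.exists_bar {p q : V × ℝ≥0} (h : IsStep hT B p q) (hj : JointAt hT B p.1 q.2) :
    ∃ b ∈ B, (b.1 : Sym2 V) = s(p.1, q.1) ∧ b.2 = cyclicHeight hT 0 q.2 := by
  obtain ⟨b, hb, hv, hh⟩ := hj
  obtain ⟨w, hw⟩ := Sym2.mem_iff_exists.1 hv
  refine ⟨b, hb, ?_, hh⟩
  rw [hw, h.jump b hb w hw hh]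

theorem IsGoodBars.exists_isStep (hB : IsGoodBars T B) (p : V × ℝ≥0) :
    ∃ q, IsStep hT B p q := by
  obtain ⟨v, t⟩ := p
  set F : Set ℝ≥0 := insert (t + 1) {u | t < u ∧ u ≤ t + 1 ∧ JointAt hT B v u} with hF
  have hFfin : F.Finite := by
    refine Set.Finite.insert _ ((finite_cyclicHeight_mem hT (hB.finite_joints v) (t + 1)).subset ?_)
    rintro u ⟨-, h1, h2⟩
    exact ⟨h1, h2⟩
  obtain ⟨t', ht', hmin⟩ := Set.exists_min_image F id hFfin ⟨t + 1, Set.mem_insert _ _⟩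
  have hlt : t < t' := by
    rcases ht' with rfl | h
    · exact lt_add_one t
    · exact h.1
  have hle : t' ≤ t + 1 := hmin _ (Set.mem_insert _ _)
  have hno : ∀ u, t < u → u < t' → ¬ JointAt hT B v u := fun u h1 h2 h3 =>
    absurd (hmin u (Or.inr ⟨h1, h2.le.trans hle, h3⟩)) (not_le.2 h2)
  have hor : JointAt hT B v t' ∨ t' = t + 1 := by
    rcases ht' with h | h
    · exact Or.inr h
    · exact Or.inl h.2.2
  by_cases hj : JointAt hT B v t'
  · obtain ⟨b, hb, hv, hh⟩ := hj
    obtain ⟨w, hw⟩ := Sym2.mem_iff_exists.1 hv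
    refine ⟨(w, t'), hlt, hno, fun b' hb' w' hw' hh' => ?_, fun h => absurd ⟨b, hb, hv, hh⟩ h, hor⟩
    have : b' = b := hB.unique b' hb' b hb v (by rw [hw']; exact Sym2.mem_mk_left _ _) hv
      (Eq.trans hh' hh.symm)
    rw [this, hw] at hw'
    exact Sym2.congr_right.1 hw'
  · refine ⟨(v, t'), hlt, hno, fun b hb w hw hh => absurd ⟨b, hb, ?_, hh⟩ hj, fun _ => rfl, hor⟩
    rw [hw]
    exact Sym2.mem_mk_left _ _

theorem IsGoodBars.exists_isStepSeq (hB : IsGoodBars T B) (φ : V) :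
    ∃ f, IsStepSeq hT B φ f := by
  choose g hg using fun p => hB.exists_isStep (hT := hT) p
  set f : ℕ → V × ℝ≥0 := fun k => g^[k] (φ, 0) with hf
  have hstep : ∀ k, IsStep hT B (f k) (f (k + 1)) := fun k => by
    have : f (k + 1) = g (f k) := Function.iterate_succ_apply' _ _ _
    rw [this]
    exact hg _
  refine ⟨f, rfl, hstep, ?_⟩
  by_contra! hbdd
  obtain ⟨t₀, ht₀⟩ := hbdd
  have hmono : StrictMono fun k => (f k).2 := strictMono_nat_of_lt_succ fun k => (hstep k).lt
  have hba : BddAbove (Set.range fun k => (f k).2) := ⟨t₀, by rintro _ ⟨k, rfl⟩; exact ht₀ k⟩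
  -- The times of the steps increase to a limit `t`, before which there are infinitely many jumps.
  have htend := tendsto_atTop_ciSup hmono.monotone hba
  have hltt : ∀ k, (f k).2 < ⨆ k, (f k).2 := fun k =>
    (hmono (Nat.lt_succ_self k)).trans_le (le_ciSup hba (k + 1))
  set t := ⨆ k, (f k).2 with ht
  obtain ⟨h, hh, hclock⟩ := exists_cyclicHeight_left hT t
  obtain ⟨a, ha, hS⟩ := hB.exists_finite h hh
  obtain ⟨δ, hδ, hδ1, hδa, hδh⟩ : ∃ δ : ℝ, 0 < δ ∧ δ ≤ 1 ∧ δ ≤ h - a ∧ δ ≤ h :=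
    ⟨min 1 (min (h - a) h), lt_min one_pos (lt_min (by linarith) hh.1), min_le_left _ _,
      (min_le_right _ _).trans (min_le_left _ _), (min_le_right _ _).trans (min_le_right _ _)⟩
  have htend' : Tendsto (fun k => ((f k).2 : ℝ)) atTop (𝓝 (t : ℝ)) :=
    NNReal.tendsto_coe.2 htend
  obtain ⟨K, hK⟩ := eventually_atTop.1 (htend'.eventually (lt_mem_nhds (sub_lt_self (t : ℝ) hδ)))
  have hlttR : ∀ k, ((f k).2 : ℝ) < t := fun k => by exact_mod_cast hltt k
  have hval : ∀ k, K ≤ k → cyclicHeight hT 0 (f k).2 = (f k).2 - (t - h) := fun k hk =>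
    hclock _ (hltt k) (by have := hK k hk; linarith)
  have hjoint : ∀ k, K ≤ k → JointAt hT B (f k).1 (f (k + 1)).2 := fun k hk => by
    refine (hstep k).jointAt_or.resolve_right fun h1 => ?_
    have h2 := hlttR (k + 1)
    rw [h1] at h2
    push_cast at h2
    have := hK k hk
    linarith
  obtain ⟨S, hSfin, hKS, hcl⟩ := hS (f K).1
  have hmemS : ∀ k, K ≤ k → (f k).1 ∈ S := fun k hk => by
    induction k, hk using Nat.le_induction with
    | base => exact hKS
    | succ k hk ih =>
      obtain ⟨b, hb, he, hbh⟩ := (hstep k).exists_bar (hjoint k hk)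
      refine hcl b hb ?_ _ ih _ he
      rw [hbh, hval (k + 1) (by omega)]
      have h1 := hlttR (k + 1)
      have h2 := hK (k + 1) (by omega)
      constructor <;> linarith
  have hfin : (⋃ v ∈ S, {h | IsJoint B v h}).Finite :=
    hSfin.biUnion fun v _ => hB.finite_joints v
  refine Set.infinite_range_of_injective (f := fun k => cyclicHeight hT 0 (f (K + k + 1)).2) ?_
    (hfin.subset ?_)
  · intro k k' hkk
    simp only at hkk
    rw [hval _ (by omega), hval _ (by omega)] at hkk
    have h1 : (f (K + k + 1)).2 = (f (K + k' + 1)).2 := by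
      have : ((f (K + k + 1)).2 : ℝ) = (f (K + k' + 1)).2 := by linarith
      exact_mod_cast this
    have := hmono.injective h1
    omega
  · rintro _ ⟨k, rfl⟩
    exact Set.mem_biUnion (hmemS (K + k) (by omega)) (hjoint (K + k) (by omega))

namespace IsStepSeq

variable {φ : V} {f : ℕ → V × ℝ≥0}

theorem strictMono (hf : IsStepSeq hT B φ f) : StrictMono fun k => (f k).2 :=
  strictMono_nat_of_lt_succ fun k => (hf.step k).lt

theorem exists_index (hf : IsStepSeq hT B φ f) (t : ℝ≥0) :
    ∃ k, (f k).2 ≤ t ∧ t < (f (k + 1)).2 := by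
  classical
  have hpos : Nat.find (hf.unbounded t) ≠ 0 := fun h => by
    have := Nat.find_spec (hf.unbounded t)
    rw [h, hf.init] at this
    exact not_lt_zero this
  obtain ⟨k, hk⟩ := Nat.exists_eq_succ_of_ne_zero hpos
  refine ⟨k, not_lt.1 (Nat.find_min (hf.unbounded t) (by omega)), ?_⟩
  have := Nat.find_spec (hf.unbounded t)
  rwa [hk] at this

theorem index_unique (hf : IsStepSeq hT B φ f) {t : ℝ≥0} {k k' : ℕ} (h1 : (f k).2 ≤ t)
    (h2 : t < (f (k + 1)).2) (h1' : (f k').2 ≤ t) (h2' : t < (f (k' + 1)).2) : k = k' := by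
  have h3 := hf.strictMono.lt_iff_lt.1 (h1.trans_lt h2')
  have h4 := hf.strictMono.lt_iff_lt.1 (h1'.trans_lt h2)
  omega

/-- Steps that do not meet a joint do not change the vertex. -/
theorem eq_of_not_jointAt (hf : IsStepSeq hT B φ f) {k m : ℕ} (hkm : k ≤ m) {s t : ℝ≥0}
    (hs : s < (f (k + 1)).2) (ht : (f m).2 ≤ t)
    (h : ∀ u, s < u → u ≤ t → ¬ JointAt hT B (f k).1 u) : (f m).1 = (f k).1 := by
  induction m, hkm using Nat.le_induction with
  | base => rfl
  | succ m hkm ih =>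
    have h1 := ih ((hf.step m).lt.le.trans ht)
    rw [← h1]
    refine (hf.step m).stay ?_
    rw [h1]
    exact h _ (hs.trans_le (hf.strictMono.monotone (by omega : k + 1 ≤ m + 1))) ht

/-- All meanders follow the steps. -/
theorem eq_of_isMeander (hf : IsStepSeq hT B φ f) {X : ℝ≥0 → V × ℝ}
    (hX : IsMeander hT B (φ, 0) X) (k : ℕ) {t : ℝ≥0} (h1 : (f k).2 ≤ t)
    (h2 : t < (f (k + 1)).2) : X t = ((f k).1, cyclicHeight hT 0 t) := by
  have key : ∀ k, X (f k).2 = ((f k).1, cyclicHeight hT 0 (f k).2) → ∀ t, (f k).2 ≤ t →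
      t < (f (k + 1)).2 → X t = ((f k).1, cyclicHeight hT 0 t) := by
    intro k hk t h1 h2
    rcases h1.eq_or_lt with rfl | h1
    · exact hk
    · obtain ⟨r, hr, rfl⟩ := exists_pos_add_of_lt' h1
      have h3 := hX.flow (f k).2 r hr
      rw [hk] at h3
      simp only [cyclicHeight_cyclicHeight] at h3
      refine h3 fun u hu hur => (hf.step k).not_jointAt _ (lt_add_of_pos_right _ hu) ?_
      exact (add_le_add_right hur _).trans_lt h2
  refine key k ?_ t h1 h2
  clear h1 h2
  induction k with
  | zero => rw [hf.init, hX.init, cyclicHeight_zero_zero]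
  | succ k ih =>
    obtain ⟨r, hr, hrk⟩ := exists_pos_add_of_lt' (hf.step k).lt
    have hno : ∀ u, 0 < u → u < r →
        ¬ JointAt hT B (f k).1 ((f k).2 + u) := fun u hu hur =>
      (hf.step k).not_jointAt _ (lt_add_of_pos_right _ hu) (by rw [← hrk]; gcongr)
    rw [← hrk]
    by_cases hj : JointAt hT B (f k).1 (f (k + 1)).2
    · obtain ⟨b, hb, he, hh⟩ := (hf.step k).exists_bar hj
      have h3 := hX.jump (f k).2 r hr
      rw [ih] at h3
      simp only [cyclicHeight_cyclicHeight] at h3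
      exact h3 hno b hb _ he (by rw [hh, hrk])
    · have h3 := hX.flow (f k).2 r hr
      rw [ih] at h3
      simp only [cyclicHeight_cyclicHeight] at h3
      rw [(hf.step k).stay hj]
      refine h3 fun u hu hur => ?_
      rcases hur.eq_or_lt with rfl | hur
      · rw [hrk]; exact hj
      · exact hno u hu hur

theorem exists_isMeander (hf : IsStepSeq hT B φ f) : ∃ X, IsMeander hT B (φ, 0) X := by
  choose i hi1 hi2 using hf.exists_index
  have hi : ∀ {t k}, (f k).2 ≤ t → t < (f (k + 1)).2 → i t = k := fun h1 h2 =>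
    hf.index_unique (hi1 _) (hi2 _) h1 h2
  have hmono : ∀ {s t}, s ≤ t → i s ≤ i t := fun {s t} hst => by
    have := hf.strictMono.lt_iff_lt.1 ((hi1 s).trans_lt (hst.trans_lt (hi2 t)))
    omega
  refine ⟨fun t => ((f (i t)).1, cyclicHeight hT 0 t), ?_, fun s t ht h => ?_,
    fun s t ht h b hb w he hh => ?_, fun s => ?_, fun s => ?_⟩
  · have h1 : i 0 = 0 := hi (by rw [hf.init]) ((zero_le).trans_lt (hf.step 0).lt)
    simp only [h1, hf.init, cyclicHeight_zero_zero]
  · simp only [cyclicHeight_cyclicHeight] at h ⊢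
    refine Prod.ext ?_ rfl
    refine hf.eq_of_not_jointAt (hmono le_self_add) (hi2 s) (hi1 (s + t)) fun u hu hut => ?_
    obtain ⟨r, hr, rfl⟩ := exists_pos_add_of_lt' hu
    exact h r hr (le_of_add_le_add_left hut)
  · simp only [cyclicHeight_cyclicHeight] at h he hh ⊢
    refine Prod.ext ?_ rfl
    have hno : ∀ u, s < u → u < s + t → ¬ JointAt hT B (f (i s)).1 u := fun u hu hut => by
      obtain ⟨r, hr, rfl⟩ := exists_pos_add_of_lt' hu
      exact h r hr (lt_of_add_lt_add_left hut)
    have hj : JointAt hT B (f (i s)).1 (s + t) :=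
      ⟨b, hb, by rw [he]; exact Sym2.mem_mk_left _ _, hh⟩
    have hlt : s < s + t := lt_add_of_pos_right _ ht
    -- The time `s + t` ends a step.
    have hend : (f (i (s + t))).2 = s + t := by
      refine (hi1 (s + t)).eq_of_not_lt fun hlt' => ?_
      have h1 := hf.eq_of_not_jointAt (hmono hlt.le) (hi2 s) le_rfl
        fun u hu hut => hno u hu (hut.trans_lt hlt')
      exact (hf.step (i (s + t))).not_jointAt _ hlt' (hi2 (s + t)) (h1 ▸ hj)
    have hpos : i s < i (s + t) := by
      refine (hmono hlt.le).lt_of_ne fun h1 => ?_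
      have h2 := hi1 s
      rw [h1, hend] at h2
      exact absurd h2 (not_le.2 hlt)
    obtain ⟨m, hm⟩ := Nat.exists_eq_add_of_le' (Nat.zero_lt_of_lt hpos)
    rw [hm] at hend hpos ⊢
    have hlt' : (f m).2 < s + t := hend ▸ (hf.step m).lt
    have h1 : (f m).1 = (f (i s)).1 := hf.eq_of_not_jointAt (by omega) (hi2 s) le_rfl
      fun u hu hut => hno u hu (hut.trans_lt hlt')
    exact (hf.step m).jump b hb w (by rw [he, h1]) (by rw [hh, hend])
  · filter_upwards [Ioo_mem_nhdsGT (hi2 s)] with t ht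
    simp only [hi ((hi1 s).trans ht.1.le) ht.2]
  · rcases eq_or_ne s 0 with rfl | hs
    · exact ⟨φ, by simp⟩
    · obtain ⟨k, hk1, hk2⟩ : ∃ k, (f k).2 < s ∧ s ≤ (f (k + 1)).2 := by
        rcases (hi1 s).eq_or_lt with h1 | h1
        · have : i s ≠ 0 := fun h0 => hs (by rw [← h1, h0, hf.init])
          obtain ⟨m, hm⟩ := Nat.exists_eq_succ_of_ne_zero this
          rw [hm] at h1
          exact ⟨m, h1 ▸ (hf.step m).lt, h1.ge⟩
        · exact ⟨i s, h1, (hi2 s).le⟩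
      refine ⟨(f k).1, ?_⟩
      filter_upwards [Ioo_mem_nhdsLT hk1] with t ht
      simp only [hi ht.1.le (ht.2.trans_le hk2)]

end IsStepSeq

namespace IsGoodBars

variable {φ : V} {X : ℝ≥0 → V × ℝ}

theorem existsUnique_isMeander (hB : IsGoodBars T B) (φ : V) :
    ∃! X, IsMeander hT B (φ, 0) X := by
  obtain ⟨f, hf⟩ := hB.exists_isStepSeq (hT := hT) φ
  obtain ⟨X, hX⟩ := hf.exists_isMeander
  refine ⟨X, hX, fun X' hX' => funext fun t => ?_⟩
  obtain ⟨k, h1, h2⟩ := hf.exists_index t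
  rw [hf.eq_of_isMeander hX k h1 h2, hf.eq_of_isMeander hX' k h1 h2]

theorem snd_eq (hB : IsGoodBars T B) (hX : IsMeander hT B (φ, 0) X) (t : ℝ≥0) :
    (X t).2 = cyclicHeight hT 0 t := by
  obtain ⟨f, hf⟩ := hB.exists_isStepSeq (hT := hT) φ
  obtain ⟨k, h1, h2⟩ := hf.exists_index t
  rw [hf.eq_of_isMeander hX k h1 h2]

theorem finite_visited (hB : IsGoodBars T B) (hX : IsMeander hT B (φ, 0) X) (t : ℝ≥0) :
    {v | ∃ u ≤ t, (X u).1 = v}.Finite := by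
  obtain ⟨f, hf⟩ := hB.exists_isStepSeq (hT := hT) φ
  obtain ⟨K, -, hK⟩ := hf.exists_index t
  refine ((Set.finite_le_nat K).image fun k => (f k).1).subset ?_
  rintro v ⟨u, hu, rfl⟩
  obtain ⟨k, h1, h2⟩ := hf.exists_index u
  have := hf.strictMono.lt_iff_lt.1 (h1.trans_lt (hu.trans_lt hK))
  exact ⟨k, by simp only [Set.mem_ofPred_eq]; omega, by rw [hf.eq_of_isMeander hX k h1 h2]⟩

/-- A meander rests until it meets a joint. -/
theorem rest (hB : IsGoodBars T B) (hX : IsMeander hT B (φ, 0) X) {s t : ℝ≥0} (hst : s ≤ t)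
    (h : ∀ u, s < u → u ≤ t → ¬ JointAt hT B (X s).1 u) : (X t).1 = (X s).1 := by
  rcases hst.eq_or_lt with rfl | hst
  · rfl
  obtain ⟨r, hr, rfl⟩ := exists_pos_add_of_lt' hst
  rw [hX.flow s r hr fun u hu hur => ?_]
  rw [hB.snd_eq hX, cyclicHeight_cyclicHeight]
  exact h _ (lt_add_of_pos_right _ hu) (by gcongr)

theorem jump (hB : IsGoodBars T B) (hX : IsMeander hT B (φ, 0) X) {s t : ℝ≥0} (hst : s < t)
    (h : ∀ u, s < u → u < t → ¬ JointAt hT B (X s).1 u) {b : Bar G} (hb : b ∈ B) {w : V}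
    (he : (b.1 : Sym2 V) = s((X s).1, w)) (hh : b.2 = cyclicHeight hT 0 t) : (X t).1 = w := by
  obtain ⟨r, hr, rfl⟩ := exists_pos_add_of_lt' hst
  rw [hX.jump s r hr (fun u hu hur => ?_) b hb w he
    (by rw [hB.snd_eq hX, cyclicHeight_cyclicHeight, hh])]
  rw [hB.snd_eq hX, cyclicHeight_cyclicHeight]
  exact h _ (lt_add_of_pos_right _ hu) (by gcongr)

end IsGoodBars

end Meander

/-! ### The meander follows the discretised walk -/

/-- The times that are multiples of the length of a cell. -/
noncomputable def gridTime (T : ℝ) (N i : ℕ) : ℝ≥0 := i * (T / N).toNNReal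

section Grid

variable {T : ℝ} (hT : 0 < T) {N i : ℕ} (hN : 0 < N)

theorem coe_gridTime (hT : 0 < T) : (gridTime T N i : ℝ) = i * (T / N) := by
  rw [gridTime, NNReal.coe_mul, NNReal.coe_natCast, Real.coe_toNNReal _ (by positivity)]

theorem gridTime_zero : gridTime T N 0 = 0 := by simp [gridTime]

theorem gridTime_lt_succ (hT : 0 < T) (hN : 0 < N) : gridTime T N i < gridTime T N (i + 1) := by
  have hd : 0 < T / N := div_pos hT (by exact_mod_cast hN)
  rw [← NNReal.coe_lt_coe, coe_gridTime hT, coe_gridTime hT]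
  push_cast
  linarith

theorem gridTime_mono {j : ℕ} (h : i ≤ j) : gridTime T N i ≤ gridTime T N j := by
  unfold gridTime
  gcongr

theorem exists_gridTime (hT : 0 < T) (hN : 0 < N) (t : ℝ≥0) :
    ∃ i, gridTime T N i ≤ t ∧ t < gridTime T N (i + 1) := by
  have hd : 0 < T / N := div_pos hT (by exact_mod_cast hN)
  have h1 := Nat.floor_le (div_nonneg t.2 hd.le)
  have h2 := Nat.lt_floor_add_one ((t : ℝ) / (T / N))
  rw [le_div_iff₀ hd] at h1
  rw [div_lt_iff₀ hd] at h2
  refine ⟨⌊(t : ℝ) / (T / N)⌋₊, ?_, ?_⟩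
  · rw [← NNReal.coe_le_coe, coe_gridTime hT]
    exact h1
  · rw [← NNReal.coe_lt_coe, coe_gridTime hT]
    push_cast
    exact h2

/-- The height during a cell. -/
theorem cyclicHeight_of_gridTime_le {u : ℝ≥0} (hN : 0 < N) (h1 : gridTime T N i ≤ u)
    (h2 : u < gridTime T N (i + 1)) :
    cyclicHeight hT 0 u = u - gridTime T N i + (i % N : ℕ) * (T / N) ∧
      cyclicHeight hT 0 u
        ∈ Set.Ico ((i % N : ℕ) * (T / N)) (((i % N : ℕ) + 1) * (T / N)) := by
  have hN' : (0 : ℝ) < N := by exact_mod_cast hN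
  have hd : 0 < T / N := div_pos hT hN'
  rw [← NNReal.coe_le_coe, coe_gridTime hT] at h1
  rw [← NNReal.coe_lt_coe, coe_gridTime hT] at h2
  push_cast at h2
  have hdiv : (i : ℝ) = N * (i / N : ℕ) + (i % N : ℕ) := by
    exact_mod_cast (Nat.div_add_mod i N).symm
  have hlt : ((i % N : ℕ) : ℝ) + 1 ≤ N := by exact_mod_cast Nat.mod_lt i hN
  have hle : (((i % N : ℕ) : ℝ) + 1) * (T / N) ≤ T := by
    calc _ ≤ N * (T / N) := mul_le_mul_of_nonneg_right hlt hd.le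
      _ = T := by field_simp
  have hpos : 0 ≤ ((i % N : ℕ) : ℝ) * (T / N) := by positivity
  have hmem : (u : ℝ) - i * (T / N) + (i % N : ℕ) * (T / N)
      ∈ Set.Ico ((i % N : ℕ) * (T / N)) (((i % N : ℕ) + 1) * (T / N)) := by
    constructor <;> linarith
  have heq : cyclicHeight hT 0 u = u - i * (T / N) + (i % N : ℕ) * (T / N) := by
    refine cyclicHeight_eq hT ⟨hpos.trans hmem.1, hmem.2.trans_le hle⟩ (i / N : ℕ) ?_
    have h3 : (i : ℝ) * (T / N) = (i / N : ℕ) * T + (i % N : ℕ) * (T / N) := by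
      calc (i : ℝ) * (T / N) = (N * (i / N : ℕ) + (i % N : ℕ)) * (T / N) := by rw [← hdiv]
        _ = _ := by field_simp
    rw [Int.cast_natCast]
    linarith
  rw [coe_gridTime hT, heq]
  exact ⟨rfl, hmem⟩

end Grid

namespace ParentTree

variable {V : Type*} {R : ParentTree V} {G : SimpleGraph V} {φ : V} {T : ℝ}
  {hT : 0 < T} {n N i : ℕ} {B : Set (Bar G)} {X : ℝ≥0 → V × ℝ}

/-- A discretisation of the bars that represents their effect on the walk up to depth `n`
faithfully. -/
structure IsFaithful (R : ParentTree V) (T : ℝ) (n N : ℕ) (B : Set (Bar G)) : Prop where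
  pos : 0 < N
  not_crowded : ¬ R.Crowded T (n + 1) N B
  ne_grid : ∀ c : ℕ, ∀ b ∈ B, b.2 ≠ c * (T / N)

theorem IsFaithful.not_jointAt_gridTime (hF : IsFaithful R T n N B) (v : V) :
    ¬ JointAt hT B v (gridTime T N i) := by
  rintro ⟨b, hb, -, hh⟩
  rw [(cyclicHeight_of_gridTime_le hT hF.pos le_rfl (gridTime_lt_succ hT hF.pos)).1, sub_self,
    zero_add] at hh
  exact hF.ne_grid _ b hb hh

variable [DecidableEq V]

theorem Presents.mem_edgesUpTo_of_mem (hR : R.Presents G φ) {e : G.edgeSet} {v : V}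
    (hv : v ∈ (e : Sym2 V)) (hd : R.depth v ≤ n) : e ∈ R.edgesUpTo G (n + 1) := by
  obtain ⟨z, hz, hz', he⟩ := hR.exists_label_star hv
  refine ⟨z, hz', ?_, he⟩
  rcases mem_star.1 hz with rfl | hz
  · omega
  · have := depth_child hz
    omega

/-- Within one cell, all joints at vertices of depth at most `n` belong to the same bar. -/
theorem IsFaithful.eq_bar (hF : IsFaithful R T n N B) (hR : R.Presents G φ) {b b' : Bar G}
    (hb : b ∈ B) (hb' : b' ∈ B) {v v' : V} (hv : v ∈ (b.1 : Sym2 V)) (hv' : v' ∈ (b'.1 : Sym2 V))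
    (hd : R.depth v ≤ n) (hd' : R.depth v' ≤ n)
    (h : b.2 ∈ Set.Ico ((i % N : ℕ) * (T / N)) (((i % N : ℕ) + 1) * (T / N)))
    (h' : b'.2 ∈ Set.Ico ((i % N : ℕ) * (T / N)) (((i % N : ℕ) + 1) * (T / N))) : b = b' :=
  eq_of_not_crowded hF.not_crowded (Nat.mod_lt i hF.pos) hb hb' (hR.mem_edgesUpTo_of_mem hv hd)
    (hR.mem_edgesUpTo_of_mem hv' hd') h h'

/-- If there is no bar at the current vertex in the current cell, the meander waits. -/
theorem IsFaithful.wait (hF : IsFaithful R T n N B) (hR : R.Presents G φ) (hB : IsGoodBars T B)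
    (hX : IsMeander hT B (φ, 0) X)
    (h : ∀ z ∈ R.star (X (gridTime T N i)).1, (z, i % N) ∉ R.barBits T N B) {t : ℝ≥0}
    (h1 : gridTime T N i ≤ t) (h2 : t ≤ gridTime T N (i + 1)) :
    (X t).1 = (X (gridTime T N i)).1 := by
  refine hB.rest hX h1 fun u hu hut hj => ?_
  rcases (hut.trans h2).eq_or_lt with rfl | hlt
  · exact hF.not_jointAt_gridTime _ hj
  obtain ⟨b, hb, hv, hh⟩ := hj
  obtain ⟨z, hz, hz', he⟩ := hR.exists_label_star hv
  refine h z hz (mem_barBits.2 ⟨⟨hz', Nat.mod_lt i hF.pos⟩, b, hb, he, ?_⟩)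
  rw [hh]
  exact (cyclicHeight_of_gridTime_le hT hF.pos hu.le hlt).2

/-- If there is a bar at the current vertex in the current cell, the meander uses it. -/
theorem IsFaithful.cross (hF : IsFaithful R T n N B) (hR : R.Presents G φ) (hB : IsGoodBars T B)
    (hX : IsMeander hT B (φ, 0) X) {x y : V} (hx : (X (gridTime T N i)).1 = x)
    (hdx : R.depth x ≤ n) (hdy : R.depth y ≤ n) {b : Bar G} (hb : b ∈ B)
    (he : (b.1 : Sym2 V) = s(x, y))
    (hcell : b.2 ∈ Set.Ico ((i % N : ℕ) * (T / N)) (((i % N : ℕ) + 1) * (T / N))) :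
    (X (gridTime T N (i + 1))).1 = y ∧ ∀ t, gridTime T N i ≤ t → t ≤ gridTime T N (i + 1) →
      (X t).1 = x ∨ (X t).1 = y := by
  have hg0 := coe_gridTime (N := N) (i := i) hT
  have hg1 := coe_gridTime (N := N) (i := i + 1) hT
  push_cast at hg1
  have hlow : (i % N : ℕ) * (T / N) < b.2 := lt_of_le_of_ne hcell.1 (hF.ne_grid _ b hb).symm
  have hup := hcell.2
  -- The time at which the meander meets the bar.
  set t₀ : ℝ≥0 := gridTime T N i + (b.2 - (i % N : ℕ) * (T / N)).toNNReal with ht₀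
  have ht₀R : (t₀ : ℝ) = gridTime T N i + (b.2 - (i % N : ℕ) * (T / N)) := by
    rw [ht₀, NNReal.coe_add, Real.coe_toNNReal _ (by linarith)]
  have h1 : gridTime T N i < t₀ := by rw [← NNReal.coe_lt_coe]; linarith
  have h2 : t₀ < gridTime T N (i + 1) := by rw [← NNReal.coe_lt_coe]; linarith
  have hclock : b.2 = cyclicHeight hT 0 t₀ := by
    rw [(cyclicHeight_of_gridTime_le hT hF.pos h1.le h2).1, ht₀R]
    ring
  have hother : ∀ v, R.depth v ≤ n → ∀ u, gridTime T N i ≤ u → u ≤ gridTime T N (i + 1) →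
      JointAt hT B v u → u = t₀ := by
    intro v hv u hu hu' hj
    rcases hu'.eq_or_lt with rfl | hlt
    · exact absurd hj (hF.not_jointAt_gridTime _)
    obtain ⟨b', hb', hv', hh'⟩ := hj
    obtain ⟨h3, h4⟩ := cyclicHeight_of_gridTime_le hT hF.pos hu hlt
    have : b' = b := hF.eq_bar hR hb' hb hv' (by rw [he]; exact Sym2.mem_mk_left x y) hv hdx
      (hh' ▸ h4) hcell
    rw [this, h3] at hh'
    rw [← NNReal.coe_inj]
    linarith
  have hbefore : ∀ t, gridTime T N i ≤ t → t < t₀ → (X t).1 = x := fun t ht ht' => by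
    rw [← hx]
    refine hB.rest hX ht fun u hu hut hj => ?_
    rw [hx] at hj
    have := hother x hdx u hu.le (hut.trans (ht'.le.trans h2.le)) hj
    rw [this] at hut
    exact absurd ht' (not_lt.2 hut)
  have hat : (X t₀).1 = y := by
    refine hB.jump hX h1 (fun u hu hut hj => ?_) hb (by rw [he, hx]) hclock
    rw [hx] at hj
    exact hut.ne (hother x hdx u hu.le (hut.le.trans h2.le) hj)
  have hafter : ∀ t, t₀ ≤ t → t ≤ gridTime T N (i + 1) → (X t).1 = y := fun t ht ht' => by
    rw [← hat]
    refine hB.rest hX ht fun u hu hut hj => ?_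
    rw [hat] at hj
    exact hu.ne' (hother y hdy u (h1.trans hu).le (hut.trans ht') hj)
  refine ⟨hafter _ h2.le le_rfl, fun t ht ht' => ?_⟩
  rcases lt_or_ge t t₀ with h | h
  · exact Or.inl (hbefore t ht h)
  · exact Or.inr (hafter t h ht')

/-- The meander, observed at the multiples of the length of a cell, moves as the discretised walk
does. -/
theorem IsFaithful.step (hF : IsFaithful R T n N B) (hR : R.Presents G φ) (hB : IsGoodBars T B)
    (hX : IsMeander hT B (φ, 0) X) {x y : V} (hx : (X (gridTime T N i)).1 = x)
    (hy : (X (gridTime T N (i + 1))).1 = y) (hd : R.depth x < n) :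
    ((y = x ∧ ∀ z ∈ R.star x, (z, i % N) ∉ R.barBits T N B) ∨
      (y ∈ R.children x ∧ ∀ z ∈ R.star x, (z, i % N) ∈ R.barBits T N B ↔ z = y) ∨
      (y = R.parent x ∧ ∀ z ∈ R.star x, (z, i % N) ∈ R.barBits T N B ↔ z = x)) ∧
    ∀ t, gridTime T N i ≤ t → t ≤ gridTime T N (i + 1) → (X t).1 = x ∨ (X t).1 = y := by
  rcases star_pattern R {z | (z, i % N) ∈ R.barBits T N B} x with h | ⟨z, hz, h⟩ | h |
    ⟨z, hz, z', hz', hne, hb, hb'⟩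
  · have hw := fun {t} => hF.wait (t := t) (i := i) hR hB hX (by rwa [hx])
    have hyx : y = x := by rw [← hy, ← hx]; exact hw (gridTime_mono (by omega)) le_rfl
    exact ⟨Or.inl ⟨hyx, h⟩, fun t h1 h2 => Or.inl (by rw [← hx]; exact hw h1 h2)⟩
  · obtain ⟨-, b, hb, he, hcell⟩ := mem_barBits.1 ((h z (child_mem_star hz)).2 rfl)
    have hc := hF.cross hR hB hX hx hd.le (y := z) (by rw [depth_child hz]; exact hd) hb
      (by rw [he, parent_child hz, Sym2.eq_swap]) hcell
    have hzy : z = y := hc.1.symm.trans hy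
    exact ⟨Or.inr (Or.inl ⟨hzy ▸ hz, hzy ▸ h⟩), fun t h1 h2 => hzy ▸ hc.2 t h1 h2⟩
  · obtain ⟨hs, b, hb, he, hcell⟩ := mem_barBits.1 ((h x (self_mem_star x)).2 rfl)
    have hp := R.depth_parent hs.1
    have hc := hF.cross hR hB hX hx hd.le (y := R.parent x) (by simp only at hp; omega) hb he hcell
    have hzy : R.parent x = y := hc.1.symm.trans hy
    exact ⟨Or.inr (Or.inr ⟨hzy.symm, h⟩), fun t h1 h2 => hzy ▸ hc.2 t h1 h2⟩
  · obtain ⟨hs, b, hb, he, hcell⟩ := mem_barBits.1 hb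
    obtain ⟨hs', b', hb', he', hcell'⟩ := mem_barBits.1 hb'
    have hmem : ∀ {z}, z ∈ R.star x → 0 < R.depth z → x ∈ s(z, R.parent z) := fun {z} hz _ => by
      rcases mem_star.1 hz with rfl | hz
      · exact Sym2.mem_mk_left _ _
      · rw [parent_child hz]
        exact Sym2.mem_mk_right _ _
    have := hF.eq_bar hR hb hb' (he ▸ hmem hz hs.1) (he' ▸ hmem hz' hs'.1) hd.le hd.le hcell hcell'
    rw [this] at he
    exact absurd (label_unique hs.1 hs'.1 (he.symm.trans he')) hne

/-- If the discretised walk starts with an escape, the meander does not come back to the root after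
the time `T` before it has reached depth `n`. -/
theorem IsFaithful.ne_root (hF : IsFaithful R T n N B) (hR : R.Presents G φ)
    (hB : IsGoodBars T B) (hX : IsMeander hT B (φ, 0) X)
    (hS : R.StartEscapes n N (R.barBits T N B) φ) {s : ℝ≥0} (hs : T < s)
    (hd : ∀ u ≤ s, R.depth (X u).1 < n) : (X s).1 ≠ φ := by
  obtain ⟨y, hy, j, hj, hone, hesc⟩ := hS
  have hN' : (0 : ℝ) < N := by exact_mod_cast hF.pos
  have hroot : R.depth φ = 0 := hR.depth_eq_zero_iff.2 rfl
  have hbit : ∀ z ∈ R.star φ, ∀ c < N, (z, c) ∈ R.barBits T N B ↔ z = y ∧ c = j := by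
    intro z hz c hc
    rcases mem_star.1 hz with rfl | hz
    · refine ⟨fun h => ?_, fun h => absurd h.1 (ne_of_mem_children hy).symm⟩
      have := (mem_barBits.1 h).1.1
      simp only at this
      omega
    · exact hone z hz c hc
  have hTs : gridTime T N N < s := by
    rw [← NNReal.coe_lt_coe, coe_gridTime hT]
    calc (N : ℝ) * (T / N) = T := by field_simp
      _ < s := hs
  have hwait : ∀ i ≤ j, (X (gridTime T N i)).1 = φ := by
    intro i hi
    induction i with
    | zero => rw [gridTime_zero, hX.init]
    | succ i ih =>
      have h1 := ih (by omega)
      rw [← h1]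
      refine hF.wait hR hB hX (fun z hz => ?_) (gridTime_mono (by omega)) le_rfl
      rw [h1] at hz
      rw [hbit z hz _ (Nat.mod_lt _ hF.pos), Nat.mod_eq_of_lt (by omega)]
      omega
  have hgs : ∀ {i}, i ≤ N → gridTime T N i ≤ s := fun hi => (gridTime_mono hi).trans hTs.le
  have hfirst : (X (gridTime T N (j + 1))).1 = y := by
    have hφ := hwait j le_rfl
    have hdφ := hd _ (hgs hj.le)
    rw [hφ] at hdφ
    have hyj := (hbit y (child_mem_star hy) (j % N) (Nat.mod_lt _ hF.pos)).2
      ⟨rfl, Nat.mod_eq_of_lt hj⟩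
    rcases (hF.step hR hB hX hφ rfl hdφ).1 with ⟨-, h⟩ | ⟨-, h⟩ | ⟨-, h⟩
    · exact absurd hyj (h y (child_mem_star hy))
    · exact ((h y (child_mem_star hy)).1 hyj).symm
    · exact absurd ((h y (child_mem_star hy)).1 hyj) (ne_of_mem_children hy)
  have hnext : ∀ i, gridTime T N i ≤ s → R.Below y (X (gridTime T N i)).1 →
      (∀ k, ¬ R.Exits n N (R.barBits T N B) y k (X (gridTime T N i)).1 i) →
      R.Below y (X (gridTime T N (i + 1))).1 ∧
        ∀ k, ¬ R.Exits n N (R.barBits T N B) y k (X (gridTime T N (i + 1))).1 (i + 1) := by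
    intro i hi hbel hex
    have hdi := hd _ hi
    rcases (hF.step hR hB hX rfl rfl hdi).1 with ⟨h1, h⟩ | ⟨h1, h⟩ | ⟨h1, h⟩
    · rw [h1]
      exact ⟨hbel, fun k hk => hex (k + 1) ((exits_succ_none hdi h).2 hk)⟩
    · exact ⟨hbel.child h1, fun k hk => hex (k + 1) ((exits_succ_child hdi h1 h).2 hk)⟩
    · rw [h1]
      have h2 := fun k => mt (exits_succ_up (w := y) (k := k) hdi h).2 (hex (k + 1))
      simp only [not_or] at h2
      exact ⟨hbel.parent (h2 0).1, fun k => (h2 k).2⟩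
  have hinv : ∀ i, j + 1 ≤ i → gridTime T N i ≤ s → R.Below y (X (gridTime T N i)).1 ∧
      ∀ k, ¬ R.Exits n N (R.barBits T N B) y k (X (gridTime T N i)).1 i := by
    intro i hi
    induction i, hi using Nat.le_induction with
    | base => exact fun _ => by rw [hfirst]; exact ⟨Below.refl y, hesc⟩
    | succ i hi ih =>
      intro h
      have h1 := (gridTime_mono (by omega : i ≤ i + 1)).trans h
      obtain ⟨h2, h3⟩ := ih h1
      exact hnext i h1 h2 h3
  obtain ⟨i, hi1, hi2⟩ := exists_gridTime hT hF.pos s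
  have hNi : N < i + 1 := by
    by_contra h
    exact absurd (hi2.trans_le (gridTime_mono (not_lt.1 h))) (not_lt.2 hTs.le)
  obtain ⟨h1, h2⟩ := hinv i (by omega) hi1
  have h3 := (hnext i hi1 h1 h2).1
  have hφ : ∀ v, R.Below y v → v ≠ φ := by
    rintro v hv rfl
    have := hv.depth_le
    have := depth_child hy
    omega
  rcases (hF.step hR hB hX rfl rfl (hd _ hi1)).2 s hi1 hi2.le with h | h
  · rw [h]; exact hφ _ h1
  · rw [h]; exact hφ _ h3

end ParentTree

/-! ### Transience -/

/-- A variant of the Borel–Cantelli lemma: if each of the sets `E n` has measure at most `c < 1`,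
then with positive probability infinitely many of them fail. -/
theorem exists_measurableSet_infinitely_often {Ω : Type*} [MeasurableSpace Ω] (P : Measure Ω)
    [IsProbabilityMeasure P] (E : ℕ → Set Ω) {c : ℝ≥0∞} (hc : c < 1) (hE : ∀ n, P (E n) ≤ c)
    {good : Ω → Prop} (hgood : ∀ᵐ ω ∂P, good ω) :
    ∃ A, MeasurableSet A ∧ 0 < P A ∧ ∀ ω ∈ A, good ω ∧ ∀ m, ∃ n ≥ m, ω ∉ E n := by
  set C : ℕ → Set Ω := fun m => ⋂ n ≥ m, toMeasurable P (E n) with hC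
  have hCm : ∀ m, MeasurableSet (C m) := fun m =>
    MeasurableSet.iInter fun n => MeasurableSet.iInter fun _ => measurableSet_toMeasurable _ _
  have hmono : Monotone C := fun m m' h =>
    Set.biInter_mono (fun n hn => h.trans hn) fun _ _ => le_rfl
  have hle : P (⋃ m, C m) ≤ c := by
    rw [hmono.measure_iUnion]
    refine iSup_le fun m => (measure_mono (Set.biInter_subset_of_mem (le_refl m))).trans ?_
    rw [measure_toMeasurable]
    exact hE m
  set Z := toMeasurable P {ω | ¬ good ω} with hZ
  have hZ0 : P Z = 0 := by rw [hZ, measure_toMeasurable]; exact hgood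
  refine ⟨((⋃ m, C m) ∪ Z)ᶜ,
    ((MeasurableSet.iUnion hCm).union (measurableSet_toMeasurable _ _)).compl, ?_, ?_⟩
  · rw [prob_compl_eq_one_sub ((MeasurableSet.iUnion hCm).union (measurableSet_toMeasurable _ _)),
      tsub_pos_iff_lt]
    refine (measure_union_le _ _).trans_lt ?_
    rw [hZ0, add_zero]
    exact hle.trans_lt hc
  · intro ω hω
    simp only [Set.mem_compl_iff, Set.mem_union, not_or] at hω
    refine ⟨by_contra fun h => hω.2 (subset_toMeasurable _ _ h), fun m => ?_⟩
    by_contra! h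
    exact hω.1 (Set.mem_iUnion.2 ⟨m, Set.mem_iInter₂.2 fun n hn =>
      subset_toMeasurable _ _ (h n hn)⟩)

theorem proposition1 {V : Type*} [Infinite V] (G : SimpleGraph V) [G.LocallyFinite] (φ : V)
    (htree : G.IsTree) (hdeg : ∃ D : ℕ, ∀ v, G.degree v ≤ D)
    (hoff : ∀ v, 2 ≤ (offspring G φ v).encard) :
    ∃ T₀ : ℝ, 0 < T₀ ∧ ∀ (T : ℝ) (hT : 0 < T), T₀ ≤ T →
      ∀ {Ω : Type*} [MeasurableSpace Ω] (P : Measure Ω) [IsProbabilityMeasure P]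
        (B : Ω → Set (Bar G)), IsPoissonBars G T P B →
        (∀ᵐ ω ∂P, ∃! X : ℝ≥0 → V × ℝ, IsMeander hT (B ω) (φ, 0) X) ∧
        IsTransient P (fun ω => cyclicWalk hT (B ω) φ) φ := by
  classical
  obtain ⟨R, hR, hsub, hcard⟩ := ParentTree.exists_presents G φ htree
  obtain ⟨D, hD⟩ := hdeg
  have htwo : ∀ x, 1 < (R.children x).card := fun x => by
    have h := (hoff x).trans (Set.encard_le_encard (hsub x))
    rw [Set.encard_coe_eq_coe_finsetCard] at h
    exact_mod_cast h
  set M := D + 3 with hM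
  have hchild : ∀ x, (R.children x).card ≤ M := fun x =>
    ((hcard x).trans (hD x)).trans (by omega)
  have hstar : ∀ x, (R.star x).card ≤ M := fun x => by
    have := (hcard x).trans (hD x)
    rw [ParentTree.card_star]
    omega
  have hroot : R.depth φ = 0 := hR.depth_eq_zero_iff.2 rfl
  obtain ⟨T₀, hT₀, p, hp0, hp1, hesc⟩ := ParentTree.exists_escapeBound M (by omega)
  refine ⟨T₀, hT₀, fun T hT hTT₀ {Ω} _ P _ B hB => ?_⟩
  have hgood := hR.ae_isGoodBars hchild hT hB
  refine ⟨?_, ?_⟩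
  · filter_upwards [hgood] with ω hω using hω.existsUnique_isMeander φ
  obtain ⟨N₀, hN₀, hN⟩ := hesc T hTT₀
  -- A lower bound, uniform in the discretisation, for the probability that the walk escapes.
  set c : ℝ := T / 2 * Real.exp (-(T * M)) * p with hc
  have hc0 : 0 < c := by positivity
  have hstart : ∀ n N, N₀ ≤ N →
      P {ω | ¬ R.StartEscapes n N (R.barBits T N (B ω)) φ} ≤ ENNReal.ofReal (1 - c) := by
    intro n N hNN
    obtain ⟨hr0, hr1, hr2, hE⟩ := hN N hNN
    have hNpos : 0 < N := hN₀.trans_le hNN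
    have hNR : (0 : ℝ) < N := by exact_mod_cast hNpos
    have hbits := hR.isBernoulliSet_barBits hT hNpos hB
    refine (ParentTree.measure_not_startEscapes_le (M := M) hbits hr0 hr1 hNpos hroot (hchild φ)
      (by have := htwo φ; omega) hp0.le fun w hw => hE R P _ n w hstar htwo hw hbits).trans ?_
    refine ENNReal.ofReal_le_ofReal (sub_le_sub_left ?_ 1)
    have hpow : (1 - (1 - Real.exp (-(T / N)))) ^ (M * N) = Real.exp (-(T * M)) := by
      rw [sub_sub_cancel, ← Real.exp_nat_mul]
      congr 1
      push_cast
      field_simp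
    rw [hpow, hc]
    gcongr
  choose Nn hNn using fun n => ((eventually_ge_atTop N₀).and
    ((hR.tendsto_measure_crowded hT hB (n + 1)).eventually
      (gt_mem_nhds (ENNReal.ofReal_pos.2 (half_pos (lt_min hc0 one_pos)))))).exists
  set E : ℕ → Set Ω := fun n => {ω | ¬ R.StartEscapes n (Nn n) (R.barBits T (Nn n) (B ω)) φ} ∪
    {ω | R.Crowded T (n + 1) (Nn n) (B ω)} with hEdef
  have hE : ∀ n, P (E n) ≤ ENNReal.ofReal (1 - min c 1 / 2) := fun n => by
    refine (measure_union_le _ _).trans ((add_le_add (hstart n _ (hNn n).1) (hNn n).2.le).trans ?_)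
    have h1 : ENNReal.ofReal (1 - c) ≤ ENNReal.ofReal (1 - min c 1) :=
      ENNReal.ofReal_le_ofReal (sub_le_sub_left (min_le_left _ _) 1)
    refine (add_le_add_left h1 _).trans ?_
    rw [← ENNReal.ofReal_add (by linarith [min_le_right c 1])
      (by have := lt_min hc0 one_pos; positivity)]
    exact ENNReal.ofReal_le_ofReal (by linarith)
  obtain ⟨A, hA, hApos, hAmem⟩ := exists_measurableSet_infinitely_often P E
    (ENNReal.ofReal_lt_one.2 (by have := lt_min hc0 one_pos; linarith)) hE
    (hgood.and (ParentTree.ae_ne_grid hB))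
  refine ⟨A, hA, hApos, fun ω hω => ⟨T.toNNReal, Real.toNNReal_pos.2 hT, fun s hs => ?_⟩⟩
  obtain ⟨⟨hω1, hω2⟩, hio⟩ := hAmem ω hω
  have hex := (hω1.existsUnique_isMeander (hT := hT) φ).exists
  have hX := hex.choose_spec
  simp only [cyclicWalk, dif_pos hex]
  -- Up to time `s` the meander visits vertices of bounded depth only.
  obtain ⟨d, hd⟩ := ((hω1.finite_visited hX s).image R.depth).bddAbove
  obtain ⟨n, hnd, hn⟩ := hio (d + 1)
  simp only [hEdef, Set.mem_union, Set.mem_ofPred_eq, not_or, not_not] at hn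
  have hF : ParentTree.IsFaithful R T n (Nn n) (B ω) :=
    ⟨hN₀.trans_le (hNn n).1, hn.2, hω2 (Nn n)⟩
  refine hF.ne_root hR hω1 hX hn.1 ?_ fun u hu => ?_
  · rw [← Real.coe_toNNReal T hT.le]
    exact_mod_cast hs
  · have := hd ⟨_, ⟨u, hu, rfl⟩, rfl⟩
    omega
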